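/- Let $d\ge 1$ and let $\Omega\subset\mathbb R^d$ be a bounded Lipschitz domain (open, connected, nonempty). Let $\Gamma^D,\Gamma^N$ be disjoint measurable parts of $\partial\Omega$ with $\overline{\Gamma^D\cup\Gamma^N}=\partial\Omega$ and $\Gamma^D$ of positive $(d-1)$-dimensional Hausdorff measure. Let $H^1_D(\Omega)=\{u\in H^1(\Omega): u|_{\Gamma^D}=0\}$ in the sense of traces. Let $\lambda>0$, $z_a\in\mathbb Z$, $p\in[1,\infty]$ with $p>d/2$. Let $S_a<\infty$ and let $F_a:\mathbb R\to(0,S_a)$ be a $C^1$-diffeomorphism with $0<F_a'(\eta)\le F_a(\eta)\le e^{\eta}$ for all $\eta\in\mathbb R$. Let $0<M_a<|\Omega|\,S_a$. Then there is a constant $K>0$, depending only on $\Omega$, $\Gamma^D$, $p$, $\lambda$, $F_a$, $M_a$ and $|z_a|$, such that for every $\psi^D\in H^1(\Omega)\cap L^\infty(\Omega)$, every $f\in L^p(\Omega)$ and every $\sigma\in[0,1]$ there is exactly one pair $(v_a,\psi)\in\mathbb R\times H^1(\Omega)$ with $\psi-\sigma\psi^D\in H^1_D(\Omega)$ that is a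 weak solution of $$-\lambda^2\Delta\psi=\sigma\bigl(f+z_aF_a(v_a-z_a\psi)\bigr)\ \text{in }\Omega,\qquad \psi=\sigma\psi^D\ \text{on }\Gamma^D,\qquad \nabla\psi\cdot\nu=0\ \text{on }\Gamma^N,$$ with the mass constraint $\int_\Omega F_a(v_a-z_a\psi)\,dx=M_a$, that is, such that this constraint holds and for all $\phi\in H^1_D(\Omega)$ $$\lambda^2\int_\Omega\nabla\psi\cdot\nabla\phi\,dx=\sigma\int_\Omega\bigl(f+z_aF_a(v_a-z_a\psi)\bigr)\phi\,dx .$$ Moreover this solution satisfies $$\sigma|v_a|+\|\psi\|_{H^1(\Omega)}^2\le\sigma K\bigl(1+\|\psi^D\|_{H^1(\Omega)}^2+\|f\|_{L^p(\Omega)}^2\bigr).$$ -/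

import Mathlib

open MeasureTheory Filter Set
open scoped ENNReal NNReal Topology ContDiff

/-- `IsLipschitzBoundary Ω`: near every boundary point, in suitable orthonormal coordinates, `Ω` is
the set strictly above the graph of a Lipschitz function. The vertical direction is the unit
vector `e`, the horizontal part of `y` is `y - ⟪e, y⟫ e`, and `γ` is evaluated on horizontal
vectors only. -/
def IsLipschitzBoundary {d : ℕ} (Ω : Set (EuclideanSpace ℝ (Fin d))) : Prop :=
  ∀ x ∈ frontier Ω, ∃ e : EuclideanSpace ℝ (Fin d), ‖e‖ = 1 ∧
    ∃ (L : ℝ≥0) (γ : EuclideanSpace ℝ (Fin d) → ℝ), LipschitzWith L γ ∧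
      ∃ r > 0, ∀ y ∈ Metric.ball x r,
        (y ∈ Ω ↔ γ (y - inner ℝ e y • e) < inner ℝ e y)

/-- Bounded Lipschitz domain: nonempty, open, connected, bounded, with Lipschitz boundary. -/
structure IsBoundedLipschitzDomain {d : ℕ} (Ω : Set (EuclideanSpace ℝ (Fin d))) : Prop where
  isOpen : IsOpen Ω
  isConnected : IsConnected Ω
  isBounded : Bornology.IsBounded Ω
  lipschitz : IsLipschitzBoundary Ω

/-- The `(d-1)`-dimensional Hausdorff measure on `ℝᵈ` (used for `d ≥ 1`). -/
noncomputable def surfaceMeasure (d : ℕ) : Measure (EuclideanSpace ℝ (Fin d)) :=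
  Measure.hausdorffMeasure ((d : ℝ) - 1)

/-- Partition of the boundary of `Ω` into a Dirichlet part `ΓD` of positive surface measure
and a Neumann part `ΓN`. -/
structure IsBoundarySplitting {d : ℕ} (Ω ΓD ΓN : Set (EuclideanSpace ℝ (Fin d))) : Prop where
  measurableSet_dirichlet : MeasurableSet ΓD
  measurableSet_neumann : MeasurableSet ΓN
  disjoint : Disjoint ΓD ΓN
  closure_union : closure (ΓD ∪ ΓN) = frontier Ω
  dirichlet_pos : 0 < surfaceMeasure d ΓD

/-- `F : ℝ → (0, S)` is a `C¹`-diffeomorphism with `0 < F' ≤ F ≤ exp`. (Since `F' > 0`, the inverse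
of a `C¹` bijection is automatically `C¹`.) In particular `S = sup F` is finite. -/
structure IsIonStatistics (F : ℝ → ℝ) (S : ℝ) : Prop where
  contDiff : ContDiff ℝ 1 F
  bijOn : BijOn F univ (Ioo 0 S)
  deriv_pos : ∀ η, 0 < deriv F η
  deriv_le : ∀ η, deriv F η ≤ F η
  le_exp : ∀ η, F η ≤ Real.exp η

/-- `G` is the weak gradient of `u` on the open set `Ω`: for every test function
`φ ∈ C_c^∞(Ω)` and every direction `e`, `∫_Ω u ∂_e φ = - ∫_Ω (G · e) φ`. -/
def IsWeakGradient {d : ℕ} (Ω : Set (EuclideanSpace ℝ (Fin d)))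
    (u : EuclideanSpace ℝ (Fin d) → ℝ)
    (G : EuclideanSpace ℝ (Fin d) → EuclideanSpace ℝ (Fin d)) : Prop :=
  ∀ φ : EuclideanSpace ℝ (Fin d) → ℝ, ContDiff ℝ ∞ φ → HasCompactSupport φ → tsupport φ ⊆ Ω →
    ∀ e : EuclideanSpace ℝ (Fin d),
      ∫ x in Ω, u x * fderiv ℝ φ x e = - ∫ x in Ω, inner ℝ (G x) e * φ x

/-- The Sobolev space `H¹(Ω)`: square integrable functions on `Ω` with a square integrable weak
gradient. The values of `u` outside `Ω` are irrelevant. -/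
def MemH1 {d : ℕ} (Ω : Set (EuclideanSpace ℝ (Fin d))) (u : EuclideanSpace ℝ (Fin d) → ℝ) : Prop :=
  MemLp u 2 (volume.restrict Ω) ∧
    ∃ G : EuclideanSpace ℝ (Fin d) → EuclideanSpace ℝ (Fin d),
      MemLp G 2 (volume.restrict Ω) ∧ IsWeakGradient Ω u G

open Classical in
/-- The weak gradient of `u ∈ H¹(Ω)` (unique up to almost everywhere equality on `Ω`). -/
noncomputable def weakGrad {d : ℕ} (Ω : Set (EuclideanSpace ℝ (Fin d)))
    (u : EuclideanSpace ℝ (Fin d) → ℝ) : EuclideanSpace ℝ (Fin d) → EuclideanSpace ℝ (Fin d) :=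
  if h : MemH1 Ω u then h.2.choose else 0

/-- The norm `‖u‖_{H¹(Ω)} = (‖u‖²_{L²(Ω)} + ‖∇u‖²_{L²(Ω)})^{1/2}`. -/
noncomputable def h1Norm {d : ℕ} (Ω : Set (EuclideanSpace ℝ (Fin d)))
    (u : EuclideanSpace ℝ (Fin d) → ℝ) : ℝ :=
  Real.sqrt ((eLpNorm u 2 (volume.restrict Ω)).toReal ^ 2 +
    (eLpNorm (weakGrad Ω u) 2 (volume.restrict Ω)).toReal ^ 2)

/-- `g` is the trace of `u ∈ H¹(Ω)` on the part `Γ` of the boundary. The trace operator is the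
continuous extension to `H¹(Ω)` of the restriction `s ↦ s|_Γ` of functions `s` that are smooth up to
the boundary: `g` is the limit in `L²(Γ)`, for the surface measure, of the boundary values of smooth
functions that converge to `u` in `H¹(Ω)`. -/
def HasTrace {d : ℕ} (Ω Γ : Set (EuclideanSpace ℝ (Fin d)))
    (u g : EuclideanSpace ℝ (Fin d) → ℝ) : Prop :=
  ∃ s : ℕ → EuclideanSpace ℝ (Fin d) → ℝ, (∀ n, ContDiff ℝ ∞ (s n)) ∧
    Tendsto (fun n => eLpNorm (fun x => s n x - u x) 2 (volume.restrict Ω)) atTop (𝓝 0) ∧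
    Tendsto (fun n => eLpNorm (fun x => gradient (s n) x - weakGrad Ω u x) 2 (volume.restrict Ω))
      atTop (𝓝 0) ∧
    Tendsto (fun n => eLpNorm (fun x => s n x - g x) 2 ((surfaceMeasure d).restrict Γ))
      atTop (𝓝 0)

/-- The space `H¹_D(Ω)` of functions in `H¹(Ω)` whose trace on `ΓD` vanishes. -/
def MemH1D {d : ℕ} (Ω ΓD : Set (EuclideanSpace ℝ (Fin d)))
    (u : EuclideanSpace ℝ (Fin d) → ℝ) : Prop :=
  MemH1 Ω u ∧ HasTrace Ω ΓD u 0

/-- `(v, ψ)` is a weak solution of `-lam² Δψ = σ (f + z F(v - z ψ))` in `Ω`, `ψ = σ ψD` on `ΓD` (and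
the homogeneous Neumann condition on the rest of the boundary), with the mass constraint
`∫_Ω F(v - z ψ) = M`. -/
structure IsPoissonWeakSolution {d : ℕ} (Ω ΓD : Set (EuclideanSpace ℝ (Fin d))) (lam : ℝ) (z : ℤ)
    (F : ℝ → ℝ) (M σ : ℝ) (ψD f : EuclideanSpace ℝ (Fin d) → ℝ)
    (v : ℝ) (ψ : EuclideanSpace ℝ (Fin d) → ℝ) : Prop where
  memH1 : MemH1 Ω ψ
  boundary : MemH1D Ω ΓD (fun x => ψ x - σ * ψD x)
  integrable : ∀ φ, MemH1D Ω ΓD φ →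
    Integrable (fun x => (f x + z * F (v - z * ψ x)) * φ x) (volume.restrict Ω)
  equation : ∀ φ, MemH1D Ω ΓD φ →
    lam ^ 2 * ∫ x in Ω, inner ℝ (weakGrad Ω ψ x) (weakGrad Ω φ x) =
      σ * ∫ x in Ω, (f x + z * F (v - z * ψ x)) * φ x
  mass : ∫ x in Ω, F (v - z * ψ x) = M

/-! ### Weak gradients: linearity, uniqueness, closedness. -/

section WeakGradient

variable {d : ℕ} {Ω ΓD : Set (EuclideanSpace ℝ (Fin d))}

/-! Put u = ψ - σψD and let Φ be the primitive of F with Φ(0) = 0. For σ > 0 the mass constraint and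
the weak equation are the Euler-Lagrange equations, in v and in u respectively, of the single
functional J(v, u) = (λ²/2)‖∇(u + σψD)‖² - σ∫fu + σ(∫Φ(v - zψ) - Mv) on ℝ × H¹_D(Ω). Since F
increases, Φ is convex and J is jointly convex. It is coercive in u by the Poincaré-Friedrichs
inequality. It is coercive in v because M/|Ω| lies strictly between 0 and S = sup F: tangents to Φ
with slopes below and above M/|Ω| make ∫Φ - Mv grow linearly at both ends. A minimizer therefore
exists (`exists_forall_le_of_midpointConvex`, `exists_solution`). For σ = 0 one has u = 0, and only
a scalar equation for v is left.

Uniqueness is monotonicity: the difference of two solutions as test function, together with their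
equal masses, gives a nonnegative quantity equal to a nonpositive one (`unique`). For the estimate,
testing with u and using 0 < F < S bounds ‖∇u‖ by σ times the data (`norm_snd_le`). The tangent
inequality for Φ at the solution, evaluated at zero, then bounds v (`abs_le`).

Two inequalities on Lipschitz domains carry the analysis: Poincaré-Friedrichs
(`exists_poincareFriedrichs`), and the pairing of L^p with H¹ for p > d/2 (`exists_pairing_le`).
Both are proved for smooth functions by integrating the gradient along segments that the cone
property keeps inside Ω. They then pass to the limit, because zero trace is itself defined by smooth
approximants. -/

theorem ofReal_abs_integral_mul_le {α : Type*} [MeasurableSpace α] {μ : Measure α} {a b : α → ℝ}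
    (ha : AEStronglyMeasurable a μ) (hb : AEStronglyMeasurable b μ) :
    ‖∫ x, a x * b x ∂μ‖ₑ ≤ eLpNorm a 2 μ * eLpNorm b 2 μ := by
  refine (enorm_integral_le_lintegral_enorm _).trans ?_
  have h := eLpNorm_smul_le_mul_eLpNorm (p := 2) (q := 2) (r := 1) hb ha
  rw [eLpNorm_one_eq_lintegral_enorm] at h
  exact h

theorem contDiff_gradient {s : EuclideanSpace ℝ (Fin d) → ℝ} (hs : ContDiff ℝ ∞ s) :
    Continuous (gradient s) :=
  (InnerProductSpace.toDual ℝ (EuclideanSpace ℝ (Fin d))).symm.continuous.comp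
    (hs.continuous_fderiv (by simp))

theorem inner_gradient_eq {s : EuclideanSpace ℝ (Fin d) → ℝ} (x e : EuclideanSpace ℝ (Fin d)) :
    inner ℝ (gradient s x) e = fderiv ℝ s x e := by
  simp [gradient]

theorem memLp_of_continuous_of_isBounded {F : Type*} [NormedAddCommGroup F]
    {s : EuclideanSpace ℝ (Fin d) → F} (hs : Continuous s) (hb : Bornology.IsBounded Ω)
    [SecondCountableTopology F] (p : ℝ≥0∞) : MemLp s p (volume.restrict Ω) := by
  have hK : IsCompact (closure Ω) := hb.isCompact_closure
  have hfin : volume (closure Ω) < ⊤ := hK.measure_lt_top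
  have : IsFiniteMeasure (volume.restrict (closure Ω)) := ⟨by simpa using hfin⟩
  obtain ⟨C, hC⟩ := hK.exists_bound_of_continuousOn hs.continuousOn
  have h1 : MemLp s p (volume.restrict (closure Ω)) := by
    refine MemLp.of_bound hs.aestronglyMeasurable C ?_
    exact (ae_restrict_iff' isClosed_closure.measurableSet).2 (Eventually.of_forall hC)
  exact h1.mono_measure (Measure.restrict_mono subset_closure le_rfl)

theorem integrable_mul_testFunction {u φ : EuclideanSpace ℝ (Fin d) → ℝ}
    (hu : MemLp u 2 (volume.restrict Ω)) (hφ : Continuous φ) (hc : HasCompactSupport φ) :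
    Integrable (fun x => u x * φ x) (volume.restrict Ω) :=
  hu.integrable_mul (q := 2) ((hφ.memLp_of_hasCompactSupport hc).restrict Ω)

theorem MeasureTheory.MemLp.inner_right {G : EuclideanSpace ℝ (Fin d) → EuclideanSpace ℝ (Fin d)}
    {p : ℝ≥0∞} {μ : Measure (EuclideanSpace ℝ (Fin d))}
    (hG : MemLp G p μ) (e : EuclideanSpace ℝ (Fin d)) :
    MemLp (fun x => (inner ℝ (G x) e : ℝ)) p μ := by
  have := (innerSL ℝ e).comp_memLp' hG
  refine this.congr_norm (hG.1.inner aestronglyMeasurable_const) ?_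
  exact Eventually.of_forall fun x => by simp [real_inner_comm]

theorem contDiff_isWeakGradient {s : EuclideanSpace ℝ (Fin d) → ℝ}
    (hs : ContDiff ℝ ∞ s) : IsWeakGradient Ω s (gradient s) := by
  intro φ hφ hc hsub e
  have hφ' : Continuous fun x => fderiv ℝ φ x e :=
    (hφ.continuous_fderiv (by simp)).clm_apply continuous_const
  have hs' : Continuous fun x => fderiv ℝ s x e :=
    (hs.continuous_fderiv (by simp)).clm_apply continuous_const
  have hc' : HasCompactSupport fun x => fderiv ℝ φ x e :=
    (hc.fderiv ℝ).comp_left (g := fun L : EuclideanSpace ℝ (Fin d) →L[ℝ] ℝ => L e) rfl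
  have key := integral_mul_fderiv_eq_neg_fderiv_mul_of_integrable (μ := volume) (f := s) (g := φ)
    (v := e) ((hs'.mul hφ.continuous).integrable_of_hasCompactSupport hc.mul_left)
    ((hs.continuous.mul hφ').integrable_of_hasCompactSupport hc'.mul_left)
    ((hs.continuous.mul hφ.continuous).integrable_of_hasCompactSupport hc.mul_left)
    (fun x _ => (hs.differentiable (by simp)) x) (fun x _ => (hφ.differentiable (by simp)) x)
  have h0 : ∀ x, x ∉ Ω → φ x = 0 := fun x hx => image_eq_zero_of_notMem_tsupport
    fun h => hx (hsub h)
  have h0' : ∀ x, x ∉ Ω → fderiv ℝ φ x = 0 := fun x hx => image_eq_zero_of_notMem_tsupport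
    fun h => hx (hsub (tsupport_fderiv_subset ℝ h))
  rw [setIntegral_eq_integral_of_forall_compl_eq_zero (fun x hx => by simp [h0' x hx]),
    setIntegral_eq_integral_of_forall_compl_eq_zero (fun x hx => by simp [h0 x hx]), key]
  simp

theorem IsWeakGradient.combo {u u' : EuclideanSpace ℝ (Fin d) → ℝ}
    {G G' : EuclideanSpace ℝ (Fin d) → EuclideanSpace ℝ (Fin d)}
    (hu : MemLp u 2 (volume.restrict Ω)) (hu' : MemLp u' 2 (volume.restrict Ω))
    (hG : MemLp G 2 (volume.restrict Ω)) (hG' : MemLp G' 2 (volume.restrict Ω))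
    (h : IsWeakGradient Ω u G) (h' : IsWeakGradient Ω u' G') (a b : ℝ) :
    IsWeakGradient Ω (fun x => a * u x + b * u' x) (fun x => a • G x + b • G' x) := by
  intro φ hφ hc hsub e
  have hφ' : Continuous fun x => fderiv ℝ φ x e :=
    (hφ.continuous_fderiv (by simp)).clm_apply continuous_const
  have hc' : HasCompactSupport fun x => fderiv ℝ φ x e :=
    (hc.fderiv ℝ).comp_left (g := fun L : EuclideanSpace ℝ (Fin d) →L[ℝ] ℝ => L e) rfl
  have i1 := integrable_mul_testFunction hu hφ' hc'
  have i2 := integrable_mul_testFunction hu' hφ' hc'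
  have i3 := integrable_mul_testFunction (hG.inner_right e) hφ.continuous hc
  have i4 := integrable_mul_testFunction (hG'.inner_right e) hφ.continuous hc
  have e1 := h φ hφ hc hsub e
  have e2 := h' φ hφ hc hsub e
  calc ∫ x in Ω, (a * u x + b * u' x) * fderiv ℝ φ x e
      = ∫ x in Ω, (a * (u x * fderiv ℝ φ x e) + b * (u' x * fderiv ℝ φ x e)) := by
        congr 1; ext x; ring
    _ = a * -(∫ x in Ω, inner ℝ (G x) e * φ x) + b * -(∫ x in Ω, inner ℝ (G' x) e * φ x) := by
        rw [integral_add (i1.const_mul a) (i2.const_mul b), integral_const_mul, integral_const_mul,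
          e1, e2]
    _ = - ∫ x in Ω, (a * (inner ℝ (G x) e * φ x) + b * (inner ℝ (G' x) e * φ x)) := by
        rw [integral_add (i3.const_mul a) (i4.const_mul b), integral_const_mul, integral_const_mul]
        ring
    _ = _ := by
        congr 2; ext x; rw [inner_add_left, inner_smul_left, inner_smul_left]; simp; ring

/-- The fundamental lemma of the calculus of variations, applied to each coordinate. It makes the
chosen representative `weakGrad` computable almost everywhere. -/
theorem IsWeakGradient.ae_unique (hΩ : IsOpen Ω) {u : EuclideanSpace ℝ (Fin d) → ℝ}
    {G G' : EuclideanSpace ℝ (Fin d) → EuclideanSpace ℝ (Fin d)}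
    (hG : MemLp G 2 (volume.restrict Ω)) (hG' : MemLp G' 2 (volume.restrict Ω))
    (h : IsWeakGradient Ω u G) (h' : IsWeakGradient Ω u G') : G =ᵐ[volume.restrict Ω] G' := by
  have key : ∀ i : Fin d, ∀ᵐ x ∂volume.restrict Ω, G x i = G' x i := by
    intro i
    set e : EuclideanSpace ℝ (Fin d) := EuclideanSpace.single i 1
    have hl : MemLp (fun x => (inner ℝ (G x) e : ℝ) - inner ℝ (G' x) e) 2 (volume.restrict Ω) :=
      (hG.inner_right e).sub (hG'.inner_right e)
    have hloc : LocallyIntegrableOn (fun x => (inner ℝ (G x) e : ℝ) - inner ℝ (G' x) e) Ω volume :=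
      (locallyIntegrableOn_of_locallyIntegrable_restrict (hl.locallyIntegrable (by norm_num)))
    have := hΩ.ae_eq_zero_of_integral_contDiff_smul_eq_zero hloc (fun φ hφ hc hsub => ?_)
    · filter_upwards [(ae_restrict_iff' hΩ.measurableSet).2 this] with x hx
      simpa [e, EuclideanSpace.inner_single_right, sub_eq_zero] using hx
    · have h0 : ∀ x, x ∉ Ω → φ x = 0 := fun x hx => image_eq_zero_of_notMem_tsupport
        fun h => hx (hsub h)
      rw [← setIntegral_eq_integral_of_forall_compl_eq_zero (s := Ω)
        (fun x hx => by simp [h0 x hx])]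
      have i3 := integrable_mul_testFunction (hG.inner_right e) hφ.continuous hc
      have i4 := integrable_mul_testFunction (hG'.inner_right e) hφ.continuous hc
      have e1 := h φ hφ hc hsub e
      have e2 := h' φ hφ hc hsub e
      have : ∫ x in Ω, φ x • ((inner ℝ (G x) e : ℝ) - inner ℝ (G' x) e)
          = ∫ x in Ω, (inner ℝ (G x) e * φ x - inner ℝ (G' x) e * φ x) := by
        congr 1; ext x; rw [smul_eq_mul]; ring
      rw [this, integral_sub i3 i4]
      linarith
  filter_upwards [ae_all_iff.2 key] with x hx
  ext i; exact hx i

/-- For a fixed test function both sides of the defining identity are continuous in L². This is how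
limits of smooth functions become elements of H¹. -/
theorem IsWeakGradient.of_tendsto {u : EuclideanSpace ℝ (Fin d) → ℝ}
    {G : EuclideanSpace ℝ (Fin d) → EuclideanSpace ℝ (Fin d)}
    {s : ℕ → EuclideanSpace ℝ (Fin d) → ℝ} {g : ℕ → EuclideanSpace ℝ (Fin d) → EuclideanSpace ℝ (Fin d)}
    (hu : MemLp u 2 (volume.restrict Ω)) (hG : MemLp G 2 (volume.restrict Ω))
    (hs : ∀ n, MemLp (s n) 2 (volume.restrict Ω)) (hg : ∀ n, MemLp (g n) 2 (volume.restrict Ω))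
    (h : ∀ n, IsWeakGradient Ω (s n) (g n))
    (h1 : Tendsto (fun n => eLpNorm (fun x => s n x - u x) 2 (volume.restrict Ω)) atTop (𝓝 0))
    (h2 : Tendsto (fun n => eLpNorm (fun x => g n x - G x) 2 (volume.restrict Ω)) atTop (𝓝 0)) :
    IsWeakGradient Ω u G := by
  intro φ hφ hc hsub e
  have hφ' : Continuous fun x => fderiv ℝ φ x e :=
    (hφ.continuous_fderiv (by simp)).clm_apply continuous_const
  have hc' : HasCompactSupport fun x => fderiv ℝ φ x e :=
    (hc.fderiv ℝ).comp_left (g := fun L : EuclideanSpace ℝ (Fin d) →L[ℝ] ℝ => L e) rfl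
  have m1 : MemLp (fun x => fderiv ℝ φ x e) 2 (volume.restrict Ω) :=
    (hφ'.memLp_of_hasCompactSupport hc').restrict Ω
  have m2 : MemLp φ 2 (volume.restrict Ω) :=
    (hφ.continuous.memLp_of_hasCompactSupport hc).restrict Ω
  have t1 : Tendsto (fun n => ∫ x in Ω, (s n x - u x) * fderiv ℝ φ x e) atTop (𝓝 0) := by
    rw [tendsto_zero_iff_enorm_tendsto_zero]
    refine tendsto_of_tendsto_of_tendsto_of_le_of_le tendsto_const_nhds
      (h := fun n => eLpNorm (fun x => s n x - u x) 2 (volume.restrict Ω) *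
        eLpNorm (fun x => fderiv ℝ φ x e) 2 (volume.restrict Ω)) ?_ (fun _ => zero_le)
      (fun n => ofReal_abs_integral_mul_le ((hs n).sub hu).1 m1.1)
    simpa using ENNReal.Tendsto.mul_const h1 (Or.inr m1.2.ne)
  have t2 : Tendsto (fun n => ∫ x in Ω, inner ℝ (g n x - G x) e * φ x) atTop (𝓝 0) := by
    rw [tendsto_zero_iff_enorm_tendsto_zero]
    refine tendsto_of_tendsto_of_tendsto_of_le_of_le tendsto_const_nhds
      (h := fun n => (ENNReal.ofReal ‖e‖ * eLpNorm (fun x => g n x - G x) 2 (volume.restrict Ω)) *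
        eLpNorm φ 2 (volume.restrict Ω)) ?_ (fun _ => zero_le)
      (fun n => (ofReal_abs_integral_mul_le (((hg n).sub hG).inner_right e).1 m2.1).trans ?_)
    · have := ENNReal.Tendsto.const_mul (a := ENNReal.ofReal ‖e‖) h2 (Or.inr ENNReal.ofReal_ne_top)
      simpa using ENNReal.Tendsto.mul_const this (Or.inr m2.2.ne)
    · refine mul_le_mul_left ?_ _
      refine eLpNorm_le_mul_eLpNorm_of_ae_le_mul (Eventually.of_forall fun x => ?_) 2
      rw [mul_comm]
      exact norm_inner_le_norm (𝕜 := ℝ) _ _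
  have e1 : ∀ n, ∫ x in Ω, (s n x - u x) * fderiv ℝ φ x e =
      - (∫ x in Ω, inner ℝ (g n x - G x) e * φ x) -
      ((∫ x in Ω, u x * fderiv ℝ φ x e) + ∫ x in Ω, inner ℝ (G x) e * φ x) := by
    intro n
    have i1 := integrable_mul_testFunction (hs n) hφ' hc'
    have i2 := integrable_mul_testFunction hu hφ' hc'
    have i3 := integrable_mul_testFunction ((hg n).inner_right e) hφ.continuous hc
    have i4 := integrable_mul_testFunction (hG.inner_right e) hφ.continuous hc
    have e1 := h n φ hφ hc hsub e
    simp_rw [sub_mul, inner_sub_left, sub_mul]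
    rw [integral_sub i1 i2, integral_sub i3 i4, e1]; ring
  have t3 := (t2.neg.sub_const ((∫ x in Ω, u x * fderiv ℝ φ x e) + ∫ x in Ω, inner ℝ (G x) e * φ x))
  have := tendsto_nhds_unique (t1.congr e1) t3
  simp at this
  linarith

theorem weakGrad_spec {u : EuclideanSpace ℝ (Fin d) → ℝ} (h : MemH1 Ω u) :
    MemLp (weakGrad Ω u) 2 (volume.restrict Ω) ∧ IsWeakGradient Ω u (weakGrad Ω u) := by
  rw [weakGrad, dif_pos h]; exact h.2.choose_spec

theorem weakGrad_ae_eq (hΩ : IsOpen Ω) {u : EuclideanSpace ℝ (Fin d) → ℝ}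
    {G : EuclideanSpace ℝ (Fin d) → EuclideanSpace ℝ (Fin d)}
    (hu : MemLp u 2 (volume.restrict Ω)) (hG : MemLp G 2 (volume.restrict Ω))
    (h : IsWeakGradient Ω u G) : weakGrad Ω u =ᵐ[volume.restrict Ω] G :=
  have hm : MemH1 Ω u := ⟨hu, G, hG, h⟩
  (weakGrad_spec hm).2.ae_unique hΩ (weakGrad_spec hm).1 hG h

theorem MemH1.combo {u u' : EuclideanSpace ℝ (Fin d) → ℝ} (h : MemH1 Ω u) (h' : MemH1 Ω u')
    (a b : ℝ) : MemH1 Ω (fun x => a * u x + b * u' x) :=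
  ⟨(h.1.const_mul a).add (h'.1.const_mul b), _,
    ((weakGrad_spec h).1.const_smul a).add ((weakGrad_spec h').1.const_smul b),
    (weakGrad_spec h).2.combo h.1 h'.1 (weakGrad_spec h).1 (weakGrad_spec h').1
      (weakGrad_spec h').2 a b⟩

theorem MemH1.weakGrad_combo (hΩ : IsOpen Ω) {u u' : EuclideanSpace ℝ (Fin d) → ℝ}
    (h : MemH1 Ω u) (h' : MemH1 Ω u') (a b : ℝ) :
    weakGrad Ω (fun x => a * u x + b * u' x) =ᵐ[volume.restrict Ω]
      fun x => a • weakGrad Ω u x + b • weakGrad Ω u' x :=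
  weakGrad_ae_eq hΩ (h.combo h' a b).1
    (((weakGrad_spec h).1.const_smul a).add ((weakGrad_spec h').1.const_smul b))
    ((weakGrad_spec h).2.combo h.1 h'.1 (weakGrad_spec h).1 (weakGrad_spec h').1
      (weakGrad_spec h').2 a b)

end WeakGradient

/-! ### Integration along segments. -/

section Segments

variable {d : ℕ}

theorem sq_lintegral_le {α : Type*} [MeasurableSpace α] {μ : Measure α} {g : α → ℝ≥0∞}
    (hg : AEMeasurable g μ) : (∫⁻ x, g x ∂μ) ^ 2 ≤ μ univ * ∫⁻ x, g x ^ 2 ∂μ := by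
  have h := ENNReal.lintegral_mul_norm_pow_le (f := fun _ => 1) (g := fun x => g x ^ 2)
    (μ := μ) aemeasurable_const (hg.pow_const 2) (p := 1 / 2) (q := 1 / 2) (by norm_num)
    (by norm_num) (by norm_num)
  have e : ∀ a : ℝ≥0∞, (a ^ 2) ^ (1 / 2 : ℝ) = a := fun a => by
    rw [← ENNReal.rpow_natCast, ← ENNReal.rpow_mul]; norm_num
  have e' : ∀ a : ℝ≥0∞, (a ^ (1 / 2 : ℝ)) ^ 2 = a := fun a => by
    rw [← ENNReal.rpow_natCast, ← ENNReal.rpow_mul]; norm_num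
  simp only [e, ENNReal.one_rpow, one_mul, lintegral_one] at h
  calc _ ≤ (μ univ ^ (1 / 2 : ℝ) * (∫⁻ x, g x ^ 2 ∂μ) ^ (1 / 2 : ℝ)) ^ 2 := by gcongr
    _ = _ := by rw [mul_pow, e', e']

theorem enorm_sub_le_lintegral_gradient {s : EuclideanSpace ℝ (Fin d) → ℝ} (hs : ContDiff ℝ ∞ s)
    (x w : EuclideanSpace ℝ (Fin d)) {T : ℝ} (hT : 0 ≤ T) :
    ‖s (x + T • w) - s x‖ₑ ≤ ∫⁻ t in Ioc (0 : ℝ) T, ‖w‖ₑ * ‖gradient s (x + t • w)‖ₑ := by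
  have hd : ∀ t : ℝ, HasDerivAt (fun t : ℝ => s (x + t • w)) (fderiv ℝ s (x + t • w) w) t := by
    intro t
    have h1 : HasDerivAt (fun t : ℝ => x + t • w) w t := by
      simpa using ((hasDerivAt_id t).smul_const w).const_add x
    exact ((hs.differentiable (by simp)) _).hasFDerivAt.comp_hasDerivAt t h1
  have hc : Continuous fun t : ℝ => fderiv ℝ s (x + t • w) w :=
    ((hs.continuous_fderiv (by simp)).comp (by fun_prop)).clm_apply continuous_const
  have := intervalIntegral.integral_eq_sub_of_hasDerivAt (a := 0) (b := T) (fun t _ => hd t)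
    (hc.intervalIntegrable 0 T)
  simp only [zero_smul, add_zero] at this
  rw [← this, intervalIntegral.integral_of_le hT]
  refine (enorm_integral_le_lintegral_enorm _).trans (lintegral_mono fun t => ?_)
  rw [← inner_gradient_eq, mul_comm, ← ofReal_norm, ← ofReal_norm, ← ofReal_norm,
    ← ENNReal.ofReal_mul (norm_nonneg _)]
  exact ENNReal.ofReal_le_ofReal (norm_inner_le_norm _ _)

theorem sq_enorm_sub_smul_le_lintegral_gradient {s : EuclideanSpace ℝ (Fin d) → ℝ}
    (hs : ContDiff ℝ ∞ s) (x w : EuclideanSpace ℝ (Fin d)) {T : ℝ} (hT : 0 ≤ T) :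
    ‖s (x + T • w) - s x‖ₑ ^ 2 ≤ ENNReal.ofReal T * ‖w‖ₑ ^ 2 *
      ∫⁻ t in Ioc (0 : ℝ) T, ‖gradient s (x + t • w)‖ₑ ^ 2 := by
  have hc : Continuous fun t : ℝ => gradient s (x + t • w) :=
    (contDiff_gradient hs).comp (by fun_prop)
  have hm : Measurable fun t : ℝ => ‖gradient s (x + t • w)‖ₑ := hc.enorm.measurable
  calc _ ≤ (∫⁻ t in Ioc (0 : ℝ) T, ‖w‖ₑ * ‖gradient s (x + t • w)‖ₑ) ^ 2 := by
        gcongr; exact enorm_sub_le_lintegral_gradient hs x w hT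
    _ ≤ _ := sq_lintegral_le (hm.const_mul _).aemeasurable
    _ = _ := by
        simp only [mul_pow]
        rw [lintegral_const_mul _ (hm.pow_const 2)]
        simp [mul_assoc]

theorem sq_enorm_sub_le_lintegral_gradient {s : EuclideanSpace ℝ (Fin d) → ℝ}
    (hs : ContDiff ℝ ∞ s) (x w : EuclideanSpace ℝ (Fin d)) :
    ‖s (x + w) - s x‖ₑ ^ 2 ≤ ‖w‖ₑ ^ 2 * ∫⁻ t in Ioc (0 : ℝ) 1, ‖gradient s (x + t • w)‖ₑ ^ 2 := by
  simpa using sq_enorm_sub_smul_le_lintegral_gradient hs x w zero_le_one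

theorem lintegral_comp_add_smul {g : EuclideanSpace ℝ (Fin d) → ℝ≥0∞} (hg : Measurable g)
    (a : EuclideanSpace ℝ (Fin d)) {t : ℝ} (ht : 0 < t) :
    ∫⁻ y, g (a + t • y) = ENNReal.ofReal ((t ^ d)⁻¹) * ∫⁻ y, g y := by
  have h1 : ∫⁻ y, g (a + t • y) = ∫⁻ y, g (a + y) ∂(Measure.map (t • ·) volume) := by
    rw [lintegral_map (by fun_prop) (by fun_prop)]
  rw [h1, Measure.map_addHaar_smul _ ht.ne', lintegral_smul_measure, lintegral_add_left_eq_self,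
    finrank_euclideanSpace_fin, abs_of_nonneg (by positivity), smul_eq_mul]

/-- For t ≥ 1/2 substitute in y, with Jacobian factor t^(-d) ≤ 2^d. For t ≤ 1/2 substitute in x,
with factor (1 - t)^(-d) ≤ 2^d. Switching variables at the midpoint avoids the singularity at either
end. -/
theorem lintegral_segment_le {g : EuclideanSpace ℝ (Fin d) → ℝ≥0∞} (hg : Measurable g)
    (X Y : Set (EuclideanSpace ℝ (Fin d))) :
    ∫⁻ x in X, ∫⁻ y in Y, ∫⁻ t in Ioc (0 : ℝ) 1, g (x + t • (y - x)) ≤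
      2 ^ d * (volume X + volume Y) * ∫⁻ y, g y := by
  have key : ∀ a : EuclideanSpace ℝ (Fin d), ∀ t : ℝ, 1 / 2 ≤ t →
      ∫⁻ y, g (a + t • y) ≤ 2 ^ d * ∫⁻ y, g y := by
    intro a t ht
    rw [lintegral_comp_add_smul hg a (by linarith)]
    gcongr
    calc ENNReal.ofReal ((t ^ d)⁻¹) ≤ ENNReal.ofReal (2 ^ d) := by
          apply ENNReal.ofReal_le_ofReal
          rw [← inv_pow]
          have : t⁻¹ ≤ 2 := by rw [inv_le_comm₀ (by linarith) two_pos]; linarith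
          have h0 : 0 ≤ t⁻¹ := by positivity
          gcongr
      _ = 2 ^ d := by rw [ENNReal.ofReal_pow (by norm_num)]; simp
  have hm3 : Measurable fun q : (EuclideanSpace ℝ (Fin d) × EuclideanSpace ℝ (Fin d)) × ℝ =>
      g (q.1.1 + q.2 • (q.1.2 - q.1.1)) := hg.comp (by fun_prop)
  have bound : ∀ t ∈ Ioc (0 : ℝ) 1, ∫⁻ x in X, ∫⁻ y in Y, g (x + t • (y - x)) ≤
      2 ^ d * (volume X + volume Y) * ∫⁻ y, g y := by
    intro t ht
    have hm2 : Measurable fun q : EuclideanSpace ℝ (Fin d) × EuclideanSpace ℝ (Fin d) =>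
      g (q.1 + t • (q.2 - q.1)) := hg.comp (by fun_prop)
    rcases le_total (1 / 2) t with h | h
    · calc _ ≤ ∫⁻ x in X, 2 ^ d * ∫⁻ y, g y := by
            refine lintegral_mono fun x => (setLIntegral_le_lintegral _ _).trans ?_
            refine le_trans (le_of_eq ?_) (key (x - t • x) t h)
            congr 1; ext y; congr 1; module
        _ = 2 ^ d * volume X * ∫⁻ y, g y := by
            rw [setLIntegral_const]; ring
        _ ≤ _ := by gcongr; exact le_self_add
    · calc _ = ∫⁻ y in Y, ∫⁻ x in X, g (x + t • (y - x)) :=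
            lintegral_lintegral_swap hm2.aemeasurable
        _ ≤ ∫⁻ y in Y, 2 ^ d * ∫⁻ y, g y := by
            refine lintegral_mono fun y => (setLIntegral_le_lintegral _ _).trans ?_
            refine le_trans (le_of_eq ?_) (key (t • y) (1 - t) (by linarith))
            congr 1; ext x; congr 1; module
        _ = 2 ^ d * volume Y * ∫⁻ y, g y := by
            rw [setLIntegral_const]; ring
        _ ≤ _ := by gcongr; exact le_add_self
  calc ∫⁻ x in X, ∫⁻ y in Y, ∫⁻ t in Ioc (0 : ℝ) 1, g (x + t • (y - x))
      = ∫⁻ x in X, ∫⁻ t in Ioc (0 : ℝ) 1, ∫⁻ y in Y, g (x + t • (y - x)) := by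
        refine lintegral_congr fun x => lintegral_lintegral_swap ?_
        exact (hg.comp (by fun_prop)).aemeasurable
    _ = ∫⁻ t in Ioc (0 : ℝ) 1, ∫⁻ x in X, ∫⁻ y in Y, g (x + t • (y - x)) := by
        refine lintegral_lintegral_swap (Measurable.aemeasurable ?_)
        have : Measurable fun q : (EuclideanSpace ℝ (Fin d) × ℝ) × EuclideanSpace ℝ (Fin d) =>
          g (q.1.1 + q.1.2 • (q.2 - q.1.1)) := hg.comp (by fun_prop)
        exact this.lintegral_prod_right'
    _ ≤ ∫⁻ t in Ioc (0 : ℝ) 1, 2 ^ d * (volume X + volume Y) * ∫⁻ y, g y :=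
        setLIntegral_mono' measurableSet_Ioc bound
    _ = _ := by simp

end Segments

/-! ### A Poincaré inequality as a relation between two measures. -/

section PoincareRelation

variable {d : ℕ} {Ω : Set (EuclideanSpace ℝ (Fin d))}

/-- The mean square oscillation of smooth functions between `μ` and `ν` is controlled by their
Dirichlet energy on `Ω`. -/
def PoincareRel (Ω : Set (EuclideanSpace ℝ (Fin d))) (μ ν : Measure (EuclideanSpace ℝ (Fin d))) :
    Prop :=
  ∃ C : ℝ≥0, ∀ s : EuclideanSpace ℝ (Fin d) → ℝ, ContDiff ℝ ∞ s →
    ∫⁻ x, ∫⁻ y, ‖s x - s y‖ₑ ^ 2 ∂ν ∂μ ≤ C * ∫⁻ x in Ω, ‖gradient s x‖ₑ ^ 2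

theorem measurable_enorm_sub_sq {s : EuclideanSpace ℝ (Fin d) → ℝ} (hs : Continuous s) :
    Measurable fun q : EuclideanSpace ℝ (Fin d) × EuclideanSpace ℝ (Fin d) =>
      ‖s q.1 - s q.2‖ₑ ^ 2 :=
  (Continuous.enorm (by fun_prop)).measurable.pow_const 2

theorem PoincareRel.symm {μ ν : Measure (EuclideanSpace ℝ (Fin d))} [SFinite μ] [SFinite ν]
    (h : PoincareRel Ω μ ν) : PoincareRel Ω ν μ := by
  obtain ⟨C, hC⟩ := h
  refine ⟨C, fun s hs => le_trans (le_of_eq ?_) (hC s hs)⟩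
  rw [lintegral_lintegral_swap (measurable_enorm_sub_sq hs.continuous).aemeasurable]
  refine lintegral_congr fun x => lintegral_congr fun y => ?_
  rw [← enorm_neg, neg_sub]

theorem PoincareRel.mono {μ ν μ' ν' : Measure (EuclideanSpace ℝ (Fin d))}
    (h : PoincareRel Ω μ ν) (hμ : μ' ≤ μ) (hν : ν' ≤ ν) : PoincareRel Ω μ' ν' := by
  obtain ⟨C, hC⟩ := h
  exact ⟨C, fun s hs => (lintegral_mono' hμ fun x => lintegral_mono' hν le_rfl).trans (hC s hs)⟩

theorem enorm_sub_sq_le (a b c : ℝ) : ‖a - c‖ₑ ^ 2 ≤ 2 * ‖a - b‖ₑ ^ 2 + 2 * ‖b - c‖ₑ ^ 2 := by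
  simp only [← ofReal_norm, Real.norm_eq_abs]
  have : (2 : ℝ≥0∞) = ENNReal.ofReal 2 := by simp
  rw [this, ← ENNReal.ofReal_pow (abs_nonneg _), ← ENNReal.ofReal_pow (abs_nonneg _),
    ← ENNReal.ofReal_pow (abs_nonneg _), ← ENNReal.ofReal_mul (by norm_num),
    ← ENNReal.ofReal_mul (by norm_num), ← ENNReal.ofReal_add (by positivity) (by positivity)]
  apply ENNReal.ofReal_le_ofReal
  simp only [sq_abs]
  nlinarith [sq_nonneg (a - b - (b - c))]

/-- Insert s y between s x and s z and average over y with respect to ν, which must have positive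
mass. Transitivity lets the inequality spread along chains of overlapping sets. -/
theorem PoincareRel.trans {μ ν κ : Measure (EuclideanSpace ℝ (Fin d))} [IsFiniteMeasure μ]
    [IsFiniteMeasure ν] [IsFiniteMeasure κ] (hν : ν univ ≠ 0)
    (h : PoincareRel Ω μ ν) (h' : PoincareRel Ω ν κ) : PoincareRel Ω μ κ := by
  obtain ⟨C, hC⟩ := h
  obtain ⟨C', hC'⟩ := h'
  refine ⟨(ν univ).toNNReal⁻¹ * (2 * (κ univ).toNNReal * C + 2 * (μ univ).toNNReal * C'),
    fun s hs => ?_⟩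
  have hm := measurable_enorm_sub_sq hs.continuous
  have key : ν univ * ∫⁻ x, ∫⁻ z, ‖s x - s z‖ₑ ^ 2 ∂κ ∂μ ≤
      2 * κ univ * (C * ∫⁻ x in Ω, ‖gradient s x‖ₑ ^ 2) +
        2 * μ univ * (C' * ∫⁻ x in Ω, ‖gradient s x‖ₑ ^ 2) := by
    calc ν univ * ∫⁻ x, ∫⁻ z, ‖s x - s z‖ₑ ^ 2 ∂κ ∂μ
        = ∫⁻ y, ∫⁻ x, ∫⁻ z, ‖s x - s z‖ₑ ^ 2 ∂κ ∂μ ∂ν := by rw [lintegral_const, mul_comm]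
      _ ≤ ∫⁻ y, ∫⁻ x, ∫⁻ z, (2 * ‖s x - s y‖ₑ ^ 2 + 2 * ‖s y - s z‖ₑ ^ 2) ∂κ ∂μ ∂ν :=
          lintegral_mono fun y => lintegral_mono fun x => lintegral_mono fun z =>
            enorm_sub_sq_le _ _ _
      _ = ∫⁻ y, (2 * κ univ * ∫⁻ x, ‖s x - s y‖ₑ ^ 2 ∂μ) +
            2 * μ univ * ∫⁻ z, ‖s y - s z‖ₑ ^ 2 ∂κ ∂ν := by
          refine lintegral_congr fun y => ?_
          have m1 : Measurable fun x => ‖s x - s y‖ₑ ^ 2 :=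
            (hs.continuous.sub continuous_const).enorm.measurable.pow_const 2
          have m2 : Measurable fun z => ‖s y - s z‖ₑ ^ 2 :=
            (continuous_const.sub hs.continuous).enorm.measurable.pow_const 2
          have : ∀ x, ∫⁻ z, (2 * ‖s x - s y‖ₑ ^ 2 + 2 * ‖s y - s z‖ₑ ^ 2) ∂κ =
              2 * κ univ * ‖s x - s y‖ₑ ^ 2 + 2 * ∫⁻ z, ‖s y - s z‖ₑ ^ 2 ∂κ := fun x => by
            rw [lintegral_add_left measurable_const, lintegral_const, lintegral_const_mul _ m2]
            ring
          simp_rw [this]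
          rw [lintegral_add_right _ measurable_const, lintegral_const, lintegral_const_mul _ m1]
          ring
      _ = 2 * κ univ * (∫⁻ y, ∫⁻ x, ‖s x - s y‖ₑ ^ 2 ∂μ ∂ν) +
            2 * μ univ * ∫⁻ y, ∫⁻ z, ‖s y - s z‖ₑ ^ 2 ∂κ ∂ν := by
          have m1 : Measurable fun y => ∫⁻ x, ‖s x - s y‖ₑ ^ 2 ∂μ := hm.lintegral_prod_left'
          have m2 : Measurable fun y => ∫⁻ z, ‖s y - s z‖ₑ ^ 2 ∂κ := hm.lintegral_prod_right'
          rw [lintegral_add_left (m1.const_mul _), lintegral_const_mul _ m1,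
            lintegral_const_mul _ m2]
      _ ≤ _ := by
          gcongr
          · rw [← lintegral_lintegral_swap hm.aemeasurable]; exact hC s hs
          · exact hC' s hs
  have hfin : ν univ ≠ ⊤ := measure_ne_top _ _
  calc _ = (ν univ)⁻¹ * (ν univ * ∫⁻ x, ∫⁻ z, ‖s x - s z‖ₑ ^ 2 ∂κ ∂μ) := by
        rw [← mul_assoc, ENNReal.inv_mul_cancel hν hfin, one_mul]
    _ ≤ (ν univ)⁻¹ * (2 * κ univ * (C * ∫⁻ x in Ω, ‖gradient s x‖ₑ ^ 2) +
          2 * μ univ * (C' * ∫⁻ x in Ω, ‖gradient s x‖ₑ ^ 2)) := by gcongr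
    _ = _ := by
        have h0 : (ν univ).toNNReal ≠ 0 := by
          rw [Ne, ENNReal.toNNReal_eq_zero_iff]; simp [hν, hfin]
        push_cast [ENNReal.coe_inv h0, ENNReal.coe_toNNReal hfin,
          ENNReal.coe_toNNReal (measure_ne_top κ univ), ENNReal.coe_toNNReal (measure_ne_top μ univ)]
        ring

theorem restrict_biUnion_finset_le_sum {α ι : Type*} [MeasurableSpace α] {μ : Measure α}
    (t : Finset ι) (N : ι → Set α) : μ.restrict (⋃ x ∈ t, N x) ≤ ∑ x ∈ t, μ.restrict (N x) := by
  refine (Measure.restrict_biUnion_le t.countable_toSet).trans (le_of_eq ?_)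
  rw [← Measure.sum_coe_finset]; rfl

theorem PoincareRel.finset_sum {ι : Type*} (t : Finset ι)
    {μ : ι → Measure (EuclideanSpace ℝ (Fin d))} {ν : Measure (EuclideanSpace ℝ (Fin d))}
    (h : ∀ i ∈ t, PoincareRel Ω (μ i) ν) : PoincareRel Ω (∑ i ∈ t, μ i) ν := by
  classical
  induction t using Finset.induction_on with
  | empty => exact ⟨0, fun s _ => by simp⟩
  | insert a t ha ih =>
    obtain ⟨C, hC⟩ := h a (Finset.mem_insert_self a t)
    obtain ⟨C', hC'⟩ := ih fun i hi => h i (Finset.mem_insert_of_mem hi)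
    refine ⟨C + C', fun s hs => ?_⟩
    rw [Finset.sum_insert ha, lintegral_add_measure, ENNReal.coe_add, add_mul]
    exact add_le_add (hC s hs) (hC' s hs)

/-- Write s y - s x as an integral of the gradient over the segment, which lies in Ω, and apply
`lintegral_segment_le` to |∇s|² extended by zero. -/
theorem poincareRel_of_segments (hΩ : MeasurableSet Ω) {X Y : Set (EuclideanSpace ℝ (Fin d))}
    (hX : MeasurableSet X) (hY : MeasurableSet Y)
    (hXb : Bornology.IsBounded X) (hYb : Bornology.IsBounded Y)
    (h : ∀ x ∈ X, ∀ y ∈ Y, ∀ t ∈ Ioc (0 : ℝ) 1, x + t • (y - x) ∈ Ω) :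
    PoincareRel Ω (volume.restrict X) (volume.restrict Y) := by
  obtain ⟨R, hR⟩ := (hXb.union hYb).exists_norm_le
  have hXf : volume X ≠ ⊤ := hXb.measure_lt_top.ne
  have hYf : volume Y ≠ ⊤ := hYb.measure_lt_top.ne
  refine ⟨(2 * R).toNNReal ^ 2 * (2 ^ d * ((volume X).toNNReal + (volume Y).toNNReal)),
    fun s hs => ?_⟩
  set g : EuclideanSpace ℝ (Fin d) → ℝ≥0∞ := Ω.indicator fun x => ‖gradient s x‖ₑ ^ 2 with hgdef
  have hg : Measurable g := ((contDiff_gradient hs).enorm.measurable.pow_const 2).indicator hΩ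
  calc ∫⁻ x in X, ∫⁻ y in Y, ‖s x - s y‖ₑ ^ 2
      ≤ ∫⁻ x in X, ∫⁻ y in Y, (ENNReal.ofReal (2 * R)) ^ 2 *
          ∫⁻ t in Ioc (0 : ℝ) 1, g (x + t • (y - x)) := by
        refine setLIntegral_mono' hX fun x hx => setLIntegral_mono' hY fun y hy => ?_
        have h1 := sq_enorm_sub_le_lintegral_gradient hs x (y - x)
        rw [add_sub_cancel, ← enorm_neg, neg_sub] at h1
        refine h1.trans (mul_le_mul' ?_ ?_)
        · rw [← ofReal_norm]
          gcongr
          calc ‖y - x‖ ≤ ‖y‖ + ‖x‖ := norm_sub_le _ _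
            _ ≤ 2 * R := by linarith [hR x (Or.inl hx), hR y (Or.inr hy)]
        · refine setLIntegral_mono' measurableSet_Ioc fun t ht => ?_
          rw [hgdef, indicator_of_mem (h x hx y hy t ht)]
    _ = (ENNReal.ofReal (2 * R)) ^ 2 *
          ∫⁻ x in X, ∫⁻ y in Y, ∫⁻ t in Ioc (0 : ℝ) 1, g (x + t • (y - x)) := by
        rw [← lintegral_const_mul' _ _ (by finiteness)]
        congr 1; ext x
        rw [← lintegral_const_mul' _ _ (by finiteness)]
    _ ≤ (ENNReal.ofReal (2 * R)) ^ 2 * (2 ^ d * (volume X + volume Y) * ∫⁻ y, g y) := by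
        gcongr; exact lintegral_segment_le hg X Y
    _ = _ := by
        rw [hgdef, lintegral_indicator hΩ]
        push_cast [ENNReal.coe_toNNReal hXf, ENNReal.coe_toNNReal hYf, ENNReal.ofReal]
        ring

end PoincareRelation

/-! ### Uniform interior cones and the Poincaré-Wirtinger inequality. -/

section ConeProperty

variable {d : ℕ} {Ω : Set (EuclideanSpace ℝ (Fin d))}

theorem graph_le_of_mem_closure {e : EuclideanSpace ℝ (Fin d)}
    {γ : EuclideanSpace ℝ (Fin d) → ℝ} (hγ : Continuous γ)
    {x : EuclideanSpace ℝ (Fin d)} {r : ℝ}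
    (h : ∀ y ∈ Metric.ball x r, (y ∈ Ω ↔ γ (y - inner ℝ e y • e) < inner ℝ e y))
    {z : EuclideanSpace ℝ (Fin d)} (hz : z ∈ closure Ω) (hzr : z ∈ Metric.ball x r) :
    γ (z - inner ℝ e z • e) ≤ inner ℝ e z := by
  by_contra! hlt
  have ho : IsOpen {y : EuclideanSpace ℝ (Fin d) | inner ℝ e y < γ (y - inner ℝ e y • e)} :=
    isOpen_lt (by fun_prop) (hγ.comp (by fun_prop))
  obtain ⟨y, ⟨hy1, hy2⟩, hy3⟩ := mem_closure_iff.1 hz _ (ho.inter Metric.isOpen_ball) ⟨hlt, hzr⟩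
  exact absurd ((h y hy2).1 hy3) (not_lt.2 (le_of_lt hy1))

/-- One ball of directions serves all nearby points of the closure. At a boundary point it is
centred on the vertical direction and is so small that the vertical gain along w exceeds L times the
horizontal displacement. -/
theorem IsBoundedLipschitzDomain.exists_cone (hΩ : IsBoundedLipschitzDomain Ω)
    {x : EuclideanSpace ℝ (Fin d)} (hx : x ∈ closure Ω) :
    ∃ N ∈ 𝓝 x, ∃ (c : EuclideanSpace ℝ (Fin d)) (ρ : ℝ), 0 < ρ ∧
      ∀ z ∈ N ∩ closure Ω, ∀ w ∈ Metric.ball c ρ, ∀ t ∈ Ioc (0 : ℝ) 1, z + t • w ∈ Ω := by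
  by_cases hxΩ : x ∈ Ω
  · obtain ⟨r, hr, hsub⟩ := Metric.isOpen_iff.1 hΩ.isOpen x hxΩ
    refine ⟨Metric.ball x (r / 2), Metric.ball_mem_nhds _ (by linarith), 0, r / 2, by linarith,
      fun z hz w hw t ht => hsub ?_⟩
    have h1 : ‖z - x‖ < r / 2 := by simpa [dist_eq_norm] using hz.1
    have h2 : ‖w‖ < r / 2 := by simpa using hw
    rw [Metric.mem_ball, dist_eq_norm]
    calc ‖z + t • w - x‖ = ‖(z - x) + t • w‖ := by congr 1; abel
      _ ≤ ‖z - x‖ + ‖t • w‖ := norm_add_le _ _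
      _ ≤ ‖z - x‖ + 1 * ‖w‖ := by
          rw [norm_smul, Real.norm_of_nonneg ht.1.le]; gcongr; exact ht.2
      _ < r := by linarith
  · have hfr : x ∈ frontier Ω := by
      rw [hΩ.isOpen.frontier_eq]; exact ⟨hx, hxΩ⟩
    obtain ⟨e, he, L, γ, hL, r, hr, h⟩ := hΩ.lipschitz x hfr
    -- With ρ(2L + 2) = r/4 the vertical gain exceeds r/4 - ρ = (2L + 1)ρ, whereas the graph rises
    -- by at most 2Lρ. Also ρ ≤ r/8 keeps ‖w‖ < r/2, so the segment stays in the chart.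
    set ρ : ℝ := r / 4 / (2 * L + 2) with hρ
    have hL0 : (0 : ℝ) ≤ L := L.2
    have hρ0 : 0 < ρ := by positivity
    have hh : r / 4 = ρ * (2 * L + 2) := by rw [hρ]; field_simp
    refine ⟨Metric.ball x (r / 2), Metric.ball_mem_nhds _ (by linarith), (r / 4) • e, ρ, hρ0,
      fun z hz w hw t ht => ?_⟩
    have hzr : z ∈ Metric.ball x r := Metric.ball_subset_ball (by linarith) hz.1
    have hz1 : ‖z - x‖ < r / 2 := by simpa [dist_eq_norm] using hz.1
    set v := w - (r / 4) • e with hv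
    have hvρ : ‖v‖ < ρ := by simpa [dist_eq_norm] using hw
    have hwv : w = (r / 4) • e + v := by rw [hv]; abel
    have hee : inner ℝ e e = (1 : ℝ) := by rw [real_inner_self_eq_norm_sq, he]; norm_num
    have hev : |inner ℝ e v| < ρ := by
      calc |inner ℝ e v| ≤ ‖e‖ * ‖v‖ := abs_real_inner_le_norm _ _
        _ < ρ := by rw [he, one_mul]; exact hvρ
    have hwe : inner ℝ e w = r / 4 + inner ℝ e v := by
      rw [hwv, inner_add_right, inner_smul_right, hee, mul_one]
    have hwh : ‖w - inner ℝ e w • e‖ ≤ 2 * ρ := by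
      have : w - inner ℝ e w • e = v - inner ℝ e v • e := by rw [hwe, hwv]; module
      rw [this]
      calc ‖v - inner ℝ e v • e‖ ≤ ‖v‖ + ‖inner ℝ e v • e‖ := norm_sub_le _ _
        _ = ‖v‖ + |inner ℝ e v| := by rw [norm_smul, he, mul_one, Real.norm_eq_abs]
        _ ≤ 2 * ρ := by linarith
    have hwn : ‖w‖ < r / 2 := by
      calc ‖w‖ ≤ ‖(r / 4) • e‖ + ‖v‖ := by rw [hwv]; exact norm_add_le _ _
        _ = r / 4 + ‖v‖ := by rw [norm_smul, he, mul_one, Real.norm_of_nonneg (by linarith)]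
        _ < r / 2 := by nlinarith
    have hmem : z + t • w ∈ Metric.ball x r := by
      rw [Metric.mem_ball, dist_eq_norm]
      calc ‖z + t • w - x‖ = ‖(z - x) + t • w‖ := by congr 1; abel
        _ ≤ ‖z - x‖ + ‖t • w‖ := norm_add_le _ _
        _ ≤ ‖z - x‖ + 1 * ‖w‖ := by
            rw [norm_smul, Real.norm_of_nonneg ht.1.le]; gcongr; exact ht.2
        _ < r := by linarith
    rw [h _ hmem]
    have hγz := graph_le_of_mem_closure hL.continuous h hz.2 hzr
    have e1 : inner ℝ e (z + t • w) = inner ℝ e z + t * inner ℝ e w := by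
      rw [inner_add_right, inner_smul_right]
    have e2 : (z + t • w) - inner ℝ e (z + t • w) • e =
        (z - inner ℝ e z • e) + t • (w - inner ℝ e w • e) := by rw [e1]; module
    have e3 := hL.dist_le_mul ((z + t • w) - inner ℝ e (z + t • w) • e) (z - inner ℝ e z • e)
    rw [Real.dist_eq, dist_eq_norm, e2, add_sub_cancel_left, norm_smul,
      Real.norm_of_nonneg ht.1.le] at e3
    have e4 := (le_abs_self _).trans e3
    rw [e2, e1]
    have e5 : (L : ℝ) * (t * ‖w - inner ℝ e w • e‖) ≤ L * (t * (2 * ρ)) := by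
      have := ht.1.le
      gcongr
    have e6 : t * (L * (2 * ρ)) < t * (r / 4 + inner ℝ e v) := by
      apply mul_lt_mul_of_pos_left _ ht.1
      have := (abs_lt.1 hev).1
      nlinarith
    rw [← hwe] at e6
    linarith

theorem poincareRel_ball (x y : EuclideanSpace ℝ (Fin d)) {r ρ : ℝ} (hr : Metric.ball x r ⊆ Ω)
    (hΩ : MeasurableSet Ω) (hy : Metric.ball y ρ ⊆ Metric.ball x r) :
    PoincareRel Ω (volume.restrict (Metric.ball x r)) (volume.restrict (Metric.ball y ρ)) := by
  refine poincareRel_of_segments hΩ measurableSet_ball measurableSet_ball Metric.isBounded_ball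
    Metric.isBounded_ball fun a ha b hb t ht => hr ?_
  exact (convex_ball x r).add_smul_sub_mem ha (hy hb) ⟨ht.1.le, ht.2⟩

instance isFiniteMeasure_restrict_ball' (x : EuclideanSpace ℝ (Fin d)) (r : ℝ) :
    IsFiniteMeasure (volume.restrict (Metric.ball x r)) :=
  ⟨by simpa using measure_ball_lt_top⟩

theorem volume_restrict_ball_ne_zero (x : EuclideanSpace ℝ (Fin d)) {r : ℝ} (hr : 0 < r) :
    (volume.restrict (Metric.ball x r)) univ ≠ 0 := by
  simpa using (Metric.measure_ball_pos volume x hr).ne'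

/-- A connectedness argument: the centres of balls related to the reference ball form an open set.
It is closed relative to Ω, since a ball about a limit point contains a small related ball, through
which transitivity applies. -/
theorem poincareRel_ball_ball (hΩ : IsOpen Ω) (hc : IsPreconnected Ω)
    {x₀ x : EuclideanSpace ℝ (Fin d)} {r₀ r : ℝ} (hr₀ : 0 < r₀) (hr : 0 < r)
    (h₀ : Metric.ball x₀ r₀ ⊆ Ω) (h : Metric.ball x r ⊆ Ω) :
    PoincareRel Ω (volume.restrict (Metric.ball x r)) (volume.restrict (Metric.ball x₀ r₀)) := by
  set A : Set (EuclideanSpace ℝ (Fin d)) := {y | ∃ ρ > 0, Metric.ball y ρ ⊆ Ω ∧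
    PoincareRel Ω (volume.restrict (Metric.ball y ρ)) (volume.restrict (Metric.ball x₀ r₀))}
  have step : ∀ y ∈ closure A, ∀ ρ > 0, Metric.ball y ρ ⊆ Ω →
      PoincareRel Ω (volume.restrict (Metric.ball y ρ)) (volume.restrict (Metric.ball x₀ r₀)) := by
    intro y hy ρ hρ hsub
    obtain ⟨z, hz, δ, hδ, -, hrel⟩ := mem_closure_iff.1 hy _ Metric.isOpen_ball
      (Metric.mem_ball_self hρ)
    obtain ⟨δ', hδ', hsub'⟩ := Metric.isOpen_iff.1 Metric.isOpen_ball z hz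
    have hsub'' : Metric.ball z (min δ δ') ⊆ Metric.ball y ρ :=
      (Metric.ball_subset_ball (min_le_right _ _)).trans hsub'
    refine (poincareRel_ball y z hsub hΩ.measurableSet hsub'').trans
      (volume_restrict_ball_ne_zero z (lt_min hδ hδ')) ?_
    exact hrel.mono (Measure.restrict_mono (Metric.ball_subset_ball (min_le_left _ _)) le_rfl) le_rfl
  have hAo : IsOpen A := by
    refine Metric.isOpen_iff.2 fun y ⟨ρ, hρ, hsub, hrel⟩ => ⟨ρ, hρ, fun z hz => ?_⟩
    obtain ⟨δ, hδ, hsub'⟩ := Metric.isOpen_iff.1 Metric.isOpen_ball z hz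
    exact ⟨δ, hδ, hsub'.trans hsub, hrel.mono (Measure.restrict_mono hsub' le_rfl) le_rfl⟩
  have hx₀ : x₀ ∈ A := ⟨r₀, hr₀, h₀, poincareRel_ball x₀ x₀ h₀ hΩ.measurableSet le_rfl⟩
  have hsub : Ω ⊆ A := by
    refine hc.subset_of_closure_inter_subset hAo ⟨x₀, h₀ (Metric.mem_ball_self hr₀), hx₀⟩ ?_
    rintro y ⟨hy, hyΩ⟩
    obtain ⟨ρ, hρ, hρs⟩ := Metric.isOpen_iff.1 hΩ y hyΩ
    exact ⟨ρ, hρ, hρs, step y hy ρ hρ hρs⟩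
  exact step x (subset_closure (hsub (h (Metric.mem_ball_self hr)))) r hr h

/-- **Poincaré-Wirtinger inequality** on a bounded Lipschitz domain, for smooth functions. -/
theorem IsBoundedLipschitzDomain.poincareRel (hΩ : IsBoundedLipschitzDomain Ω) :
    PoincareRel Ω (volume.restrict Ω) (volume.restrict Ω) := by
  obtain ⟨x₀, hx₀⟩ := hΩ.isConnected.nonempty
  obtain ⟨r₀, hr₀, h₀⟩ := Metric.isOpen_iff.1 hΩ.isOpen x₀ hx₀
  have hfin : IsFiniteMeasure (volume.restrict Ω) :=
    ⟨by simpa using hΩ.isBounded.measure_lt_top⟩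
  -- Radii of at most ρ/2 about x and about x + c keep every difference y - z in the ball of
  -- directions about c. Hence the second ball is joined to all nearby points of Ω by segments in Ω,
  -- and it is related to the reference ball by connectedness.
  have loc : ∀ x ∈ closure Ω, ∃ N ∈ 𝓝 x, MeasurableSet N ∧
      PoincareRel Ω (volume.restrict (N ∩ Ω)) (volume.restrict (Metric.ball x₀ r₀)) := by
    intro x hx
    obtain ⟨N, hN, c, ρ, hρ, hcone⟩ := hΩ.exists_cone hx
    obtain ⟨δ, hδ, hδN⟩ := Metric.mem_nhds_iff.1 hN
    set η := min δ (ρ / 2)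
    have hη : 0 < η := lt_min hδ (by linarith)
    have seg : ∀ z ∈ Metric.ball x η ∩ closure Ω, ∀ y ∈ Metric.ball (x + c) (ρ / 2),
        ∀ t ∈ Ioc (0 : ℝ) 1, z + t • (y - z) ∈ Ω := by
      intro z hz y hy t ht
      refine hcone z ⟨hδN (Metric.ball_subset_ball (min_le_left _ _) hz.1), hz.2⟩ _ ?_ t ht
      have h1 : ‖z - x‖ < ρ / 2 := by
        have := Metric.ball_subset_ball (min_le_right _ _) hz.1
        simpa [dist_eq_norm] using this
      have h2 : ‖y - (x + c)‖ < ρ / 2 := by simpa [dist_eq_norm] using hy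
      rw [Metric.mem_ball, dist_eq_norm]
      calc ‖y - z - c‖ = ‖(y - (x + c)) - (z - x)‖ := by congr 1; abel
        _ ≤ _ := norm_sub_le _ _
        _ < ρ := by linarith
    have hB : Metric.ball (x + c) (ρ / 2) ⊆ Ω := fun y hy => by
      simpa using seg x ⟨Metric.mem_ball_self hη, hx⟩ y hy 1 ⟨one_pos, le_rfl⟩
    have hfin' : IsFiniteMeasure (volume.restrict (Metric.ball x η ∩ Ω)) :=
      ⟨by simpa using (hΩ.isBounded.subset inter_subset_right).measure_lt_top⟩
    refine ⟨Metric.ball x η, Metric.ball_mem_nhds _ hη, measurableSet_ball, ?_⟩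
    refine PoincareRel.trans (volume_restrict_ball_ne_zero (x + c) (r := ρ / 2) (by linarith))
      (poincareRel_of_segments hΩ.isOpen.measurableSet
        (measurableSet_ball.inter hΩ.isOpen.measurableSet) measurableSet_ball
        (hΩ.isBounded.subset inter_subset_right) Metric.isBounded_ball
        fun z hz => seg z ⟨hz.1, subset_closure hz.2⟩)
      (poincareRel_ball_ball hΩ.isOpen hΩ.isConnected.isPreconnected hr₀ (by linarith) h₀ hB)
  choose! N hN hNm hrel using loc
  obtain ⟨t, ht, hcov⟩ := hΩ.isBounded.isCompact_closure.elim_nhds_subcover N hN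
  have h1 : PoincareRel Ω (volume.restrict Ω) (volume.restrict (Metric.ball x₀ r₀)) := by
    refine (PoincareRel.finset_sum t fun x hx => hrel x (ht x hx)).mono ?_ le_rfl
    have hle := restrict_biUnion_finset_le_sum (μ := volume) t fun x => N x ∩ Ω
    refine (Measure.restrict_mono (s' := ⋃ x ∈ t, N x ∩ Ω) ?_ le_rfl).trans hle
    intro y hy
    obtain ⟨x, hx, hyx⟩ := mem_iUnion₂.1 (hcov (subset_closure hy))
    exact mem_iUnion₂.2 ⟨x, hx, hyx, hy⟩
  exact h1.trans (volume_restrict_ball_ne_zero x₀ hr₀) h1.symm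

end ConeProperty

/-! ### Surface measure on Lipschitz graphs. -/

section Graph

variable {d : ℕ}

/-- Orthogonal decomposition of the space along the hyperplane normal to a unit vector `e`. -/
noncomputable def hyperplaneProdEquiv (e : EuclideanSpace ℝ (Fin d)) (he : ‖e‖ = 1) :
    ((ℝ ∙ e)ᗮ × ℝ) ≃ₗ[ℝ] EuclideanSpace ℝ (Fin d) where
  toFun q := q.1 + q.2 • e
  map_add' a b := by simp only [Prod.fst_add, Prod.snd_add, Submodule.coe_add]; module
  map_smul' c a := by simp [mul_smul]
  invFun y := (⟨y - inner ℝ e y • e, by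
    rw [Submodule.mem_orthogonal_singleton_iff_inner_right, inner_sub_right, inner_smul_right,
      real_inner_self_eq_norm_sq, he]; ring⟩, inner ℝ e y)
  left_inv q := by
    have h1 : inner ℝ e (q.1 : EuclideanSpace ℝ (Fin d)) = (0 : ℝ) :=
      Submodule.mem_orthogonal_singleton_iff_inner_right.1 q.1.2
    have h2 : inner ℝ e ((q.1 : EuclideanSpace ℝ (Fin d)) + q.2 • e) = q.2 := by
      rw [inner_add_right, inner_smul_right, real_inner_self_eq_norm_sq, he, h1]; ring
    ext1
    · ext1; simp [h2]
    · exact h2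
  right_inv y := by simp

/-- The hyperplane has dimension d - 1, so its Hausdorff measure is a Haar measure. The image of the
product measure under the linear isomorphism is again Haar, hence a multiple of Lebesgue measure;
the value of the multiple is irrelevant. -/
theorem exists_map_hyperplane_eq_smul (hd : 1 ≤ d) (e : EuclideanSpace ℝ (Fin d)) (he : ‖e‖ = 1) :
    ∃ c : ℝ≥0, Measure.map (fun q : (ℝ ∙ e)ᗮ × ℝ => (q.1 : EuclideanSpace ℝ (Fin d)) + q.2 • e)
      ((Measure.hausdorffMeasure ((d : ℝ) - 1)).prod volume) = c • volume ∧
      Measure.IsAddHaarMeasure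
        (Measure.hausdorffMeasure ((d : ℝ) - 1) : Measure (ℝ ∙ e)ᗮ) := by
  have he0 : e ≠ 0 := fun h => by simp [h] at he
  have hfin : Module.finrank ℝ (ℝ ∙ e)ᗮ = d - 1 := by
    have h1 := Submodule.finrank_add_finrank_orthogonal (ℝ ∙ e)
    rw [finrank_span_singleton he0, finrank_euclideanSpace_fin] at h1
    omega
  have hcast : ((d : ℝ) - 1) = (Module.finrank ℝ (ℝ ∙ e)ᗮ : ℝ) := by
    rw [hfin]; push_cast [hd]; ring
  rw [hcast]
  set Φ := (hyperplaneProdEquiv e he).toContinuousLinearEquiv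
  have hH : Measure.IsAddHaarMeasure (Measure.map Φ
      ((Measure.hausdorffMeasure (Module.finrank ℝ (ℝ ∙ e)ᗮ : ℝ) : Measure (ℝ ∙ e)ᗮ).prod
        (volume : Measure ℝ))) := Φ.isAddHaarMeasure_map _
  exact ⟨_, Measure.isAddLeftInvariant_eq_smul (Measure.map Φ _) volume,
    isAddHaarMeasure_hausdorffMeasure⟩

/-- The graph of `γ` over the hyperplane normal to `e`. -/
noncomputable def graphMap (e : EuclideanSpace ℝ (Fin d)) (γ : EuclideanSpace ℝ (Fin d) → ℝ)
    (q : (ℝ ∙ e)ᗮ) : EuclideanSpace ℝ (Fin d) :=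
  q + γ q • e

theorem lipschitzWith_graphMap {e : EuclideanSpace ℝ (Fin d)} (he : ‖e‖ = 1)
    {γ : EuclideanSpace ℝ (Fin d) → ℝ} {L : ℝ≥0} (hγ : LipschitzWith L γ) :
    LipschitzWith (1 + L) (graphMap e γ) := by
  refine LipschitzWith.of_dist_le_mul fun p q => ?_
  have h := hγ.dist_le_mul p q
  rw [dist_eq_norm] at h ⊢
  calc ‖graphMap e γ p - graphMap e γ q‖
      = ‖((p : EuclideanSpace ℝ (Fin d)) - q) + (γ p - γ q) • e‖ := by
        congr 1; unfold graphMap; module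
    _ ≤ ‖(p : EuclideanSpace ℝ (Fin d)) - q‖ + ‖γ p - γ q‖ := by
        refine (norm_add_le _ _).trans ?_
        rw [norm_smul, he, mul_one]
    _ ≤ _ := by
        have e1 : dist p q = ‖(p : EuclideanSpace ℝ (Fin d)) - q‖ := by
          rw [← dist_eq_norm]; rfl
        have e2 : dist (p : EuclideanSpace ℝ (Fin d)) q = dist p q := rfl
        rw [e2] at h
        rw [← e1]
        push_cast
        linarith

theorem graphMap_sub_inner_smul {e : EuclideanSpace ℝ (Fin d)} (he : ‖e‖ = 1)
    {γ : EuclideanSpace ℝ (Fin d) → ℝ} {y : EuclideanSpace ℝ (Fin d)}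
    (hy : γ (y - inner ℝ e y • e) = inner ℝ e y) :
    graphMap e γ ((hyperplaneProdEquiv e he).symm y).1 = y := by
  change (y - inner ℝ e y • e) + γ (y - inner ℝ e y • e) • e = y
  rw [hy]; simp

/-- Integration over a graph and a vertical variable is controlled by volume integration; a bounded
graph has finite surface measure. -/
theorem exists_lintegral_graph_le (hd : 1 ≤ d) {e : EuclideanSpace ℝ (Fin d)} (he : ‖e‖ = 1)
    {γ : EuclideanSpace ℝ (Fin d) → ℝ} {L : ℝ≥0} (hγ : LipschitzWith L γ)
    {A : Set (EuclideanSpace ℝ (Fin d))} (hAb : Bornology.IsBounded A)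
    (hA : ∀ y ∈ A, γ (y - inner ℝ e y • e) = inner ℝ e y) :
    surfaceMeasure d A < ⊤ ∧ ∃ C : ℝ≥0, ∀ (h : ℝ) (g : EuclideanSpace ℝ (Fin d) → ℝ≥0∞),
      Measurable g →
      ∫⁻ y in A, ∫⁻ t in Ioc (0 : ℝ) h, g (y + t • e) ∂volume ∂(surfaceMeasure d) ≤ C * ∫⁻ y, g y := by
  obtain ⟨c, hc, hHaar⟩ := exists_map_hyperplane_eq_smul hd e he
  have hd0 : (0 : ℝ) ≤ (d : ℝ) - 1 := by
    have : (1 : ℝ) ≤ d := by exact_mod_cast hd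
    linarith
  set m : Measure (ℝ ∙ e)ᗮ := Measure.hausdorffMeasure ((d : ℝ) - 1) with hm
  set K : ℝ≥0 := (1 + L) ^ ((d : ℝ) - 1)
  have hK : ((1 + L : ℝ≥0) : ℝ≥0∞) ^ ((d : ℝ) - 1) = K :=
    (ENNReal.coe_rpow_of_nonneg _ hd0).symm
  have hlip := lipschitzWith_graphMap he hγ
  -- B is the image of its projection under the graph map, which is Lipschitz with constant 1 + L
  -- and so multiplies (d-1)-dimensional measure by at most K.
  have himg : ∀ B ⊆ A, surfaceMeasure d B ≤ K * m (graphMap e γ ⁻¹' B) := by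
    intro B hB
    have hsub : B ⊆ graphMap e γ '' (graphMap e γ ⁻¹' B) := fun y hy =>
      ⟨((hyperplaneProdEquiv e he).symm y).1, by
        rw [mem_preimage, graphMap_sub_inner_smul he (hA y (hB hy))]; exact hy,
        graphMap_sub_inner_smul he (hA y (hB hy))⟩
    refine (measure_mono hsub).trans ?_
    rw [← hK]
    exact hlip.hausdorffMeasure_image_le hd0 _
  constructor
  · refine (himg A le_rfl).trans_lt (ENNReal.mul_lt_top ENNReal.coe_lt_top ?_)
    obtain ⟨R, hR⟩ := hAb.exists_norm_le
    refine (measure_mono (t := Metric.closedBall 0 R) fun p hp => ?_).trans_lt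
      (isCompact_closedBall _ _).measure_lt_top
    have h1 : inner ℝ e (p : EuclideanSpace ℝ (Fin d)) = (0 : ℝ) :=
      Submodule.mem_orthogonal_singleton_iff_inner_right.1 p.2
    have h2 := hR _ hp
    have h3 : ‖(p : EuclideanSpace ℝ (Fin d))‖ ^ 2 ≤ ‖graphMap e γ p‖ ^ 2 := by
      unfold graphMap
      rw [norm_add_sq_real, inner_smul_right, real_inner_comm, h1]
      nlinarith [sq_nonneg ‖γ p • e‖]
    have h4 : ‖(p : EuclideanSpace ℝ (Fin d))‖ ≤ ‖graphMap e γ p‖ :=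
      le_of_sq_le_sq h3 (norm_nonneg _)
    simpa using h4.trans h2
  · refine ⟨K * c, fun h g hg => ?_⟩
    have hle : (surfaceMeasure d).restrict A ≤ K • Measure.map (graphMap e γ) m := by
      refine Measure.le_iff.2 fun B hB => ?_
      rw [Measure.restrict_apply hB, Measure.smul_apply,
        Measure.map_apply hlip.continuous.measurable hB]
      refine (himg _ inter_subset_right).trans ?_
      rw [ENNReal.smul_def, smul_eq_mul]
      gcongr
      exact inter_subset_left
    have hm1 : Measurable fun y : EuclideanSpace ℝ (Fin d) => ∫⁻ t : ℝ, g (y + t • e) := by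
      have : Measurable fun q : EuclideanSpace ℝ (Fin d) × ℝ => g (q.1 + q.2 • e) :=
        hg.comp (by fun_prop)
      exact this.lintegral_prod_right'
    have hm2 : Measurable fun q : (ℝ ∙ e)ᗮ × ℝ => g ((q.1 : EuclideanSpace ℝ (Fin d)) + q.2 • e) :=
      hg.comp (by fun_prop)
    calc ∫⁻ y in A, ∫⁻ t in Ioc (0 : ℝ) h, g (y + t • e) ∂volume ∂(surfaceMeasure d)
        ≤ ∫⁻ y, ∫⁻ t : ℝ, g (y + t • e) ∂volume ∂(K • Measure.map (graphMap e γ) m) :=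
          lintegral_mono' hle fun y => setLIntegral_le_lintegral _ _
      _ = K * ∫⁻ p, ∫⁻ t : ℝ, g (graphMap e γ p + t • e) ∂volume ∂m := by
          rw [lintegral_smul_measure, lintegral_map hm1 hlip.continuous.measurable]; rfl
      _ = K * ∫⁻ p, ∫⁻ t : ℝ, g ((p : EuclideanSpace ℝ (Fin d)) + t • e) ∂volume ∂m := by
          congr 1
          refine lintegral_congr fun p => ?_
          -- On each vertical line the graph is straightened by translating t by γ p, which leaves
          -- the integral over ℝ unchanged.
          rw [← lintegral_add_left_eq_self (fun t : ℝ => g ((p : EuclideanSpace ℝ (Fin d)) + t • e))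
            (γ p)]
          refine lintegral_congr fun t => ?_
          congr 1; unfold graphMap; module
      _ = K * ∫⁻ q, g ((q.1 : EuclideanSpace ℝ (Fin d)) + q.2 • e) ∂(m.prod volume) := by
          rw [lintegral_prod _ hm2.aemeasurable]
      _ = K * ∫⁻ y, g y ∂(c • volume) := by
          rw [← hc, lintegral_map hg (by fun_prop)]
      _ = _ := by
          rw [lintegral_smul_measure, ENNReal.coe_mul, mul_assoc]; rfl

end Graph

/-! ### The Dirichlet part of the boundary and the Poincaré-Friedrichs inequality. -/

section Trace

variable {d : ℕ} {Ω ΓD ΓN : Set (EuclideanSpace ℝ (Fin d))}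

/-- A part of positive surface measure of the Dirichlet boundary carries a finite measure which is
related to the volume measure of `Ω` by a Poincaré inequality. -/
theorem exists_poincareRel_surface (hd : 1 ≤ d) (hΩ : IsBoundedLipschitzDomain Ω)
    (hΓ : IsBoundarySplitting Ω ΓD ΓN) :
    ∃ A ⊆ ΓD, surfaceMeasure d A ≠ 0 ∧ surfaceMeasure d A ≠ ⊤ ∧
      PoincareRel Ω ((surfaceMeasure d).restrict A) (volume.restrict Ω) := by
  -- A set of positive measure has a point all of whose relative neighbourhoods have positive
  -- measure. This localizes the problem to a single chart.
  obtain ⟨x, hx, hpos⟩ := exists_mem_forall_mem_nhdsWithin_pos_measure hΓ.dirichlet_pos.ne'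
  have hfr : ∀ y ∈ ΓD, y ∈ frontier Ω := fun y hy => by
    rw [← hΓ.closure_union]; exact subset_closure (Or.inl hy)
  obtain ⟨e, he, L, γ, hL, r, hr, h⟩ := hΩ.lipschitz x (hfr x hx)
  set A := ΓD ∩ Metric.ball x (r / 2) with hAdef
  have hAm : MeasurableSet A := hΓ.measurableSet_dirichlet.inter measurableSet_ball
  have hApos : 0 < surfaceMeasure d A := hpos A
    (inter_mem self_mem_nhdsWithin (mem_nhdsWithin_of_mem_nhds (Metric.ball_mem_nhds _ (by linarith))))
  have hAr : ∀ y ∈ A, y ∈ Metric.ball x r := fun y hy =>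
    Metric.ball_subset_ball (by linarith) hy.2
  have hgraph : ∀ y ∈ A, γ (y - inner ℝ e y • e) = inner ℝ e y := by
    intro y hy
    have hyf := hfr y hy.1
    rw [hΩ.isOpen.frontier_eq] at hyf
    refine le_antisymm (graph_le_of_mem_closure hL.continuous h hyf.1 (hAr y hy)) ?_
    exact not_lt.1 fun hlt => hyf.2 ((h y (hAr y hy)).2 hlt)
  have hee : inner ℝ e e = (1 : ℝ) := by rw [real_inner_self_eq_norm_sq, he]; norm_num
  have hin : ∀ y ∈ A, ∀ t ∈ Ioc (0 : ℝ) (r / 4), y + t • e ∈ Ω := by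
    intro y hy t ht
    have hmem : y + t • e ∈ Metric.ball x r := by
      have h1 : ‖y - x‖ < r / 2 := by simpa [dist_eq_norm] using hy.2
      rw [Metric.mem_ball, dist_eq_norm]
      calc ‖y + t • e - x‖ = ‖(y - x) + t • e‖ := by congr 1; abel
        _ ≤ ‖y - x‖ + ‖t • e‖ := norm_add_le _ _
        _ = ‖y - x‖ + t := by rw [norm_smul, Real.norm_of_nonneg ht.1.le, he, mul_one]
        _ < r := by linarith [ht.2]
    rw [h _ hmem]
    have e1 : inner ℝ e (y + t • e) = inner ℝ e y + t := by
      rw [inner_add_right, inner_smul_right, hee, mul_one]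
    have e2 : y + t • e - inner ℝ e (y + t • e) • e = y - inner ℝ e y • e := by
      rw [e1]; module
    rw [e2, e1, hgraph y hy]
    linarith [ht.1]
  obtain ⟨hAfin, C, hC⟩ := exists_lintegral_graph_le hd he hL
    (Metric.isBounded_ball.subset inter_subset_right) hgraph
  obtain ⟨P, hP⟩ := hΩ.poincareRel
  have hΩm := hΩ.isOpen.measurableSet
  have hΩf : volume Ω ≠ ⊤ := hΩ.isBounded.measure_lt_top.ne
  refine ⟨A, inter_subset_left, hApos.ne', hAfin.ne, ?_⟩
  set η : ℝ≥0 := (r / 4).toNNReal with hη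
  have hη0 : η ≠ 0 := by rw [hη]; simpa using hr
  have hηr : ENNReal.ofReal (r / 4) = η := rfl
  refine ⟨η⁻¹ * (2 * (volume Ω).toNNReal * (η * (η * C)) + 2 * (C * P)), fun s hs => ?_⟩
  have hfinA : IsFiniteMeasure ((surfaceMeasure d).restrict A) := ⟨by simpa using hAfin⟩
  have hmeas := measurable_enorm_sub_sq hs.continuous
  set D := ∫⁻ x in Ω, ‖gradient s x‖ₑ ^ 2 with hD
  set g : EuclideanSpace ℝ (Fin d) → ℝ≥0∞ := Ω.indicator fun x => ‖gradient s x‖ₑ ^ 2 with hgdef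
  have hg : Measurable g := ((contDiff_gradient hs).enorm.measurable.pow_const 2).indicator hΩm
  set H : EuclideanSpace ℝ (Fin d) → ℝ≥0∞ := Ω.indicator fun y => ∫⁻ x in Ω, ‖s y - s x‖ₑ ^ 2
    with hHdef
  have hH : Measurable H := hmeas.lintegral_prod_right'.indicator hΩm
  have hgD : ∫⁻ y, g y = D := by rw [hgdef, lintegral_indicator hΩm]
  have hHD : ∫⁻ y, H y ≤ P * D := by rw [hHdef, lintegral_indicator hΩm]; exact hP s hs
  -- Compare the boundary value s y with s x through s (y + t e) and average over the height t. The
  -- first difference is an integral of the gradient along the vertical segment. The second,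
  -- integrated over graph and height, is dominated by a volume integral controlled by
  -- Poincaré-Wirtinger.
  have pointwise : ∀ y ∈ A, (η : ℝ≥0∞) * ∫⁻ x in Ω, ‖s y - s x‖ₑ ^ 2 ≤
      2 * volume Ω * (η * (η * ∫⁻ t in Ioc (0 : ℝ) (r / 4), g (y + t • e))) +
        2 * ∫⁻ t in Ioc (0 : ℝ) (r / 4), H (y + t • e) := by
    intro y hy
    have step : ∀ t ∈ Ioc (0 : ℝ) (r / 4), ∫⁻ x in Ω, ‖s y - s x‖ₑ ^ 2 ≤
        2 * volume Ω * (η * ∫⁻ t in Ioc (0 : ℝ) (r / 4), g (y + t • e)) + 2 * H (y + t • e) := by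
      intro t ht
      have m2 : Measurable fun x => ‖s (y + t • e) - s x‖ₑ ^ 2 :=
        (continuous_const.sub hs.continuous).enorm.measurable.pow_const 2
      calc ∫⁻ x in Ω, ‖s y - s x‖ₑ ^ 2
          ≤ ∫⁻ x in Ω, (2 * ‖s y - s (y + t • e)‖ₑ ^ 2 + 2 * ‖s (y + t • e) - s x‖ₑ ^ 2) :=
            lintegral_mono fun x => enorm_sub_sq_le _ _ _
        _ = 2 * volume Ω * ‖s y - s (y + t • e)‖ₑ ^ 2 + 2 * H (y + t • e) := by
            rw [lintegral_add_left measurable_const, setLIntegral_const,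
              lintegral_const_mul _ m2, hHdef, indicator_of_mem (hin y hy t ht)]
            ring
        _ ≤ _ := by
            gcongr
            have h1 := sq_enorm_sub_smul_le_lintegral_gradient hs y e ht.1.le
            rw [← enorm_neg, neg_sub] at h1
            refine h1.trans ?_
            have h2 : ‖e‖ₑ = 1 := by rw [← ofReal_norm, he]; simp
            rw [h2, one_pow, mul_one, ← hηr]
            refine mul_le_mul' (ENNReal.ofReal_le_ofReal ht.2) ?_
            refine (setLIntegral_mono' measurableSet_Ioc (fun τ hτ => ?_)).trans
              (lintegral_mono_set (Ioc_subset_Ioc_right ht.2))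
            rw [hgdef, indicator_of_mem (hin y hy τ ⟨hτ.1, hτ.2.trans ht.2⟩)]
    have m3 : Measurable fun t : ℝ => H (y + t • e) := hH.comp (by fun_prop)
    calc (η : ℝ≥0∞) * ∫⁻ x in Ω, ‖s y - s x‖ₑ ^ 2
        = ∫⁻ t in Ioc (0 : ℝ) (r / 4), ∫⁻ x in Ω, ‖s y - s x‖ₑ ^ 2 := by
          rw [setLIntegral_const, Real.volume_Ioc, sub_zero, hηr, mul_comm]
      _ ≤ ∫⁻ t in Ioc (0 : ℝ) (r / 4), (2 * volume Ω *
            (η * ∫⁻ t in Ioc (0 : ℝ) (r / 4), g (y + t • e)) + 2 * H (y + t • e)) :=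
          setLIntegral_mono' measurableSet_Ioc step
      _ = _ := by
          rw [lintegral_add_left measurable_const, setLIntegral_const, Real.volume_Ioc, sub_zero,
            hηr, lintegral_const_mul _ m3]
          ring
  have key : (η : ℝ≥0∞) * ∫⁻ y in A, ∫⁻ x in Ω, ‖s y - s x‖ₑ ^ 2 ∂volume ∂(surfaceMeasure d) ≤
      2 * volume Ω * (η * (η * (C * D))) + 2 * (C * (P * D)) := by
    have mg : Measurable fun y : EuclideanSpace ℝ (Fin d) =>
        ∫⁻ t in Ioc (0 : ℝ) (r / 4), g (y + t • e) := by
      have : Measurable fun q : EuclideanSpace ℝ (Fin d) × ℝ => g (q.1 + q.2 • e) :=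
        hg.comp (by fun_prop)
      exact this.lintegral_prod_right'
    have mH : Measurable fun y : EuclideanSpace ℝ (Fin d) =>
        ∫⁻ t in Ioc (0 : ℝ) (r / 4), H (y + t • e) := by
      have : Measurable fun q : EuclideanSpace ℝ (Fin d) × ℝ => H (q.1 + q.2 • e) :=
        hH.comp (by fun_prop)
      exact this.lintegral_prod_right'
    rw [← lintegral_const_mul' _ _ ENNReal.coe_ne_top]
    refine (setLIntegral_mono' hAm pointwise).trans ?_
    rw [lintegral_add_left (((mg.const_mul _).const_mul _).const_mul _),
      lintegral_const_mul _ ((mg.const_mul _).const_mul _), lintegral_const_mul _ (mg.const_mul _),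
      lintegral_const_mul _ mg, lintegral_const_mul _ mH, ← hgD]
    gcongr
    · exact hC _ g hg
    · exact (hC _ H hH).trans (by gcongr; rw [hgD]; exact hHD)
  calc _ = (η : ℝ≥0∞)⁻¹ * (η * ∫⁻ y in A, ∫⁻ x in Ω, ‖s y - s x‖ₑ ^ 2 ∂volume ∂(surfaceMeasure d)) := by
        rw [← mul_assoc, ENNReal.inv_mul_cancel (by exact_mod_cast hη0) ENNReal.coe_ne_top, one_mul]
    _ ≤ (η : ℝ≥0∞)⁻¹ * (2 * volume Ω * (η * (η * (C * D))) + 2 * (C * (P * D))) := by gcongr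
    _ = _ := by
        push_cast [ENNReal.coe_inv hη0, ENNReal.coe_toNNReal hΩf]
        ring

/-- **Poincaré-Friedrichs inequality**: the `L²` norm on `Ω` is controlled by the Dirichlet energy
and the boundary values on the Dirichlet part. -/
theorem exists_poincareFriedrichs (hd : 1 ≤ d) (hΩ : IsBoundedLipschitzDomain Ω)
    (hΓ : IsBoundarySplitting Ω ΓD ΓN) :
    ∃ C : ℝ≥0, ∀ s : EuclideanSpace ℝ (Fin d) → ℝ, ContDiff ℝ ∞ s →
      ∫⁻ x in Ω, ‖s x‖ₑ ^ 2 ≤ C * ((∫⁻ x in Ω, ‖gradient s x‖ₑ ^ 2) +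
        ∫⁻ x in ΓD, ‖s x‖ₑ ^ 2 ∂(surfaceMeasure d)) := by
  obtain ⟨A, hA, h0, htop, P, hP⟩ := exists_poincareRel_surface hd hΩ hΓ
  have hΩf : volume Ω ≠ ⊤ := hΩ.isBounded.measure_lt_top.ne
  set a := (surfaceMeasure d A).toNNReal with ha
  have ha' : surfaceMeasure d A = a := (ENNReal.coe_toNNReal htop).symm
  have ha0 : a ≠ 0 := fun h => h0 (by rw [ha', h]; rfl)
  refine ⟨a⁻¹ * (2 * P + 2 * (volume Ω).toNNReal), fun s hs => ?_⟩
  set D := ∫⁻ x in Ω, ‖gradient s x‖ₑ ^ 2 with hD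
  set B := ∫⁻ x in ΓD, ‖s x‖ₑ ^ 2 ∂(surfaceMeasure d) with hB
  have m1 : Measurable fun x => ‖s x‖ₑ ^ 2 := hs.continuous.enorm.measurable.pow_const 2
  have key : (a : ℝ≥0∞) * ∫⁻ x in Ω, ‖s x‖ₑ ^ 2 ≤ 2 * (P * D) + 2 * volume Ω * B := by
    calc (a : ℝ≥0∞) * ∫⁻ x in Ω, ‖s x‖ₑ ^ 2
        = ∫⁻ y in A, ∫⁻ x in Ω, ‖s x‖ₑ ^ 2 ∂volume ∂(surfaceMeasure d) := by
          rw [setLIntegral_const, ha', mul_comm]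
      _ ≤ ∫⁻ y in A, ∫⁻ x in Ω, (2 * ‖s y - s x‖ₑ ^ 2 + 2 * ‖s y‖ₑ ^ 2)
            ∂volume ∂(surfaceMeasure d) := by
          refine lintegral_mono fun y => lintegral_mono fun x => ?_
          have := enorm_sub_sq_le (s x) (s y) 0
          rw [sub_zero, sub_zero, ← enorm_neg (s x - s y), neg_sub] at this
          exact this
      _ = ∫⁻ y in A, (2 * (∫⁻ x in Ω, ‖s y - s x‖ₑ ^ 2) + 2 * volume Ω * ‖s y‖ₑ ^ 2)
            ∂(surfaceMeasure d) := by
          refine lintegral_congr fun y => ?_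
          have m2 : Measurable fun x => ‖s y - s x‖ₑ ^ 2 :=
            (continuous_const.sub hs.continuous).enorm.measurable.pow_const 2
          rw [lintegral_add_right _ measurable_const, setLIntegral_const,
            lintegral_const_mul _ m2]
          ring
      _ = 2 * (∫⁻ y in A, ∫⁻ x in Ω, ‖s y - s x‖ₑ ^ 2 ∂volume ∂(surfaceMeasure d)) +
            2 * volume Ω * ∫⁻ y in A, ‖s y‖ₑ ^ 2 ∂(surfaceMeasure d) := by
          rw [lintegral_add_right _ (m1.const_mul _), lintegral_const_mul _ m1,
            lintegral_const_mul' _ _ (by simp)]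
      _ ≤ _ := by
          gcongr
          · exact hP s hs
          · exact lintegral_mono_set hA
  calc _ = (a : ℝ≥0∞)⁻¹ * (a * ∫⁻ x in Ω, ‖s x‖ₑ ^ 2) := by
        rw [← mul_assoc, ENNReal.inv_mul_cancel (by exact_mod_cast ha0) ENNReal.coe_ne_top, one_mul]
    _ ≤ (a : ℝ≥0∞)⁻¹ * (2 * (P * D) + 2 * volume Ω * B) := by gcongr
    _ ≤ (a : ℝ≥0∞)⁻¹ * ((2 * P + 2 * volume Ω) * (D + B)) := by
        gcongr
        -- The missing cross terms are added so that the bound factors through D + B.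
        calc 2 * (P * D) + 2 * volume Ω * B ≤ 2 * (P * D) + 2 * volume Ω * B +
              (2 * P * B + 2 * volume Ω * D) := le_self_add
          _ = _ := by ring
    _ = _ := by
        push_cast [ENNReal.coe_inv ha0, ENNReal.coe_toNNReal hΩf]
        ring

end Trace

/-! ### Cone averages: pairing L^p with H¹. -/

section ConeAverages

variable {d : ℕ} {Ω : Set (EuclideanSpace ℝ (Fin d))}

theorem lintegral_comp_sub_smul {g : EuclideanSpace ℝ (Fin d) → ℝ≥0∞} (hg : Measurable g)
    (a : EuclideanSpace ℝ (Fin d)) {t : ℝ} (ht : 0 < t) :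
    ∫⁻ y, g (a - t • y) = ENNReal.ofReal ((t ^ d)⁻¹) * ∫⁻ y, g y := by
  rw [← lintegral_comp_add_smul hg a ht, ← lintegral_neg_eq_self]
  simp [sub_eq_add_neg]

/-- Averages over the dilated ball `t • B` map `L²` into the dual of `L^q`, with a loss of a power
of `t`. -/
theorem lintegral_mul_translate_le {f g : EuclideanSpace ℝ (Fin d) → ℝ≥0∞} (hf : Measurable f)
    (hg : Measurable g) (B : Set (EuclideanSpace ℝ (Fin d))) {q : ℝ}
    (hq1 : 1 ≤ q) (hq2 : q ≤ 2) {t : ℝ} (ht : 0 < t) :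
    ∫⁻ y, ∫⁻ w in B, f y * g (y + t • w) ≤
      volume B ^ (1 - (2 - q) / q / 2) * ENNReal.ofReal ((t ^ d)⁻¹) ^ ((2 - q) / q / 2) *
        (∫⁻ y, f y ^ q) ^ (1 / q) * (∫⁻ y, g y ^ 2) ^ (1 / 2 : ℝ) := by
  -- The exponent with qθ = 2 - q, so that Hölder bounds the integral of f^(2-q) over the ball by
  -- that of f^q to the power θ.
  set θ : ℝ := (2 - q) / q with hθ
  have hq0 : 0 < q := by linarith
  have hθ0 : 0 ≤ θ := div_nonneg (by linarith) hq0.le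
  have hθ1 : θ ≤ 1 := by rw [hθ, div_le_one hq0]; linarith
  have hqθ : q * θ = 2 - q := by rw [hθ]; field_simp
  set I := ∫⁻ y, f y ^ q with hI
  set J := ∫⁻ y, g y ^ 2 with hJ
  set T := ENNReal.ofReal ((t ^ d)⁻¹) with hT
  have mgt : Measurable fun z : EuclideanSpace ℝ (Fin d) × EuclideanSpace ℝ (Fin d) =>
      g (z.1 + t • z.2) := hg.comp (by fun_prop)
  have mft : Measurable fun z : EuclideanSpace ℝ (Fin d) × EuclideanSpace ℝ (Fin d) =>
      f z.1 := hf.comp measurable_fst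
  -- The splitting fg = (f^q)^(1/2) (f^(2-q) g²)^(1/2) prepares Cauchy-Schwarz on the product space.
  -- In the second factor the translation is then moved from g to f.
  have e1 : ∀ a b : ℝ≥0∞, (a ^ q) ^ (1 / 2 : ℝ) * (a ^ (2 - q) * b ^ 2) ^ (1 / 2 : ℝ) = a * b := by
    intro a b
    rw [ENNReal.mul_rpow_of_nonneg _ _ (by norm_num), ← ENNReal.rpow_mul, ← ENNReal.rpow_mul,
      ← ENNReal.rpow_natCast b, ← ENNReal.rpow_mul, ← mul_assoc,
      ← ENNReal.rpow_add_of_nonneg _ _ (by positivity) (by nlinarith)]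
    have : q * (1 / 2) + (2 - q) * (1 / 2) = 1 := by ring
    rw [this]; norm_num
  have mfg : Measurable fun z : EuclideanSpace ℝ (Fin d) × EuclideanSpace ℝ (Fin d) =>
      f z.1 ^ (2 - q) * g (z.1 + t • z.2) ^ 2 := (mft.pow_const _).mul (mgt.pow_const 2)
  have mfg1 : Measurable fun z : EuclideanSpace ℝ (Fin d) × EuclideanSpace ℝ (Fin d) =>
      f z.1 * g (z.1 + t • z.2) := mft.mul mgt
  have cs := ENNReal.lintegral_mul_norm_pow_le (μ := volume.prod (volume.restrict B))
    (f := fun z => f z.1 ^ q) (g := fun z => f z.1 ^ (2 - q) * g (z.1 + t • z.2) ^ 2)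
    (mft.pow_const q).aemeasurable mfg.aemeasurable
    (p := 1 / 2) (q := 1 / 2) (by norm_num) (by norm_num) (by norm_num)
  simp only [e1] at cs
  rw [lintegral_prod _ mfg1.aemeasurable,
    lintegral_prod _ (mft.pow_const q).aemeasurable,
    lintegral_prod _ mfg.aemeasurable] at cs
  have h1 : ∫⁻ y, ∫⁻ _ in B, f y ^ q = volume B * I := by
    simp_rw [setLIntegral_const]
    rw [lintegral_mul_const _ (hf.pow_const q), mul_comm]
  -- The substitution in w costs t^(-d), but only to the power θ, and to the power θ/2 after the
  -- square root in Cauchy-Schwarz.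
  have inner_le : ∀ x, ∫⁻ w in B, f (x - t • w) ^ (2 - q) ≤
      (T * I) ^ θ * volume B ^ (1 - θ) := by
    intro x
    have mx : Measurable fun w => f (x - t • w) ^ q :=
      (hf.comp (by fun_prop : Measurable fun w => x - t • w)).pow_const q
    have := ENNReal.lintegral_mul_norm_pow_le (μ := volume.restrict B)
      (f := fun w => f (x - t • w) ^ q) (g := fun _ => 1) mx.aemeasurable aemeasurable_const
      (p := θ) (q := 1 - θ) hθ0 (by linarith) (by ring)
    simp only [ENNReal.one_rpow, mul_one, ← ENNReal.rpow_mul, hqθ, lintegral_one,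
      Measure.restrict_apply_univ] at this
    refine this.trans ?_
    gcongr
    refine (setLIntegral_le_lintegral _ _).trans (le_of_eq ?_)
    exact lintegral_comp_sub_smul (g := fun y => f y ^ q) (hf.pow_const q) x ht
  have h2 : ∫⁻ y, ∫⁻ w in B, f y ^ (2 - q) * g (y + t • w) ^ 2 ≤
      (T * I) ^ θ * volume B ^ (1 - θ) * J := by
    calc ∫⁻ y, ∫⁻ w in B, f y ^ (2 - q) * g (y + t • w) ^ 2
        = ∫⁻ w in B, ∫⁻ y, f y ^ (2 - q) * g (y + t • w) ^ 2 :=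
          lintegral_lintegral_swap mfg.aemeasurable
      _ = ∫⁻ w in B, ∫⁻ x, f (x - t • w) ^ (2 - q) * g x ^ 2 := by
          refine lintegral_congr fun w => ?_
          rw [← lintegral_add_right_eq_self (fun x => f (x - t • w) ^ (2 - q) * g x ^ 2) (t • w)]
          simp
      _ = ∫⁻ x, ∫⁻ w in B, f (x - t • w) ^ (2 - q) * g x ^ 2 := by
          refine lintegral_lintegral_swap (Measurable.aemeasurable ?_)
          exact ((hf.comp (by fun_prop : Measurable fun z :
            EuclideanSpace ℝ (Fin d) × EuclideanSpace ℝ (Fin d) => z.2 - t • z.1)).pow_const _).mul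
              ((hg.comp measurable_snd).pow_const 2)
      _ ≤ ∫⁻ x, (T * I) ^ θ * volume B ^ (1 - θ) * g x ^ 2 := by
          refine lintegral_mono fun x => ?_
          have mx : Measurable fun w => f (x - t • w) ^ (2 - q) :=
            (hf.comp (by fun_prop : Measurable fun w => x - t • w)).pow_const _
          rw [lintegral_mul_const _ mx]
          gcongr
          exact inner_le x
      _ = _ := by rw [lintegral_const_mul _ (hg.pow_const 2)]
  refine cs.trans ?_
  calc _ ≤ (volume B * I) ^ (1 / 2 : ℝ) * ((T * I) ^ θ * volume B ^ (1 - θ) * J) ^ (1 / 2 : ℝ) := by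
        rw [h1]; gcongr
    _ = _ := by
        have hh : (0 : ℝ) ≤ 1 / 2 := by norm_num
        rw [ENNReal.mul_rpow_of_nonneg _ _ hh, ENNReal.mul_rpow_of_nonneg _ _ hh,
          ENNReal.mul_rpow_of_nonneg _ _ hh, ENNReal.mul_rpow_of_nonneg _ _ hθ0,
          ENNReal.mul_rpow_of_nonneg _ _ hh, ← ENNReal.rpow_mul, ← ENNReal.rpow_mul,
          ← ENNReal.rpow_mul]
        have eB : volume B ^ (1 - θ / 2) =
            volume B ^ (1 / 2 : ℝ) * volume B ^ ((1 - θ) * (1 / 2)) := by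
          rw [← ENNReal.rpow_add_of_nonneg _ _ hh (by nlinarith)]; congr 1; ring
        have eI : I ^ (1 / q) = I ^ (1 / 2 : ℝ) * I ^ (θ * (1 / 2)) := by
          rw [← ENNReal.rpow_add_of_nonneg _ _ hh (by positivity)]
          congr 1; rw [hθ]; field_simp; ring
        rw [eB, eI]
        have : θ * (1 / 2) = θ / 2 := by ring
        rw [this]
        ring

/-- The integrand is t^(-da). Its integrability at zero is where the relation between the exponent
of the load and the dimension enters. -/
theorem lintegral_rpow_inv_pow_lt_top {a : ℝ} (ha : (d : ℝ) * a < 1) :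
    ∫⁻ t in Ioc (0 : ℝ) 1, ENNReal.ofReal ((t ^ d)⁻¹) ^ a < ⊤ := by
  have h1 : IntervalIntegrable (fun t : ℝ => t ^ (-(d * a))) volume 0 1 :=
    intervalIntegral.intervalIntegrable_rpow' (by linarith)
  rw [intervalIntegrable_iff_integrableOn_Ioc_of_le zero_le_one] at h1
  refine lt_of_le_of_lt (le_of_eq ?_) h1.2
  refine setLIntegral_congr_fun measurableSet_Ioc fun t ht => ?_
  have ht0 : 0 < t := ht.1
  simp only
  rw [ENNReal.ofReal_rpow_of_pos (by positivity), ← ofReal_norm, Real.norm_of_nonneg (by positivity)]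
  congr 1
  rw [Real.rpow_neg ht0.le, Real.rpow_mul ht0.le, Real.rpow_natCast, Real.inv_rpow (by positivity)]

/-- For w in the ball of directions, s y equals s (y + w) minus the integral of the derivative along
y + t w, a path that the cone keeps in Ω. Averaging over w and applying `lintegral_mul_translate_le`
for each t leaves the integrable weight t^(-da). This dual estimate takes the place of a Sobolev
embedding. -/
theorem lintegral_mul_enorm_le_local {N : Set (EuclideanSpace ℝ (Fin d))} (hΩm : MeasurableSet Ω)
    (hN : MeasurableSet N) {c : EuclideanSpace ℝ (Fin d)} {ρ : ℝ} (hρ : 0 < ρ)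
    (hcone : ∀ z ∈ N ∩ Ω, ∀ w ∈ Metric.ball c ρ, ∀ t ∈ Ioc (0 : ℝ) 1, z + t • w ∈ Ω)
    {q : ℝ} (hq1 : 1 ≤ q) (hq2 : q ≤ 2) (hqd : (d : ℝ) * ((2 - q) / q / 2) < 1) :
    ∃ C : ℝ≥0, ∀ s : EuclideanSpace ℝ (Fin d) → ℝ, ContDiff ℝ ∞ s →
      ∀ f : EuclideanSpace ℝ (Fin d) → ℝ≥0∞, Measurable f →
      ∫⁻ x in N ∩ Ω, f x * ‖s x‖ₑ ≤ C * (∫⁻ x in Ω, f x ^ q) ^ (1 / q) *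
        ((∫⁻ x in Ω, ‖s x‖ₑ ^ 2) ^ (1 / 2 : ℝ) +
          (∫⁻ x in Ω, ‖gradient s x‖ₑ ^ 2) ^ (1 / 2 : ℝ)) := by
  set B := Metric.ball c ρ with hB
  have hBm : MeasurableSet B := measurableSet_ball
  have hB0 : volume B ≠ 0 := (Metric.measure_ball_pos volume c hρ).ne'
  have hBt : volume B ≠ ⊤ := measure_ball_lt_top.ne
  set a : ℝ := (2 - q) / q / 2 with ha
  have hq0 : 0 < q := by linarith
  have ha0 : 0 ≤ a := div_nonneg (div_nonneg (by linarith) hq0.le) (by norm_num)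
  have ha1 : 0 ≤ 1 - a := by
    have : (2 - q) / q ≤ 1 := by rw [div_le_one hq0]; linarith
    rw [ha]; linarith
  set R : ℝ := ‖c‖ + ρ with hR
  set τ := ∫⁻ t in Ioc (0 : ℝ) 1, ENNReal.ofReal ((t ^ d)⁻¹) ^ a with hτ
  have hτt : τ ≠ ⊤ := (lintegral_rpow_inv_pow_lt_top hqd).ne
  set b := volume B ^ (1 - a) with hb
  have hbt : b ≠ ⊤ := ENNReal.rpow_ne_top_of_nonneg ha1 hBt
  -- The 1 comes from the endpoint t = 1, and Rτ from the gradient along the path: R bounds ‖w‖ and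
  -- τ is the integral of the weight.
  set C : ℝ≥0∞ := (volume B)⁻¹ * (b * (1 + ENNReal.ofReal R * τ)) with hC
  have hCt : C ≠ ⊤ := by
    refine ENNReal.mul_ne_top (ENNReal.inv_ne_top.2 hB0) (ENNReal.mul_ne_top hbt ?_)
    exact ENNReal.add_ne_top.2 ⟨by simp, ENNReal.mul_ne_top (by simp) hτt⟩
  refine ⟨C.toNNReal, fun s hs f hf => ?_⟩
  rw [ENNReal.coe_toNNReal hCt]
  set I := (∫⁻ x in Ω, f x ^ q) ^ (1 / q) with hI
  set U := (∫⁻ x in Ω, ‖s x‖ₑ ^ 2) ^ (1 / 2 : ℝ) with hU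
  set D := (∫⁻ x in Ω, ‖gradient s x‖ₑ ^ 2) ^ (1 / 2 : ℝ) with hD
  set f₀ := (N ∩ Ω).indicator f with hf₀
  set u₀ := Ω.indicator fun x => ‖s x‖ₑ with hu₀
  set g₀ := Ω.indicator fun x => ‖gradient s x‖ₑ with hg₀
  have mf : Measurable f₀ := hf.indicator (hN.inter hΩm)
  have mu : Measurable u₀ := hs.continuous.enorm.measurable.indicator hΩm
  have mg : Measurable g₀ := (contDiff_gradient hs).enorm.measurable.indicator hΩm
  have sqind : ∀ h : EuclideanSpace ℝ (Fin d) → ℝ≥0∞,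
      ∫⁻ y, (Ω.indicator h y) ^ 2 = ∫⁻ y in Ω, h y ^ 2 := by
    intro h
    rw [← lintegral_indicator hΩm]
    refine lintegral_congr fun y => ?_
    by_cases hy : y ∈ Ω <;> simp [hy]
  have fle : (∫⁻ y, f₀ y ^ q) ^ (1 / q) ≤ I := by
    rw [hI, ← lintegral_indicator hΩm]
    gcongr with y
    by_cases hy : y ∈ N ∩ Ω
    · rw [hf₀, indicator_of_mem hy, indicator_of_mem hy.2]
    · rw [hf₀, indicator_of_notMem hy, ENNReal.zero_rpow_of_pos hq0]; exact zero_le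
  have est : ∀ h : EuclideanSpace ℝ (Fin d) → ℝ≥0∞, Measurable h → ∀ t : ℝ, 0 < t →
      ∫⁻ y, ∫⁻ w in B, f₀ y * Ω.indicator h (y + t • w) ≤
        b * ENNReal.ofReal ((t ^ d)⁻¹) ^ a * I * (∫⁻ y in Ω, h y ^ 2) ^ (1 / 2 : ℝ) := by
    intro h hh t ht
    refine (lintegral_mul_translate_le mf (hh.indicator hΩm) B hq1 hq2 ht).trans ?_
    rw [sqind]
    gcongr
  have pw : ∀ y, ∀ w ∈ B, f₀ y * ‖s y‖ₑ ≤ f₀ y * u₀ (y + (1 : ℝ) • w) +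
      ENNReal.ofReal R * ∫⁻ t in Ioc (0 : ℝ) 1, f₀ y * g₀ (y + t • w) := by
    intro y w hw
    by_cases hy : y ∈ N ∩ Ω
    swap
    · rw [hf₀, indicator_of_notMem hy]; simp
    have m1 : Measurable fun t : ℝ => g₀ (y + t • w) := mg.comp (by fun_prop)
    have m2 : Measurable fun t : ℝ => ‖gradient s (y + t • w)‖ₑ :=
      (contDiff_gradient hs).enorm.measurable.comp (by fun_prop)
    rw [lintegral_const_mul _ m1, mul_left_comm, ← mul_add]
    gcongr
    have h1 := enorm_sub_le_lintegral_gradient hs y w zero_le_one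
    rw [lintegral_const_mul _ m2] at h1
    have h2 : ‖s y‖ₑ ≤ ‖s (y + (1 : ℝ) • w)‖ₑ + ‖s (y + (1 : ℝ) • w) - s y‖ₑ := by
      calc ‖s y‖ₑ = ‖s (y + (1 : ℝ) • w) - (s (y + (1 : ℝ) • w) - s y)‖ₑ := by congr 1; ring
        _ ≤ _ := enorm_sub_le
    refine h2.trans (add_le_add ?_ (h1.trans (mul_le_mul' ?_ ?_)))
    · rw [hu₀, indicator_of_mem (hcone y hy w hw 1 ⟨one_pos, le_rfl⟩)]
    · rw [← ofReal_norm]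
      apply ENNReal.ofReal_le_ofReal
      have : ‖w - c‖ < ρ := by simpa [hB, dist_eq_norm] using hw
      calc ‖w‖ = ‖c + (w - c)‖ := by congr 1; abel
        _ ≤ _ := (norm_add_le _ _).trans (by rw [hR]; linarith)
    · refine setLIntegral_mono' measurableSet_Ioc fun t ht => ?_
      rw [hg₀, indicator_of_mem (hcone y hy w hw t ht)]
  have m3 : Measurable fun z : (EuclideanSpace ℝ (Fin d) × EuclideanSpace ℝ (Fin d)) × ℝ =>
      f₀ z.1.1 * g₀ (z.1.1 + z.2 • z.1.2) :=
    (mf.comp (by fun_prop)).mul (mg.comp (by fun_prop))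
  have m3' : Measurable fun z : (EuclideanSpace ℝ (Fin d) × ℝ) × EuclideanSpace ℝ (Fin d) =>
      f₀ z.1.1 * g₀ (z.1.1 + z.1.2 • z.2) :=
    (mf.comp (by fun_prop)).mul (mg.comp (by fun_prop))
  have m4 : Measurable fun z : EuclideanSpace ℝ (Fin d) × EuclideanSpace ℝ (Fin d) =>
      f₀ z.1 * u₀ (z.1 + (1 : ℝ) • z.2) := (mf.comp (by fun_prop)).mul (mu.comp (by fun_prop))
  have key : volume B * ∫⁻ x in N ∩ Ω, f x * ‖s x‖ₑ ≤
      b * (1 + ENNReal.ofReal R * τ) * I * (U + D) := by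
    calc volume B * ∫⁻ x in N ∩ Ω, f x * ‖s x‖ₑ
        = ∫⁻ y, ∫⁻ w in B, f₀ y * ‖s y‖ₑ := by
          simp_rw [setLIntegral_const]
          have mfs : Measurable fun y => f₀ y * ‖s y‖ₑ := mf.mul hs.continuous.enorm.measurable
          rw [lintegral_mul_const _ mfs, mul_comm,
            ← lintegral_indicator (hN.inter hΩm)]
          congr 1
          refine lintegral_congr fun y => ?_
          by_cases hy : y ∈ N ∩ Ω
          · rw [hf₀, indicator_of_mem hy, indicator_of_mem hy]
          · rw [hf₀, indicator_of_notMem hy, indicator_of_notMem hy, zero_mul]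
      _ ≤ ∫⁻ y, ∫⁻ w in B, (f₀ y * u₀ (y + (1 : ℝ) • w) +
            ENNReal.ofReal R * ∫⁻ t in Ioc (0 : ℝ) 1, f₀ y * g₀ (y + t • w)) :=
          lintegral_mono fun y => setLIntegral_mono' hBm (pw y)
      _ = (∫⁻ y, ∫⁻ w in B, f₀ y * u₀ (y + (1 : ℝ) • w)) + ENNReal.ofReal R *
            ∫⁻ y, ∫⁻ w in B, ∫⁻ t in Ioc (0 : ℝ) 1, f₀ y * g₀ (y + t • w) := by
          rw [← lintegral_const_mul' _ _ (by simp), ← lintegral_add_left m4.lintegral_prod_right']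
          refine lintegral_congr fun y => ?_
          rw [← lintegral_const_mul' _ _ (by simp), ← lintegral_add_left]
          exact m4.comp (by fun_prop : Measurable fun w => (y, w))
      _ = (∫⁻ y, ∫⁻ w in B, f₀ y * u₀ (y + (1 : ℝ) • w)) + ENNReal.ofReal R *
            ∫⁻ t in Ioc (0 : ℝ) 1, ∫⁻ y, ∫⁻ w in B, f₀ y * g₀ (y + t • w) := by
          congr 2
          refine Eq.trans ?_ (lintegral_lintegral_swap
            (f := fun y t => ∫⁻ w in B, f₀ y * g₀ (y + t • w))
            m3'.lintegral_prod_right'.aemeasurable)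
          refine lintegral_congr fun y => lintegral_lintegral_swap (Measurable.aemeasurable ?_)
          exact m3.comp (by fun_prop : Measurable fun z : EuclideanSpace ℝ (Fin d) × ℝ =>
            ((y, z.1), z.2))
      _ ≤ b * I * U + ENNReal.ofReal R * ∫⁻ t in Ioc (0 : ℝ) 1,
            ENNReal.ofReal ((t ^ d)⁻¹) ^ a * (b * I * D) := by
          gcongr ?_ + ENNReal.ofReal R * ?_
          · refine (est (fun x => ‖s x‖ₑ) hs.continuous.enorm.measurable 1 one_pos).trans
              (le_of_eq ?_)
            rw [hU]; simp
          · refine setLIntegral_mono' measurableSet_Ioc fun t ht => ?_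
            refine (est (fun x => ‖gradient s x‖ₑ) (contDiff_gradient hs).enorm.measurable t
              ht.1).trans (le_of_eq ?_)
            ring
      _ = b * I * U + ENNReal.ofReal R * (τ * (b * I * D)) := by
          rw [lintegral_mul_const]
          exact (ENNReal.measurable_ofReal.comp (by fun_prop)).pow_const a
      _ ≤ b * I * U + ENNReal.ofReal R * (τ * (b * I * D)) +
            (b * I * D + ENNReal.ofReal R * (τ * (b * I * U))) := le_self_add
      _ = _ := by ring
  calc ∫⁻ x in N ∩ Ω, f x * ‖s x‖ₑ
      = (volume B)⁻¹ * (volume B * ∫⁻ x in N ∩ Ω, f x * ‖s x‖ₑ) := by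
        rw [← mul_assoc, ENNReal.inv_mul_cancel hB0 hBt, one_mul]
    _ ≤ (volume B)⁻¹ * (b * (1 + ENNReal.ofReal R * τ) * I * (U + D)) := by gcongr
    _ = _ := by rw [hC]; ring

theorem IsBoundedLipschitzDomain.exists_lintegral_mul_enorm_le (hΩ : IsBoundedLipschitzDomain Ω)
    {q : ℝ} (hq1 : 1 ≤ q) (hq2 : q ≤ 2) (hqd : (d : ℝ) * ((2 - q) / q / 2) < 1) :
    ∃ C : ℝ≥0, ∀ s : EuclideanSpace ℝ (Fin d) → ℝ, ContDiff ℝ ∞ s →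
      ∀ f : EuclideanSpace ℝ (Fin d) → ℝ≥0∞, Measurable f →
      ∫⁻ x in Ω, f x * ‖s x‖ₑ ≤ C * (∫⁻ x in Ω, f x ^ q) ^ (1 / q) *
        ((∫⁻ x in Ω, ‖s x‖ₑ ^ 2) ^ (1 / 2 : ℝ) +
          (∫⁻ x in Ω, ‖gradient s x‖ₑ ^ 2) ^ (1 / 2 : ℝ)) := by
  have hΩm := hΩ.isOpen.measurableSet
  have loc : ∀ x ∈ closure Ω, ∃ N ∈ 𝓝 x, ∃ C : ℝ≥0,
      ∀ s : EuclideanSpace ℝ (Fin d) → ℝ, ContDiff ℝ ∞ s →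
      ∀ f : EuclideanSpace ℝ (Fin d) → ℝ≥0∞, Measurable f →
      ∫⁻ x in N ∩ Ω, f x * ‖s x‖ₑ ≤ C * (∫⁻ x in Ω, f x ^ q) ^ (1 / q) *
        ((∫⁻ x in Ω, ‖s x‖ₑ ^ 2) ^ (1 / 2 : ℝ) +
          (∫⁻ x in Ω, ‖gradient s x‖ₑ ^ 2) ^ (1 / 2 : ℝ)) := by
    intro x hx
    obtain ⟨N, hN, c, ρ, hρ, hcone⟩ := hΩ.exists_cone hx
    obtain ⟨δ, hδ, hδN⟩ := Metric.mem_nhds_iff.1 hN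
    exact ⟨Metric.ball x δ, Metric.ball_mem_nhds _ hδ,
      lintegral_mul_enorm_le_local hΩm measurableSet_ball hρ
        (fun z hz => hcone z ⟨hδN hz.1, subset_closure hz.2⟩) hq1 hq2 hqd⟩
  choose! N hN C hC using loc
  obtain ⟨t, ht, hcov⟩ := hΩ.isBounded.isCompact_closure.elim_nhds_subcover N hN
  refine ⟨∑ x ∈ t, C x, fun s hs f hf => ?_⟩
  have hsub : Ω ⊆ ⋃ x ∈ t, N x ∩ Ω := fun y hy => by
    obtain ⟨x, hx, hyx⟩ := mem_iUnion₂.1 (hcov (subset_closure hy))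
    exact mem_iUnion₂.2 ⟨x, hx, hyx, hy⟩
  calc ∫⁻ x in Ω, f x * ‖s x‖ₑ ≤ ∫⁻ x in ⋃ x ∈ t, N x ∩ Ω, f x * ‖s x‖ₑ := lintegral_mono_set hsub
    _ ≤ ∑ i ∈ t, ∫⁻ x in N i ∩ Ω, f x * ‖s x‖ₑ := by
        rw [← lintegral_finsetSum_measure]
        exact lintegral_mono' (restrict_biUnion_finset_le_sum t _) le_rfl
    _ ≤ ∑ i ∈ t, (C i : ℝ≥0∞) * ((∫⁻ x in Ω, f x ^ q) ^ (1 / q) *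
        ((∫⁻ x in Ω, ‖s x‖ₑ ^ 2) ^ (1 / 2 : ℝ) +
          (∫⁻ x in Ω, ‖gradient s x‖ₑ ^ 2) ^ (1 / 2 : ℝ))) := by
        refine Finset.sum_le_sum fun i hi => (hC i (ht i hi) s hs f hf).trans (le_of_eq ?_)
        ring
    _ = _ := by rw [← Finset.sum_mul]; push_cast; ring

theorem eLpNorm_two_eq {F α : Type*} [NormedAddCommGroup F] [MeasurableSpace α] {μ : Measure α}
    (u : α → F) : eLpNorm u 2 μ = (∫⁻ x, ‖u x‖ₑ ^ 2 ∂μ) ^ (1 / 2 : ℝ) := by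
  rw [eLpNorm_eq_lintegral_rpow_enorm_toReal (by norm_num) (by norm_num)]
  norm_num

/-- Limits in `H¹(Ω)` of smooth functions pair with `L^p` functions when `p > d / 2`. -/
theorem IsBoundedLipschitzDomain.exists_pairing_le (hΩ : IsBoundedLipschitzDomain Ω) (p : ℝ≥0∞)
    (hp1 : 1 ≤ p) (hpd : (d : ℝ≥0∞) / 2 < p) :
    ∃ C : ℝ≥0, ∀ f : EuclideanSpace ℝ (Fin d) → ℝ, MemLp f p (volume.restrict Ω) →
      ∀ (u : EuclideanSpace ℝ (Fin d) → ℝ) (G : EuclideanSpace ℝ (Fin d) → EuclideanSpace ℝ (Fin d))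
        (s : ℕ → EuclideanSpace ℝ (Fin d) → ℝ), MemLp u 2 (volume.restrict Ω) →
        MemLp G 2 (volume.restrict Ω) → (∀ n, ContDiff ℝ ∞ (s n)) →
        Tendsto (fun n => eLpNorm (fun x => s n x - u x) 2 (volume.restrict Ω)) atTop (𝓝 0) →
        Tendsto (fun n => eLpNorm (fun x => gradient (s n) x - G x) 2 (volume.restrict Ω))
          atTop (𝓝 0) →
        ∫⁻ x in Ω, ‖f x‖ₑ * ‖u x‖ₑ ≤ C * eLpNorm f p (volume.restrict Ω) *
          (eLpNorm u 2 (volume.restrict Ω) + eLpNorm G 2 (volume.restrict Ω)) := by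
  -- The choice is q = min(p, 2). If q = p ≤ 2, then d(2 - q) ≤ d < 2q because q ≥ 1 and p > d/2;
  -- this is the required inequality.
  obtain ⟨q, hq1, hq2, hqp, hqd⟩ : ∃ q : ℝ, 1 ≤ q ∧ q ≤ 2 ∧ ENNReal.ofReal q ≤ p ∧
      (d : ℝ) * ((2 - q) / q / 2) < 1 := by
    rcases le_total 2 p with h | h
    · exact ⟨2, by norm_num, le_rfl, by simpa using h, by norm_num⟩
    · have hpt : p ≠ ⊤ := (h.trans_lt (by simp)).ne
      have h1 : 1 ≤ p.toReal := by simpa using ENNReal.toReal_mono hpt hp1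
      have h2 : p.toReal ≤ 2 := by simpa using ENNReal.toReal_mono (by simp) h
      refine ⟨p.toReal, h1, h2, by rw [ENNReal.ofReal_toReal hpt], ?_⟩
      have h3 : (d : ℝ) / 2 < p.toReal := by
        have := (ENNReal.toReal_lt_toReal (hpd.trans_le le_top).ne hpt).2 hpd
        simpa using this
      have h4 : (d : ℝ) * ((2 - p.toReal) / p.toReal / 2) =
          (d * (2 - p.toReal)) / (p.toReal * 2) := by field_simp
      rw [h4, div_lt_one (by linarith)]
      have : (0 : ℝ) ≤ d := d.cast_nonneg
      nlinarith
  obtain ⟨C, hC⟩ := hΩ.exists_lintegral_mul_enorm_le hq1 hq2 hqd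
  have hΩf : volume Ω ≠ ⊤ := hΩ.isBounded.measure_lt_top.ne
  have hfin : IsFiniteMeasure (volume.restrict Ω) := ⟨by simpa using hΩf.lt_top⟩
  have hq0 : 0 < q := by linarith
  set κ : ℝ≥0∞ := (volume.restrict Ω) univ ^ (1 / (ENNReal.ofReal q).toReal - 1 / p.toReal) with hκ
  have hκt : κ ≠ ⊤ := by
    refine ENNReal.rpow_ne_top_of_nonneg ?_ (measure_ne_top _ _)
    rcases eq_or_ne p ⊤ with rfl | hpt
    · simp
    · have h1 := ENNReal.toReal_mono hpt hqp
      rw [ENNReal.toReal_ofReal hq0.le] at h1 ⊢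
      rw [sub_nonneg]
      exact one_div_le_one_div_of_le hq0 h1
  refine ⟨C * κ.toNNReal, fun f hf u G s hu hG hs h1 h2 => ?_⟩
  set μ := volume.restrict Ω with hμ
  set f₁ : EuclideanSpace ℝ (Fin d) → ℝ≥0∞ := fun x => ‖hf.1.mk f x‖ₑ with hf₁
  have mf₁ : Measurable f₁ := hf.1.stronglyMeasurable_mk.enorm
  have hff : ∀ᵐ x ∂μ, ‖f x‖ₑ = f₁ x := by
    filter_upwards [hf.1.ae_eq_mk] with x hx
    simp only [hf₁]
    rw [← hx]
  have hfq : (∫⁻ x in Ω, f₁ x ^ q) ^ (1 / q) ≤ κ * eLpNorm f p μ := by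
    have e1 : (∫⁻ x in Ω, f₁ x ^ q) ^ (1 / q) = eLpNorm f (ENNReal.ofReal q) μ := by
      rw [eLpNorm_eq_lintegral_rpow_enorm_toReal (by simpa using hq0) (by simp),
        ENNReal.toReal_ofReal hq0.le]
      congr 1
      refine lintegral_congr_ae ?_
      filter_upwards [hff] with x hx
      rw [hx]
    rw [e1, mul_comm]
    exact eLpNorm_le_eLpNorm_mul_rpow_measure_univ hqp hf.1
  -- L² convergence yields an almost everywhere convergent subsequence, along which Fatou's lemma
  -- carries the smooth estimate to u.
  obtain ⟨ns, hns, hae⟩ := (tendstoInMeasure_of_tendsto_eLpNorm (f := s) (g := u) (p := 2)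
    (by norm_num) (fun n => (hs n).continuous.aestronglyMeasurable) hu.1 h1).exists_seq_tendsto_ae
  have bound : ∀ n, ∫⁻ x in Ω, f₁ x * ‖s (ns n) x‖ₑ ≤ C * (κ * eLpNorm f p μ) *
      ((eLpNorm (fun x => s (ns n) x - u x) 2 μ + eLpNorm u 2 μ) +
        (eLpNorm (fun x => gradient (s (ns n)) x - G x) 2 μ + eLpNorm G 2 μ)) := by
    intro n
    refine (hC _ (hs (ns n)) f₁ mf₁).trans ?_
    rw [← eLpNorm_two_eq, ← eLpNorm_two_eq]
    gcongr
    · have := eLpNorm_add_le (p := 2) (μ := μ)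
        ((hs (ns n)).continuous.aestronglyMeasurable.sub hu.1) hu.1 (by norm_num)
      rw [sub_add_cancel] at this; exact this
    · have := eLpNorm_add_le (p := 2) (μ := μ)
        ((contDiff_gradient (hs (ns n))).aestronglyMeasurable.sub hG.1) hG.1 (by norm_num)
      rw [sub_add_cancel] at this; exact this
  have hnst : Tendsto ns atTop atTop := hns.tendsto_atTop
  have lim : Tendsto (fun n => (C : ℝ≥0∞) * (κ * eLpNorm f p μ) *
      ((eLpNorm (fun x => s (ns n) x - u x) 2 μ + eLpNorm u 2 μ) +
        (eLpNorm (fun x => gradient (s (ns n)) x - G x) 2 μ + eLpNorm G 2 μ))) atTop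
      (𝓝 ((C : ℝ≥0∞) * (κ * eLpNorm f p μ) * (eLpNorm u 2 μ + eLpNorm G 2 μ))) := by
    refine ENNReal.Tendsto.const_mul ?_ (Or.inr ?_)
    · have := ((h1.comp hnst).add_const (eLpNorm u 2 μ)).add
        ((h2.comp hnst).add_const (eLpNorm G 2 μ))
      simpa using this
    · exact ENNReal.mul_ne_top ENNReal.coe_ne_top (ENNReal.mul_ne_top hκt hf.2.ne)
  calc ∫⁻ x in Ω, ‖f x‖ₑ * ‖u x‖ₑ
      = ∫⁻ x in Ω, liminf (fun n => f₁ x * ‖s (ns n) x‖ₑ) atTop := by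
        refine lintegral_congr_ae ?_
        filter_upwards [hff, hae] with x hx hx'
        rw [hx]
        refine (Tendsto.liminf_eq ?_).symm
        exact ENNReal.Tendsto.const_mul (continuous_enorm.tendsto _ |>.comp hx')
          (Or.inr (by simp [hf₁]))
    _ ≤ liminf (fun n => ∫⁻ x in Ω, f₁ x * ‖s (ns n) x‖ₑ) atTop :=
        lintegral_liminf_le fun n => mf₁.mul (hs (ns n)).continuous.enorm.measurable
    _ ≤ liminf (fun n => (C : ℝ≥0∞) * (κ * eLpNorm f p μ) *
      ((eLpNorm (fun x => s (ns n) x - u x) 2 μ + eLpNorm u 2 μ) +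
        (eLpNorm (fun x => gradient (s (ns n)) x - G x) 2 μ + eLpNorm G 2 μ))) atTop :=
        liminf_le_liminf (Eventually.of_forall bound)
    _ = _ := by
        rw [lim.liminf_eq, ENNReal.coe_mul, ENNReal.coe_toNNReal hκt]
        ring

end ConeAverages

/-! ### H¹_D(Ω) as a closed subspace of L² × L². -/

section DirichletSpace

variable {d : ℕ} {Ω ΓD ΓN : Set (EuclideanSpace ℝ (Fin d))}

/-- `(u, G)` is the limit in `L²(Ω)` of `(s n, ∇ (s n))` for smooth functions `s n` whose boundary
values tend to zero in `L²(ΓD)`. -/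
def IsDirichletLimit (Ω ΓD : Set (EuclideanSpace ℝ (Fin d))) (u : EuclideanSpace ℝ (Fin d) → ℝ)
    (G : EuclideanSpace ℝ (Fin d) → EuclideanSpace ℝ (Fin d)) : Prop :=
  ∃ s : ℕ → EuclideanSpace ℝ (Fin d) → ℝ, (∀ n, ContDiff ℝ ∞ (s n)) ∧
    Tendsto (fun n => eLpNorm (fun x => s n x - u x) 2 (volume.restrict Ω)) atTop (𝓝 0) ∧
    Tendsto (fun n => eLpNorm (fun x => gradient (s n) x - G x) 2 (volume.restrict Ω))
      atTop (𝓝 0) ∧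
    Tendsto (fun n => eLpNorm (s n) 2 ((surfaceMeasure d).restrict ΓD)) atTop (𝓝 0)

theorem hasTrace_zero_iff {u : EuclideanSpace ℝ (Fin d) → ℝ} :
    HasTrace Ω ΓD u 0 ↔ IsDirichletLimit Ω ΓD u (weakGrad Ω u) := by
  simp only [HasTrace, IsDirichletLimit, Pi.zero_apply, sub_zero]

theorem IsDirichletLimit.congr {u u' : EuclideanSpace ℝ (Fin d) → ℝ}
    {G G' : EuclideanSpace ℝ (Fin d) → EuclideanSpace ℝ (Fin d)}
    (h : IsDirichletLimit Ω ΓD u G) (hu : u =ᵐ[volume.restrict Ω] u')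
    (hG : G =ᵐ[volume.restrict Ω] G') : IsDirichletLimit Ω ΓD u' G' := by
  obtain ⟨s, hs, h1, h2, h3⟩ := h
  refine ⟨s, hs, h1.congr fun n => eLpNorm_congr_ae ?_, h2.congr fun n => eLpNorm_congr_ae ?_, h3⟩
  · filter_upwards [hu] with x hx; rw [hx]
  · filter_upwards [hG] with x hx; rw [hx]

/-- The sequence-free form turns the diagonal argument for closedness into a splitting of ε into
halves. -/
theorem isDirichletLimit_iff {u : EuclideanSpace ℝ (Fin d) → ℝ}
    {G : EuclideanSpace ℝ (Fin d) → EuclideanSpace ℝ (Fin d)} :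
    IsDirichletLimit Ω ΓD u G ↔ ∀ ε : ℝ≥0∞, 0 < ε → ∃ s : EuclideanSpace ℝ (Fin d) → ℝ,
      ContDiff ℝ ∞ s ∧ eLpNorm (fun x => s x - u x) 2 (volume.restrict Ω) < ε ∧
      eLpNorm (fun x => gradient s x - G x) 2 (volume.restrict Ω) < ε ∧
      eLpNorm s 2 ((surfaceMeasure d).restrict ΓD) < ε := by
  constructor
  · rintro ⟨s, hs, h1, h2, h3⟩ ε hε
    obtain ⟨n, hn1, hn2, hn3⟩ := ((h1.eventually_lt_const hε).and
      ((h2.eventually_lt_const hε).and (h3.eventually_lt_const hε))).exists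
    exact ⟨s n, hs n, hn1, hn2, hn3⟩
  · intro h
    obtain ⟨ε, -, hε0, hε⟩ := exists_seq_strictAnti_tendsto' (zero_lt_one (α := ℝ≥0∞))
    choose s hs h1 h2 h3 using fun n => h (ε n) (hε0 n).1
    exact ⟨s, hs, tendsto_of_tendsto_of_tendsto_of_le_of_le tendsto_const_nhds hε
      (fun _ => zero_le) fun n => (h1 n).le, tendsto_of_tendsto_of_tendsto_of_le_of_le
      tendsto_const_nhds hε (fun _ => zero_le) fun n => (h2 n).le,
      tendsto_of_tendsto_of_tendsto_of_le_of_le tendsto_const_nhds hε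
      (fun _ => zero_le) fun n => (h3 n).le⟩

theorem IsDirichletLimit.combo {u u' : EuclideanSpace ℝ (Fin d) → ℝ}
    {G G' : EuclideanSpace ℝ (Fin d) → EuclideanSpace ℝ (Fin d)}
    (hu : MemLp u 2 (volume.restrict Ω)) (hu' : MemLp u' 2 (volume.restrict Ω))
    (hG : MemLp G 2 (volume.restrict Ω)) (hG' : MemLp G' 2 (volume.restrict Ω))
    (h : IsDirichletLimit Ω ΓD u G) (h' : IsDirichletLimit Ω ΓD u' G') (a b : ℝ) :
    IsDirichletLimit Ω ΓD (fun x => a * u x + b * u' x) (fun x => a • G x + b • G' x) := by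
  obtain ⟨s, hs, h1, h2, h3⟩ := h
  obtain ⟨s', hs', h1', h2', h3'⟩ := h'
  have lim : ∀ {f g : ℕ → ℝ≥0∞}, Tendsto f atTop (𝓝 0) → Tendsto g atTop (𝓝 0) →
      Tendsto (fun n => ‖a‖ₑ * f n + ‖b‖ₑ * g n) atTop (𝓝 0) := by
    intro f g hf hg
    simpa using (ENNReal.Tendsto.const_mul hf (Or.inr enorm_ne_top)).add
      (ENNReal.Tendsto.const_mul hg (Or.inr enorm_ne_top))
  refine ⟨fun n x => a * s n x + b * s' n x, fun n => (contDiff_const.mul (hs n)).add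
    (contDiff_const.mul (hs' n)), ?_, ?_, ?_⟩
  · refine tendsto_of_tendsto_of_tendsto_of_le_of_le tendsto_const_nhds (lim h1 h1')
      (fun _ => zero_le) fun n => ?_
    have := eLpNorm_add_le (p := 2) (μ := volume.restrict Ω)
      (((hs n).continuous.aestronglyMeasurable.sub hu.1).const_smul a)
      (((hs' n).continuous.aestronglyMeasurable.sub hu'.1).const_smul b) (by norm_num)
    rw [eLpNorm_const_smul, eLpNorm_const_smul] at this
    refine le_trans (le_of_eq ?_) this
    congr 1; ext x; simp; ring
  · refine tendsto_of_tendsto_of_tendsto_of_le_of_le tendsto_const_nhds (lim h2 h2')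
      (fun _ => zero_le) fun n => ?_
    have := eLpNorm_add_le (p := 2) (μ := volume.restrict Ω)
      (((contDiff_gradient (hs n)).aestronglyMeasurable.sub hG.1).const_smul a)
      (((contDiff_gradient (hs' n)).aestronglyMeasurable.sub hG'.1).const_smul b) (by norm_num)
    rw [eLpNorm_const_smul, eLpNorm_const_smul] at this
    refine le_trans (le_of_eq ?_) this
    congr 1; ext1 x
    have e : gradient (fun x => a * s n x + b * s' n x) x =
        a • gradient (s n) x + b • gradient (s' n) x := by
      have d1 := ((hs n).differentiable (by simp)) x
      have d2 := ((hs' n).differentiable (by simp)) x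
      unfold gradient
      rw [fderiv_fun_add (d1.const_mul a) (d2.const_mul b), fderiv_const_mul d1, fderiv_const_mul d2]
      simp
    rw [e]; simp only [Pi.add_apply, Pi.smul_apply, Pi.sub_apply]; module
  · refine tendsto_of_tendsto_of_tendsto_of_le_of_le tendsto_const_nhds (lim h3 h3')
      (fun _ => zero_le) fun n => ?_
    have := eLpNorm_add_le (p := 2) (μ := (surfaceMeasure d).restrict ΓD)
      ((hs n).continuous.aestronglyMeasurable.const_smul a)
      ((hs' n).continuous.aestronglyMeasurable.const_smul b) (by norm_num)
    rw [eLpNorm_const_smul, eLpNorm_const_smul] at this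
    exact this

theorem isDirichletLimit_zero : IsDirichletLimit Ω ΓD 0 0 := by
  refine ⟨fun _ _ => 0, fun _ => contDiff_const, ?_, ?_, ?_⟩
  · simp
  · have : gradient (fun _ : EuclideanSpace ℝ (Fin d) => (0 : ℝ)) = 0 := by
      ext1 x; exact gradient_fun_const x 0
    simp [this]
  · simp

/-- The space `H¹_D(Ω)`, realized by pairs `(u, ∇u)` in `L²(Ω) × L²(Ω)`. -/
noncomputable def dirichletSpace (Ω ΓD : Set (EuclideanSpace ℝ (Fin d))) :
    Submodule ℝ (Lp ℝ 2 (volume.restrict Ω) × Lp (EuclideanSpace ℝ (Fin d)) 2 (volume.restrict Ω))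
    where
  carrier := {w | IsDirichletLimit Ω ΓD w.1 w.2}
  zero_mem' := isDirichletLimit_zero.congr (Lp.coeFn_zero _ _ _).symm (Lp.coeFn_zero _ _ _).symm
  add_mem' {w w'} h h' := by
    refine (IsDirichletLimit.combo (Lp.memLp w.1) (Lp.memLp w'.1) (Lp.memLp w.2) (Lp.memLp w'.2)
      h h' 1 1).congr ?_ ?_
    · filter_upwards [Lp.coeFn_add w.1 w'.1] with x hx
      rw [Prod.fst_add, hx]; simp
    · filter_upwards [Lp.coeFn_add w.2 w'.2] with x hx
      rw [Prod.snd_add, hx]; simp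
  smul_mem' c w h := by
    refine (IsDirichletLimit.combo (Lp.memLp w.1) (Lp.memLp w.1) (Lp.memLp w.2) (Lp.memLp w.2)
      h h c 0).congr ?_ ?_
    · filter_upwards [Lp.coeFn_smul c w.1] with x hx
      rw [Prod.smul_fst, hx]; simp
    · filter_upwards [Lp.coeFn_smul c w.2] with x hx
      rw [Prod.smul_snd, hx]; simp

theorem mem_dirichletSpace
    {w : Lp ℝ 2 (volume.restrict Ω) × Lp (EuclideanSpace ℝ (Fin d)) 2 (volume.restrict Ω)} :
    w ∈ dirichletSpace Ω ΓD ↔ IsDirichletLimit Ω ΓD w.1 w.2 := Iff.rfl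

theorem eLpNorm_sub_lt_of_dist_lt {F : Type*} [NormedAddCommGroup F]
    {μ : Measure (EuclideanSpace ℝ (Fin d))}
    {s : EuclideanSpace ℝ (Fin d) → F} {u u' : Lp F 2 μ} (hs : AEStronglyMeasurable s μ)
    {ε : ℝ≥0∞} (h : eLpNorm (fun x => s x - u' x) 2 μ < ε / 2) (hu : edist u u' < ε / 2) :
    eLpNorm (fun x => s x - u x) 2 μ < ε := by
  have e : (fun x => s x - u x) =ᵐ[μ] (fun x => s x - u' x) + ⇑(u' - u) := by
    filter_upwards [Lp.coeFn_sub u' u] with x hx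
    rw [Pi.add_apply, hx, Pi.sub_apply, sub_add_sub_cancel]
  rw [eLpNorm_congr_ae e]
  have h3 : eLpNorm (⇑(u' - u)) 2 μ < ε / 2 := by
    rw [edist_comm, Lp.edist_def] at hu
    rwa [eLpNorm_congr_ae (Lp.coeFn_sub u' u)]
  calc _ ≤ _ := eLpNorm_add_le (hs.sub (Lp.aestronglyMeasurable u')) (Lp.aestronglyMeasurable _)
        (by norm_num)
    _ < ε / 2 + ε / 2 := ENNReal.add_lt_add h h3
    _ = ε := ENNReal.add_halves ε

theorem isClosed_dirichletSpace : IsClosed (dirichletSpace Ω ΓD : Set (Lp ℝ 2 (volume.restrict Ω) ×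
    Lp (EuclideanSpace ℝ (Fin d)) 2 (volume.restrict Ω))) := by
  refine isClosed_of_closure_subset fun w hw => ?_
  rw [SetLike.mem_coe, mem_dirichletSpace, isDirichletLimit_iff]
  intro ε hε
  have hε2 : 0 < ε / 2 := ENNReal.half_pos hε.ne'
  obtain ⟨w', hw', hdist⟩ := EMetric.mem_closure_iff.1 hw (ε / 2) hε2
  obtain ⟨s, hs, h1, h2, h3⟩ := isDirichletLimit_iff.1 hw' (ε / 2) hε2
  rw [Prod.edist_eq, max_lt_iff] at hdist
  exact ⟨s, hs, eLpNorm_sub_lt_of_dist_lt hs.continuous.aestronglyMeasurable h1 hdist.1,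
    eLpNorm_sub_lt_of_dist_lt (contDiff_gradient hs).aestronglyMeasurable h2 hdist.2,
    h3.trans_le ENNReal.half_le_self⟩

theorem MemH1D.toLp_mem {φ : EuclideanSpace ℝ (Fin d) → ℝ} (h : MemH1D Ω ΓD φ) :
    (h.1.1.toLp φ, (weakGrad_spec h.1).1.toLp (weakGrad Ω φ)) ∈ dirichletSpace Ω ΓD :=
  (hasTrace_zero_iff.1 h.2).congr (MemLp.coeFn_toLp h.1.1).symm
    (MemLp.coeFn_toLp (weakGrad_spec h.1).1).symm

/-- Weak gradients survive the limit, so the second component of such a pair is necessarily the weak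
gradient of the first. With `MemH1D.toLp_mem` this identifies `dirichletSpace` with H¹_D(Ω). -/
theorem IsDirichletLimit.memH1D (hΩ : IsBoundedLipschitzDomain Ω)
    {u : EuclideanSpace ℝ (Fin d) → ℝ} {G : EuclideanSpace ℝ (Fin d) → EuclideanSpace ℝ (Fin d)}
    (hu : MemLp u 2 (volume.restrict Ω)) (hG : MemLp G 2 (volume.restrict Ω))
    (h : IsDirichletLimit Ω ΓD u G) :
    MemH1D Ω ΓD u ∧ weakGrad Ω u =ᵐ[volume.restrict Ω] G := by
  obtain ⟨s, hs, h1, h2, -⟩ := id h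
  have hwg : IsWeakGradient Ω u G := IsWeakGradient.of_tendsto hu hG
    (fun n => memLp_of_continuous_of_isBounded (hs n).continuous hΩ.isBounded 2)
    (fun n => memLp_of_continuous_of_isBounded (contDiff_gradient (hs n)) hΩ.isBounded 2)
    (fun n => contDiff_isWeakGradient (hs n)) h1 h2
  have hae := weakGrad_ae_eq hΩ.isOpen hu hG hwg
  exact ⟨⟨⟨hu, G, hG, hwg⟩, hasTrace_zero_iff.2 (h.congr EventuallyEq.rfl hae.symm)⟩, hae⟩

/-- Poincaré-Friedrichs in the limit, where the boundary term disappears. Hence the gradient alone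
controls the norm of H¹_D(Ω). -/
theorem exists_norm_fst_le (hd : 1 ≤ d) (hΩ : IsBoundedLipschitzDomain Ω)
    (hΓ : IsBoundarySplitting Ω ΓD ΓN) :
    ∃ C : ℝ, 0 ≤ C ∧ ∀ w ∈ dirichletSpace Ω ΓD, ‖w.1‖ ≤ C * ‖w.2‖ := by
  obtain ⟨C, hC⟩ := exists_poincareFriedrichs hd hΩ hΓ
  set c : ℝ≥0∞ := (C : ℝ≥0∞) ^ (1 / 2 : ℝ) with hc
  have hct : c ≠ ⊤ := ENNReal.rpow_ne_top_of_nonneg (by norm_num) ENNReal.coe_ne_top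
  refine ⟨c.toReal, ENNReal.toReal_nonneg, fun w hw => ?_⟩
  obtain ⟨s, hs, h1, h2, h3⟩ := hw
  have hsm : ∀ n, eLpNorm (s n) 2 (volume.restrict Ω) ≤
      c * (eLpNorm (gradient (s n)) 2 (volume.restrict Ω) +
        eLpNorm (s n) 2 ((surfaceMeasure d).restrict ΓD)) := by
    intro n
    rw [eLpNorm_two_eq, eLpNorm_two_eq, eLpNorm_two_eq]
    calc _ ≤ ((C : ℝ≥0∞) * ((∫⁻ x in Ω, ‖gradient (s n) x‖ₑ ^ 2) +
            ∫⁻ x in ΓD, ‖s n x‖ₑ ^ 2 ∂(surfaceMeasure d))) ^ (1 / 2 : ℝ) := by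
          gcongr; exact hC (s n) (hs n)
      _ ≤ _ := by
          rw [ENNReal.mul_rpow_of_nonneg _ _ (by norm_num)]
          gcongr
          exact ENNReal.rpow_add_le_add_rpow _ _ (by norm_num) (by norm_num)
  have bound : ∀ n, eLpNorm w.1 2 (volume.restrict Ω) ≤
      eLpNorm (fun x => s n x - w.1 x) 2 (volume.restrict Ω) +
      c * ((eLpNorm (fun x => gradient (s n) x - w.2 x) 2 (volume.restrict Ω) +
        eLpNorm w.2 2 (volume.restrict Ω)) +
        eLpNorm (s n) 2 ((surfaceMeasure d).restrict ΓD)) := by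
    intro n
    have a1 := eLpNorm_sub_le (p := 2) (μ := volume.restrict Ω)
      (hs n).continuous.aestronglyMeasurable
      ((hs n).continuous.aestronglyMeasurable.sub (Lp.aestronglyMeasurable w.1)) (by norm_num)
    rw [sub_sub_cancel, add_comm] at a1
    have a2 := eLpNorm_add_le (p := 2) (μ := volume.restrict Ω)
      ((contDiff_gradient (hs n)).aestronglyMeasurable.sub (Lp.aestronglyMeasurable w.2))
      (Lp.aestronglyMeasurable w.2) (by norm_num)
    rw [sub_add_cancel] at a2
    refine a1.trans (add_le_add le_rfl ((hsm n).trans ?_))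
    gcongr
    exact a2
  have lim : Tendsto (fun n => eLpNorm (fun x => s n x - w.1 x) 2 (volume.restrict Ω) +
      c * ((eLpNorm (fun x => gradient (s n) x - w.2 x) 2 (volume.restrict Ω) +
        eLpNorm w.2 2 (volume.restrict Ω)) +
        eLpNorm (s n) 2 ((surfaceMeasure d).restrict ΓD))) atTop
      (𝓝 (0 + c * ((0 + eLpNorm w.2 2 (volume.restrict Ω)) + 0))) :=
    h1.add (ENNReal.Tendsto.const_mul ((h2.add_const _).add h3) (Or.inr hct))
  have := ge_of_tendsto' lim bound
  rw [zero_add, zero_add, add_zero] at this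
  rw [Lp.norm_def, Lp.norm_def, ← ENNReal.toReal_mul]
  exact ENNReal.toReal_mono (ENNReal.mul_ne_top hct (Lp.memLp w.2).2.ne) this

/-- For p < 2 the integrability of f u does not follow from u ∈ L²; the gradient component supplies
it. -/
theorem exists_dirichlet_pairing_le (hΩ : IsBoundedLipschitzDomain Ω) (p : ℝ≥0∞)
    (hp1 : 1 ≤ p) (hpd : (d : ℝ≥0∞) / 2 < p) :
    ∃ C : ℝ, 0 ≤ C ∧ ∀ f : EuclideanSpace ℝ (Fin d) → ℝ, MemLp f p (volume.restrict Ω) →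
      ∀ w ∈ dirichletSpace Ω ΓD, Integrable (fun x => f x * w.1 x) (volume.restrict Ω) ∧
        |∫ x in Ω, f x * w.1 x| ≤
          C * (eLpNorm f p (volume.restrict Ω)).toReal * (‖w.1‖ + ‖w.2‖) := by
  obtain ⟨C, hC⟩ := hΩ.exists_pairing_le p hp1 hpd
  refine ⟨C, C.2, fun f hf w hw => ?_⟩
  obtain ⟨s, hs, h1, h2, -⟩ := hw
  have key := hC f hf w.1 w.2 s (Lp.memLp w.1) (Lp.memLp w.2) hs h1 h2
  have hfin : (C : ℝ≥0∞) * eLpNorm f p (volume.restrict Ω) *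
      (eLpNorm w.1 2 (volume.restrict Ω) + eLpNorm w.2 2 (volume.restrict Ω)) ≠ ⊤ :=
    ENNReal.mul_ne_top (ENNReal.mul_ne_top ENNReal.coe_ne_top hf.2.ne)
      (ENNReal.add_ne_top.2 ⟨(Lp.memLp w.1).2.ne, (Lp.memLp w.2).2.ne⟩)
  have hint : ∫⁻ x in Ω, ‖f x * w.1 x‖ₑ ≤ (C : ℝ≥0∞) * eLpNorm f p (volume.restrict Ω) *
      (eLpNorm w.1 2 (volume.restrict Ω) + eLpNorm w.2 2 (volume.restrict Ω)) := by
    simpa only [enorm_mul] using key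
  refine ⟨⟨hf.1.mul (Lp.aestronglyMeasurable w.1), hint.trans_lt hfin.lt_top⟩, ?_⟩
  have := ENNReal.toReal_mono hfin ((enorm_integral_le_lintegral_enorm _).trans hint)
  rw [toReal_enorm, Real.norm_eq_abs] at this
  refine this.trans (le_of_eq ?_)
  rw [ENNReal.toReal_mul, ENNReal.toReal_mul, ENNReal.toReal_add (Lp.memLp w.1).2.ne
    (Lp.memLp w.2).2.ne, Lp.norm_def, Lp.norm_def]
  rfl

end DirichletSpace

/-! ### The direct method for midpoint convex functionals. -/

section Minimization

variable {X Y : Type*} [NormedAddCommGroup X] [NormedSpace ℝ X] [CompleteSpace X]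
  [NormedAddCommGroup Y] [InnerProductSpace ℝ Y]

/-- The direct method: a sum of a uniformly convex quadratic term in `x` and a midpoint convex
continuous term which is coercive in the real variable has a minimizer. -/
theorem exists_forall_le_of_midpointConvex (T : X →L[ℝ] Y) (g₀ : Y) {C : ℝ} (hC : 0 ≤ C)
    (hT : ∀ x, ‖x‖ ≤ C * ‖T x‖) {N : ℝ × X → ℝ} (hNc : Continuous N)
    (hmid : ∀ p q, N ((1 / 2 : ℝ) • (p + q)) ≤ (N p + N q) / 2) {a δ A B : ℝ} (ha : 0 < a)
    (hδ : 0 < δ) (hB : 0 ≤ B) (hN : ∀ v x, δ * |v| - A - B * ‖x‖ ≤ N (v, x)) :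
    ∃ p : ℝ × X, ∀ q : ℝ × X, a * ‖T p.2 + g₀‖ ^ 2 + N p ≤ a * ‖T q.2 + g₀‖ ^ 2 + N q := by
  set J : ℝ × X → ℝ := fun p => a * ‖T p.2 + g₀‖ ^ 2 + N p with hJ
  set b := B * C
  have hb : 0 ≤ b := mul_nonneg hB hC
  -- The linear loss in ‖x‖ is bounded through T x and absorbed into the quadratic term by
  -- completing the square, which costs b²/(4a).
  have hlow : ∀ p, δ * |p.1| - (A + b * ‖g₀‖ + b ^ 2 / (4 * a)) ≤ J p := by
    intro p
    have h1 := hN p.1 p.2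
    have h2 : ‖p.2‖ ≤ C * (‖T p.2 + g₀‖ + ‖g₀‖) := by
      refine (hT p.2).trans (mul_le_mul_of_nonneg_left ?_ hC)
      calc ‖T p.2‖ = ‖(T p.2 + g₀) - g₀‖ := by rw [add_sub_cancel_right]
        _ ≤ _ := norm_sub_le _ _
    have h3 : B * ‖p.2‖ ≤ b * (‖T p.2 + g₀‖ + ‖g₀‖) := by
      calc B * ‖p.2‖ ≤ B * (C * (‖T p.2 + g₀‖ + ‖g₀‖)) := mul_le_mul_of_nonneg_left h2 hB
        _ = _ := by ring
    have h4 : b * ‖T p.2 + g₀‖ ≤ a * ‖T p.2 + g₀‖ ^ 2 + b ^ 2 / (4 * a) := by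
      have : a * ‖T p.2 + g₀‖ ^ 2 + b ^ 2 / (4 * a) - b * ‖T p.2 + g₀‖ =
          a * (‖T p.2 + g₀‖ - b / (2 * a)) ^ 2 := by field_simp; ring
      have h5 : 0 ≤ a * (‖T p.2 + g₀‖ - b / (2 * a)) ^ 2 := by positivity
      linarith
    simp only [hJ]
    linarith
  have hbdd : BddBelow (range J) := by
    refine ⟨-(A + b * ‖g₀‖ + b ^ 2 / (4 * a)), ?_⟩
    rintro _ ⟨p, rfl⟩
    have : 0 ≤ δ * |p.1| := by positivity
    linarith [hlow p]
  set m := sInf (range J)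
  have hm : ∀ p, m ≤ J p := fun p => csInf_le hbdd (mem_range_self p)
  have hseq : ∀ n : ℕ, ∃ p, J p < m + 1 / ((n : ℝ) + 1) := by
    intro n
    obtain ⟨_, ⟨p, rfl⟩, hp⟩ := exists_lt_of_csInf_lt (range_nonempty J)
      (show sInf (range J) < m + 1 / ((n : ℝ) + 1) by
        have : 0 < 1 / ((n : ℝ) + 1) := by positivity
        linarith)
    exact ⟨p, hp⟩
  choose u hu using hseq
  -- The parallelogram law at the midpoint. It makes the x-components of a minimizing sequence
  -- Cauchy, so no weak compactness is needed.
  have hJmid : ∀ p q, a / 4 * ‖T (p.2 - q.2)‖ ^ 2 ≤ (J p + J q) / 2 - m := by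
    intro p q
    have h1 := hm ((1 / 2 : ℝ) • (p + q))
    have h2 := hmid p q
    set α := T p.2 + g₀
    set β := T q.2 + g₀
    have e1 : T ((1 / 2 : ℝ) • (p + q)).2 + g₀ = (1 / 2 : ℝ) • (α + β) := by
      simp only [Prod.smul_snd, Prod.snd_add, map_smul, map_add, α, β]; module
    have e2 : T (p.2 - q.2) = α - β := by simp only [map_sub, α, β]; abel
    have e3 := parallelogram_law_with_norm ℝ α β
    have e4 : J ((1 / 2 : ℝ) • (p + q)) =
        a * (‖α + β‖ ^ 2 / 4) + N ((1 / 2 : ℝ) • (p + q)) := by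
      simp only [hJ]
      have e5 : ‖(1 / 2 : ℝ)‖ ^ 2 = 1 / 4 := by norm_num
      rw [e1, norm_smul, mul_pow, e5]
      ring
    have e5 : J p = a * ‖α‖ ^ 2 + N p := rfl
    have e6 : J q = a * ‖β‖ ^ 2 + N q := rfl
    rw [e2, e5, e6]
    rw [e4] at h1
    have e7 : a * (‖α + β‖ ^ 2) + a * (‖α - β‖ ^ 2) = 2 * (a * ‖α‖ ^ 2 + a * ‖β‖ ^ 2) := by
      linear_combination a * e3
    linarith
  have hdist : ∀ n k : ℕ, ‖(u n).2 - (u k).2‖ ^ 2 ≤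
      C ^ 2 * (4 / a) * (1 / ((n : ℝ) + 1) + 1 / ((k : ℝ) + 1)) := by
    intro n k
    have h1 := hJmid (u n) (u k)
    have h2 := hu n
    have h3 := hu k
    have p1 : 0 < 1 / ((n : ℝ) + 1) := by positivity
    have p2 : 0 < 1 / ((k : ℝ) + 1) := by positivity
    have h4 : a / 4 * ‖T ((u n).2 - (u k).2)‖ ^ 2 ≤ 1 / ((n : ℝ) + 1) + 1 / ((k : ℝ) + 1) := by
      linarith
    calc ‖(u n).2 - (u k).2‖ ^ 2 ≤ (C * ‖T ((u n).2 - (u k).2)‖) ^ 2 := by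
          gcongr; exact hT _
      _ = C ^ 2 * (4 / a) * (a / 4 * ‖T ((u n).2 - (u k).2)‖ ^ 2) := by field_simp
      _ ≤ _ := by gcongr
  have hcauchy : CauchySeq fun n => (u n).2 := by
    rw [Metric.cauchySeq_iff]
    intro ε hε
    have hlim : Tendsto (fun n : ℕ => C ^ 2 * (4 / a) * (2 * (1 / ((n : ℝ) + 1)))) atTop
        (𝓝 (C ^ 2 * (4 / a) * (2 * 0))) :=
      (tendsto_one_div_add_atTop_nhds_zero_nat.const_mul 2).const_mul _
    rw [mul_zero, mul_zero] at hlim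
    obtain ⟨n₀, hn₀⟩ := (hlim.eventually_lt_const (by positivity : (0 : ℝ) < ε ^ 2)).exists
    refine ⟨n₀, fun n hn k hk => ?_⟩
    rw [dist_eq_norm]
    refine lt_of_pow_lt_pow_left₀ 2 hε.le (lt_of_le_of_lt ((hdist n k).trans ?_) hn₀)
    have q1 : 1 / ((n : ℝ) + 1) ≤ 1 / ((n₀ : ℝ) + 1) := by gcongr
    have q2 : 1 / ((k : ℝ) + 1) ≤ 1 / ((n₀ : ℝ) + 1) := by gcongr
    gcongr
    linarith
  obtain ⟨x, hx⟩ := cauchySeq_tendsto_of_complete hcauchy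
  set R := (m + 1 + (A + b * ‖g₀‖ + b ^ 2 / (4 * a))) / δ with hR
  have hbounded : ∀ n, (u n).1 ∈ Metric.closedBall (0 : ℝ) R := by
    intro n
    have h1 := hlow (u n)
    have h2 := hu n
    have h3 : 1 / ((n : ℝ) + 1) ≤ 1 := by
      rw [div_le_one (by positivity)]
      have : (0 : ℝ) ≤ n := n.cast_nonneg
      linarith
    rw [mem_closedBall_zero_iff, Real.norm_eq_abs, hR, le_div_iff₀ hδ]
    linarith
  -- The functional need not be uniformly convex in v, but the v-components are bounded reals, so a
  -- subsequence converges.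
  obtain ⟨v, -, ns, hns, hv⟩ := (isCompact_closedBall (0 : ℝ) R).tendsto_subseq hbounded
  have hlimu : Tendsto (fun n => u (ns n)) atTop (𝓝 (v, x)) :=
    hv.prodMk_nhds (hx.comp hns.tendsto_atTop)
  have hJc : Continuous J := by
    simp only [hJ]
    fun_prop
  have hJlim := (hJc.tendsto (v, x)).comp hlimu
  have hJm : Tendsto (fun n => m + 1 / ((ns n : ℝ) + 1)) atTop (𝓝 (m + 0)) :=
    tendsto_const_nhds.add (tendsto_one_div_add_atTop_nhds_zero_nat.comp hns.tendsto_atTop)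
  rw [add_zero] at hJm
  have : J (v, x) ≤ m := le_of_tendsto_of_tendsto' hJlim hJm fun n => (hu (ns n)).le
  exact ⟨(v, x), fun q => this.trans (hm q)⟩

/-- The first-order condition at a minimum when only a quadratic upper bound for the increment is
known: a small t of sign opposite to L would make the expression negative. -/
theorem eq_zero_of_forall_mul_add_sq_nonneg {L K : ℝ} (h : ∀ t : ℝ, 0 ≤ t * L + t ^ 2 * K) :
    L = 0 := by
  have hK : 0 < |K| + 1 := by positivity
  have h1 := h (-L / (2 * (|K| + 1)))
  have h2 : -L / (2 * (|K| + 1)) * L + (-L / (2 * (|K| + 1))) ^ 2 * K =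
      -(L ^ 2 * (2 * (|K| + 1) - K)) / (4 * (|K| + 1) ^ 2) := by field_simp; ring
  rw [h2, neg_div, le_neg, neg_zero] at h1
  have h3 : 0 < 2 * (|K| + 1) - K := by linarith [le_abs_self K]
  by_contra hL
  have : 0 < L ^ 2 * (2 * (|K| + 1) - K) / (4 * (|K| + 1) ^ 2) := by positivity
  linarith

end Minimization

/-! ### The abstract constrained problem: existence, uniqueness, a priori bounds. -/

section ConvexPotential

variable {H Y : Type*} [NormedAddCommGroup H] [InnerProductSpace ℝ H]
  [NormedAddCommGroup Y] [InnerProductSpace ℝ Y]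

/-- `Ψ` is a convex potential with bounded Lipschitz gradient `N`, normalized at zero, and
`v ↦ Ψ (v • e - k) - M v` is coercive, uniformly in `k`. -/
structure IsCoercivePotential (e : H) (M : ℝ) (Ψ : H → ℝ) (N : H → H) (S δ A : ℝ) : Prop where
  apply_zero : Ψ 0 = 0
  tangent : ∀ h k, Ψ h + inner ℝ (N h) (k - h) ≤ Ψ k
  lipschitz : ∀ h k, ‖N h - N k‖ ≤ S * ‖h - k‖
  norm_le : ∀ h, ‖N h‖ ≤ S * ‖e‖
  eq_of_inner : ∀ h k, inner ℝ (N h - N k) (h - k) = (0 : ℝ) → h = k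
  nonneg : 0 ≤ A
  pos : 0 < δ
  coercive : ∀ v k, δ * |v| - A * (1 + ‖k‖) ≤ Ψ (v • e - k) - M * v

namespace IsCoercivePotential

variable {e : H} {M : ℝ} {Ψ : H → ℝ} {N : H → H} {S δ A : ℝ}

theorem midpoint (hΨ : IsCoercivePotential e M Ψ N S δ A) (h k : H) :
    Ψ ((1 / 2 : ℝ) • (h + k)) ≤ (Ψ h + Ψ k) / 2 := by
  set j := (1 / 2 : ℝ) • (h + k) with hj
  have h1 := hΨ.tangent j h
  have h2 := hΨ.tangent j k
  have h3 : inner ℝ (N j) (h - j) + inner ℝ (N j) (k - j) = (0 : ℝ) := by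
    rw [← inner_add_right]
    have : h - j + (k - j) = 0 := by rw [hj]; module
    rw [this, inner_zero_right]
  linarith

theorem sub_le (hΨ : IsCoercivePotential e M Ψ N S δ A) (h k : H) :
    Ψ h - Ψ k ≤ S * ‖e‖ * ‖h - k‖ := by
  have h1 := hΨ.tangent h k
  have h2 := (abs_le.1 (abs_real_inner_le_norm (N h) (k - h))).1
  have h3 := mul_le_mul_of_nonneg_right (hΨ.norm_le h) (norm_nonneg (k - h))
  rw [norm_sub_rev h k]
  linarith

theorem continuous (hΨ : IsCoercivePotential e M Ψ N S δ A) : Continuous Ψ := by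
  refine LipschitzWith.continuous (K := (S * ‖e‖).toNNReal) (LipschitzWith.of_le_add_mul _ ?_)
  intro h k
  have := hΨ.sub_le h k
  have h2 := mul_le_mul_of_nonneg_right (Real.le_coe_toNNReal (S * ‖e‖)) (norm_nonneg (h - k))
  rw [dist_eq_norm]
  linarith

/-- The tangent inequality at h + k, with the Lipschitz bound comparing the gradients at h + k and
h. This one-sided expansion suffices for the first variation. -/
theorem add_le (hΨ : IsCoercivePotential e M Ψ N S δ A) (h k : H) :
    Ψ (h + k) ≤ Ψ h + inner ℝ (N h) k + S * ‖k‖ ^ 2 := by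
  have h1 := hΨ.tangent (h + k) h
  rw [sub_add_cancel_left, inner_neg_right] at h1
  have h2 := real_inner_le_norm (N (h + k) - N h) k
  have h3 := mul_le_mul_of_nonneg_right (hΨ.lipschitz (h + k) h) (norm_nonneg k)
  rw [add_sub_cancel_left] at h3
  rw [inner_sub_left] at h2
  linarith

theorem monotone (hΨ : IsCoercivePotential e M Ψ N S δ A) (h k : H) :
    0 ≤ inner ℝ (N h - N k) (h - k) := by
  have h1 := hΨ.tangent h k
  have h2 := hΨ.tangent k h
  rw [← neg_sub h k, inner_neg_right] at h1
  rw [inner_sub_left]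
  linarith

/-- Bound on the Lagrange multiplier of the mass constraint. -/
theorem abs_le (hΨ : IsCoercivePotential e M Ψ N S δ A) {v : ℝ} {k : H}
    (hm : inner ℝ (N (v • e - k)) e = M) : δ * |v| ≤ (A + S * ‖e‖) * (1 + ‖k‖) := by
  -- With h = v e - k and Ψ(0) = 0 this says Ψ(h) ≤ ⟨N h, h⟩ = Mv - ⟨N h, k⟩. The term Mv then
  -- cancels the one in the coercivity bound.
  have h1 := hΨ.tangent (v • e - k) 0
  rw [hΨ.apply_zero, zero_sub, inner_neg_right, inner_sub_right, inner_smul_right, hm] at h1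
  have h2 := hΨ.coercive v k
  have h3 := (_root_.abs_le.1 (abs_real_inner_le_norm (N (v • e - k)) k)).1
  have h4 := mul_le_mul_of_nonneg_right (hΨ.norm_le (v • e - k)) (norm_nonneg k)
  have h5 : 0 ≤ S * ‖e‖ := (norm_nonneg _).trans (hΨ.norm_le 0)
  nlinarith

/-- Existence for the constrained variational problem. -/
theorem exists_solution [CompleteSpace H] [CompleteSpace Y]
    (hΨ : IsCoercivePotential e M Ψ N S δ A) {V : Submodule ℝ (H × Y)}
    (hV : IsClosed (V : Set (H × Y))) {C : ℝ} (hVC : ∀ w ∈ V, ‖w.1‖ ≤ C * ‖w.2‖)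
    {lam σ z : ℝ} (hlam : 0 < lam) (hσ : 0 < σ) (h₀ : H) (g₀ : Y) (ℓ : V →L[ℝ] ℝ) :
    ∃ (v : ℝ) (w : V), inner ℝ (N (v • e - z • (h₀ + w.1.1))) e = M ∧
      ∀ φ : V, lam ^ 2 * inner ℝ (w.1.2 + g₀) φ.1.2 =
        ℓ φ + σ * (z * inner ℝ (N (v • e - z • (h₀ + w.1.1))) φ.1.1) := by
  have : CompleteSpace V := hV.completeSpace_coe
  set T : V →L[ℝ] Y := (ContinuousLinearMap.snd ℝ H Y).comp V.subtypeL with hT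
  have hTC : ∀ w : V, ‖w‖ ≤ max C 1 * ‖T w‖ := by
    intro w
    change ‖w.1‖ ≤ max C 1 * ‖w.1.2‖
    rw [Prod.norm_def]
    refine max_le ((hVC w.1 w.2).trans ?_) ?_
    · gcongr; exact le_max_left _ _
    · calc ‖w.1.2‖ = 1 * ‖w.1.2‖ := (one_mul _).symm
        _ ≤ _ := by gcongr; exact le_max_right _ _
  set P : ℝ × V → H := fun p => p.1 • e - z • (h₀ + p.2.1.1) with hP
  have hPc : Continuous P := by simp only [hP]; fun_prop
  -- The part of the functional other than the Dirichlet energy. Because v is a free variable,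
  -- stationarity in v yields the mass constraint.
  set Nf : ℝ × V → ℝ := fun p => -ℓ p.2 + σ * (Ψ (P p) - M * p.1) with hNf
  have hΨc := hΨ.continuous
  have hNc : Continuous Nf := by simp only [hNf]; fun_prop
  have hmid : ∀ p q, Nf ((1 / 2 : ℝ) • (p + q)) ≤ (Nf p + Nf q) / 2 := by
    intro p q
    have e1 : P ((1 / 2 : ℝ) • (p + q)) = (1 / 2 : ℝ) • (P p + P q) := by
      simp only [hP, Prod.smul_fst, Prod.fst_add, Prod.smul_snd, Prod.snd_add, Submodule.coe_smul,
        Submodule.coe_add, smul_eq_mul]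
      module
    have e2 : ℓ ((1 / 2 : ℝ) • (p + q)).2 = (ℓ p.2 + ℓ q.2) / 2 := by
      simp only [Prod.smul_snd, Prod.snd_add, map_smul, map_add, smul_eq_mul]; ring
    have e3 : ((1 / 2 : ℝ) • (p + q)).1 = (p.1 + q.1) / 2 := by
      simp only [Prod.smul_fst, Prod.fst_add, smul_eq_mul]; ring
    simp only [hNf]
    rw [e1, e2, e3]
    have := mul_le_mul_of_nonneg_left (hΨ.midpoint (P p) (P q)) hσ.le
    linarith
  have hcoer : ∀ v x, σ * δ * |v| - σ * A * (1 + |z| * ‖h₀‖) - (‖ℓ‖ + σ * A * |z|) * ‖x‖ ≤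
      Nf (v, x) := by
    intro v x
    have h1 := hΨ.coercive v (z • (h₀ + x.1.1))
    have h2 : ‖z • (h₀ + x.1.1)‖ ≤ |z| * (‖h₀‖ + ‖x‖) := by
      rw [norm_smul, Real.norm_eq_abs]
      gcongr
      refine (norm_add_le _ _).trans ?_
      gcongr
      exact norm_fst_le x.1
    have h3 := (_root_.abs_le.1 (ℓ.le_opNorm x)).2
    have h4 := mul_le_mul_of_nonneg_left h1 hσ.le
    have h5 := mul_le_mul_of_nonneg_left h2 (mul_nonneg hσ.le hΨ.nonneg)
    simp only [hNf, hP]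
    linarith
  obtain ⟨⟨v, w⟩, hmin⟩ := exists_forall_le_of_midpointConvex T g₀ (by positivity) hTC hNc hmid
    (a := lam ^ 2 / 2) (by positivity) (mul_pos hσ hΨ.pos)
    (by have := hΨ.nonneg; positivity) hcoer
  set h := v • e - z • (h₀ + w.1.1) with hh
  -- One variation in the direction (τ, φ): taking (1, 0) gives the mass constraint after division
  -- by σ, and (0, φ) gives the equation.
  have EL : ∀ (τ : ℝ) (φ : V), lam ^ 2 * inner ℝ (w.1.2 + g₀) φ.1.2 - ℓ φ +
      σ * (inner ℝ (N h) (τ • e - z • φ.1.1) - M * τ) = 0 := by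
    intro τ φ
    set k := τ • e - z • φ.1.1 with hk
    refine eq_zero_of_forall_mul_add_sq_nonneg
      (K := lam ^ 2 / 2 * ‖φ.1.2‖ ^ 2 + σ * (S * ‖k‖ ^ 2)) fun t => ?_
    have h1 := hmin (v + t * τ, w + t • φ)
    simp only [hNf, hP, hT] at h1
    have e1 : (v + t * τ) • e - z • (h₀ + (w + t • φ).1.1) = h + t • k := by
      simp only [hh, hk, Submodule.coe_add, Submodule.coe_smul, Prod.fst_add, Prod.smul_fst]
      module
    have e2 : (ContinuousLinearMap.snd ℝ H Y).comp V.subtypeL (w + t • φ) + g₀ =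
        (w.1.2 + g₀) + t • φ.1.2 := by
      simp; abel
    have e3 : (ContinuousLinearMap.snd ℝ H Y).comp V.subtypeL w + g₀ = w.1.2 + g₀ := by simp
    rw [e1, e2, e3, ← hh, norm_add_sq_real (w.1.2 + g₀) (t • φ.1.2), inner_smul_right, norm_smul, map_add, map_smul,
      smul_eq_mul, mul_pow, Real.norm_eq_abs, sq_abs] at h1
    have h2 := hΨ.add_le h (t • k)
    rw [inner_smul_right, norm_smul, mul_pow, Real.norm_eq_abs, sq_abs] at h2
    have h3 := mul_le_mul_of_nonneg_left h2 hσ.le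
    nlinarith
  have hmass : inner ℝ (N h) e = M := by
    have := EL 1 0
    simp only [Submodule.coe_zero, Prod.fst_zero, Prod.snd_zero, inner_zero_right, mul_zero,
      map_zero, smul_zero, sub_zero, one_smul, mul_one, zero_add] at this
    rcases mul_eq_zero.1 this with h' | h'
    · exact absurd h' hσ.ne'
    · linarith
  refine ⟨v, w, hmass, fun φ => ?_⟩
  have := EL 0 φ
  rw [zero_smul, zero_sub, inner_neg_right, inner_smul_right] at this
  linarith

/-- Existence for boundary data and load scaled by `σ ≥ 0`. -/
theorem exists_scaled_solution [CompleteSpace H] [CompleteSpace Y]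
    (hΨ : IsCoercivePotential e M Ψ N S δ A) {V : Submodule ℝ (H × Y)}
    (hV : IsClosed (V : Set (H × Y))) {C : ℝ} (hVC : ∀ w ∈ V, ‖w.1‖ ≤ C * ‖w.2‖)
    {lam σ z : ℝ} (hlam : 0 < lam) (hσ : 0 ≤ σ) (h₀ : H) (g₀ : Y) (ℓ : V →L[ℝ] ℝ) :
    ∃ (v : ℝ) (w : V), inner ℝ (N (v • e - z • (σ • h₀ + w.1.1))) e = M ∧
      ∀ φ : V, lam ^ 2 * inner ℝ (w.1.2 + σ • g₀) φ.1.2 =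
        σ * ℓ φ + σ * (z * inner ℝ (N (v • e - z • (σ • h₀ + w.1.1))) φ.1.1) := by
  rcases hσ.eq_or_lt with rfl | hσ
  -- For σ = 0 the shift vanishes and only the scalar mass equation for v remains. It is the mass
  -- constraint of the auxiliary problem with z = 0 and weight one, whose other component is
  -- discarded.
  · obtain ⟨v, w, hm, -⟩ := hΨ.exists_solution hV hVC (z := 0) hlam one_pos h₀ g₀ ℓ
    refine ⟨v, 0, ?_, fun φ => ?_⟩
    · simpa using hm
    · simp
  · exact hΨ.exists_solution hV hVC hlam hσ (σ • h₀) (σ • g₀) (σ • ℓ)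

/-- Uniqueness for the constrained variational problem. -/
theorem unique (hΨ : IsCoercivePotential e M Ψ N S δ A) (he : e ≠ 0) {V : Submodule ℝ (H × Y)}
    {C : ℝ} (hVC : ∀ w ∈ V, ‖w.1‖ ≤ C * ‖w.2‖)
    {lam σ z : ℝ} (hlam : 0 < lam) (hσ : 0 ≤ σ) {h₀ : H} {g₀ : Y} {ℓ : V → ℝ} {v v' : ℝ} {w w' : V}
    (hm : inner ℝ (N (v • e - z • (h₀ + w.1.1))) e = M)
    (hm' : inner ℝ (N (v' • e - z • (h₀ + w'.1.1))) e = M)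
    (hw : ∀ φ : V, lam ^ 2 * inner ℝ (w.1.2 + g₀) φ.1.2 =
        ℓ φ + σ * (z * inner ℝ (N (v • e - z • (h₀ + w.1.1))) φ.1.1))
    (hw' : ∀ φ : V, lam ^ 2 * inner ℝ (w'.1.2 + g₀) φ.1.2 =
        ℓ φ + σ * (z * inner ℝ (N (v' • e - z • (h₀ + w'.1.1))) φ.1.1)) :
    v = v' ∧ w = w' := by
  set h := v • e - z • (h₀ + w.1.1) with hh
  set h' := v' • e - z • (h₀ + w'.1.1) with hh'
  have e0 : h - h' = (v - v') • e - z • (w.1.1 - w'.1.1) := by rw [hh, hh']; module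
  -- Both masses equal M, so the contribution of v - v' drops out.
  have e1 : inner ℝ (N h - N h') (h - h') = -(z * inner ℝ (N h - N h') (w.1.1 - w'.1.1)) := by
    rw [e0, inner_sub_right, inner_smul_right, inner_smul_right, inner_sub_left _ _ e, hm, hm']
    ring
  have e2 : lam ^ 2 * ‖w.1.2 - w'.1.2‖ ^ 2 = -(σ * inner ℝ (N h - N h') (h - h')) := by
    have a1 := hw (w - w')
    have a2 := hw' (w - w')
    have a3 : (w - w').1.2 = w.1.2 - w'.1.2 := rfl
    have a4 : (w - w').1.1 = w.1.1 - w'.1.1 := rfl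
    have a5 : w.1.2 - w'.1.2 = (w.1.2 + g₀) - (w'.1.2 + g₀) := by abel
    rw [a3, a4] at a1 a2
    rw [e1, ← real_inner_self_eq_norm_sq]
    nth_rewrite 1 [a5]
    rw [inner_sub_left, inner_sub_left]
    linear_combination a1 - a2
  have e3 : 0 ≤ σ * inner ℝ (N h - N h') (h - h') := mul_nonneg hσ (hΨ.monotone h h')
  have e4 : ‖w.1.2 - w'.1.2‖ = 0 := by
    have : 0 ≤ lam ^ 2 * ‖w.1.2 - w'.1.2‖ ^ 2 := by positivity
    have h0 : lam ^ 2 * ‖w.1.2 - w'.1.2‖ ^ 2 = 0 := by linarith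
    rcases mul_eq_zero.1 h0 with h | h
    · exact absurd h (by positivity)
    · exact pow_eq_zero_iff (two_ne_zero) |>.1 h
  have e5 : w.1.1 - w'.1.1 = 0 := by
    have := hVC (w - w').1 (w - w').2
    change ‖w.1.1 - w'.1.1‖ ≤ C * ‖w.1.2 - w'.1.2‖ at this
    rw [e4, mul_zero] at this
    exact norm_le_zero_iff.1 this
  -- Once w and w' agree, the monotonicity pairing vanishes by `e1`, without dividing by σ; this
  -- covers σ = 0 too.
  have e6 : h = h' := by
    refine hΨ.eq_of_inner h h' ?_
    rw [e1, e5, inner_zero_right, mul_zero, neg_zero]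
  refine ⟨?_, Subtype.ext (Prod.ext (sub_eq_zero.1 e5) (sub_eq_zero.1 (norm_eq_zero.1 e4)))⟩
  have e7 : (v - v') • e = 0 := by
    rw [e5, smul_zero, sub_zero, e6, sub_self] at e0
    exact e0.symm
  rcases smul_eq_zero.1 e7 with h | h
  · exact sub_eq_zero.1 h
  · exact absurd h he

/-- A priori bound for the constrained variational problem. -/
theorem norm_snd_le (hΨ : IsCoercivePotential e M Ψ N S δ A) {V : Submodule ℝ (H × Y)}
    {C : ℝ} (hVC : ∀ w ∈ V, ‖w.1‖ ≤ C * ‖w.2‖)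
    {lam σ z b : ℝ} (hC : 0 ≤ C) (hb : 0 ≤ b) (hlam : 0 < lam) (hσ : 0 ≤ σ) {h : H} {g₀ : Y} {ℓ : V → ℝ} {w : V}
    (hℓ : |ℓ w| ≤ b * ‖w.1.2‖)
    (hw : lam ^ 2 * inner ℝ (w.1.2 + σ • g₀) w.1.2 =
        σ * ℓ w + σ * (z * inner ℝ (N h) w.1.1)) :
    ‖w.1.2‖ ≤ σ * (‖g₀‖ + (lam ^ 2)⁻¹ * (b + |z| * (S * ‖e‖) * C)) := by
  have h0 : 0 ≤ S * ‖e‖ := (norm_nonneg _).trans (hΨ.norm_le 0)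
  set r := ‖w.1.2‖ with hr
  have hr0 : 0 ≤ r := norm_nonneg _
  have h1 : |inner ℝ (N h) w.1.1| ≤ S * ‖e‖ * (C * r) := by
    refine (abs_real_inner_le_norm _ _).trans ?_
    exact mul_le_mul (hΨ.norm_le h) (hVC w.1 w.2) (norm_nonneg _) h0
  have h2 : |z * inner ℝ (N h) w.1.1| ≤ |z| * (S * ‖e‖ * (C * r)) := by
    rw [abs_mul]; gcongr
  have h3 : |inner ℝ g₀ w.1.2| ≤ ‖g₀‖ * r := abs_real_inner_le_norm _ _
  rw [inner_add_left, real_inner_self_eq_norm_sq, inner_smul_left] at hw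
  simp only [conj_trivial] at hw
  have hl2 : 0 < lam ^ 2 := by positivity
  have k1 := mul_le_mul_of_nonneg_left (_root_.abs_le.1 hℓ).2 hσ
  have k2 := mul_le_mul_of_nonneg_left (_root_.abs_le.1 h2).2 hσ
  have k3 := mul_le_mul_of_nonneg_left (_root_.abs_le.1 h3).1 (mul_nonneg hl2.le hσ)
  -- The equation tested with its own solution: the left side is quadratic in r and the right side
  -- linear, so one factor r can be cancelled.
  have h4 : lam ^ 2 * r ^ 2 ≤ σ * (lam ^ 2 * ‖g₀‖ + (b + |z| * (S * ‖e‖) * C)) * r := by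
    nlinarith
  rcases hr0.eq_or_lt with h5 | h5
  · rw [← h5]
    have := norm_nonneg g₀
    positivity
  · have h6 : lam ^ 2 * r ≤ σ * (lam ^ 2 * ‖g₀‖ + (b + |z| * (S * ‖e‖) * C)) := by
      refine le_of_mul_le_mul_right ?_ h5
      linarith
    have h7 : r = (lam ^ 2)⁻¹ * (lam ^ 2 * r) := by field_simp
    rw [h7]
    calc _ ≤ (lam ^ 2)⁻¹ * (σ * (lam ^ 2 * ‖g₀‖ + (b + |z| * (S * ‖e‖) * C))) := by gcongr
      _ = _ := by field_simp

end IsCoercivePotential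

end ConvexPotential

/-! ### The convex potential of the ion statistics. -/

section IonPotential

theorem inner_real_eq_mul (a b : ℝ) : inner ℝ a b = a * b := by simp [mul_comm]

/-- The primitive of the statistics function. -/
noncomputable def ionPotential (F : ℝ → ℝ) (s : ℝ) : ℝ := ∫ t in (0 : ℝ)..s, F t

namespace IsIonStatistics

variable {F : ℝ → ℝ} {S : ℝ}

theorem mem_Ioo (hF : IsIonStatistics F S) (x : ℝ) : F x ∈ Ioo 0 S := hF.bijOn.mapsTo (mem_univ x)

theorem strictMono (hF : IsIonStatistics F S) : StrictMono F := strictMono_of_deriv_pos hF.deriv_pos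

/-- From 0 < F' ≤ F < S. -/
theorem abs_sub_le (hF : IsIonStatistics F S) (a b : ℝ) : |F a - F b| ≤ S * |a - b| := by
  have := Convex.norm_image_sub_le_of_norm_deriv_le (f := F) (s := univ) (C := S)
    (fun x _ => (hF.contDiff.differentiable (by simp)) x)
    (fun x _ => by
      rw [Real.norm_of_nonneg (hF.deriv_pos x).le]
      exact (hF.deriv_le x).trans (hF.mem_Ioo x).2.le) convex_univ (mem_univ b) (mem_univ a)
  simpa using this

theorem hasDerivAt_ionPotential (hF : IsIonStatistics F S) (s : ℝ) :
    HasDerivAt (ionPotential F) (F s) s :=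
  intervalIntegral.integral_hasDerivAt_right (hF.contDiff.continuous.intervalIntegrable _ _)
    (hF.contDiff.continuous.stronglyMeasurableAtFilter _ _) hF.contDiff.continuous.continuousAt

theorem continuous_ionPotential (hF : IsIonStatistics F S) : Continuous (ionPotential F) :=
  continuous_iff_continuousAt.2 fun s => (hF.hasDerivAt_ionPotential s).continuousAt

theorem ionPotential_tangent (hF : IsIonStatistics F S) (a b : ℝ) :
    ionPotential F a + F a * (b - a) ≤ ionPotential F b := by
  rcases lt_trichotomy a b with h | rfl | h
  · obtain ⟨c, hc, hs⟩ := exists_hasDerivAt_eq_slope (ionPotential F) F h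
      hF.continuous_ionPotential.continuousOn fun x _ => hF.hasDerivAt_ionPotential x
    rw [eq_div_iff (by linarith)] at hs
    nlinarith [hF.strictMono hc.1]
  · simp
  · obtain ⟨c, hc, hs⟩ := exists_hasDerivAt_eq_slope (ionPotential F) F h
      hF.continuous_ionPotential.continuousOn fun x _ => hF.hasDerivAt_ionPotential x
    rw [eq_div_iff (by linarith)] at hs
    nlinarith [hF.strictMono hc.2]

theorem abs_ionPotential_le (hF : IsIonStatistics F S) (a : ℝ) : |ionPotential F a| ≤ S * |a| := by
  have h := intervalIntegral.norm_integral_le_of_norm_le_const (a := 0) (b := a) (f := F) (C := S)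
    (fun x _ => by rw [Real.norm_of_nonneg (hF.mem_Ioo x).1.le]; exact (hF.mem_Ioo x).2.le)
  rw [sub_zero] at h
  exact h

variable {α : Type*} [MeasurableSpace α] {μ : Measure α} [IsFiniteMeasure μ]

theorem memLp_comp (hF : IsIonStatistics F S) {h : α → ℝ} (hh : AEStronglyMeasurable h μ)
    (p : ℝ≥0∞) : MemLp (fun x => F (h x)) p μ :=
  MemLp.of_bound (hF.contDiff.continuous.comp_aestronglyMeasurable hh) S
    (Eventually.of_forall fun x => by
      rw [Real.norm_of_nonneg (hF.mem_Ioo _).1.le]; exact (hF.mem_Ioo _).2.le)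

/-- The superposition operator `h ↦ F ∘ h` on `L²`. -/
noncomputable def superposition (hF : IsIonStatistics F S) (h : Lp ℝ 2 μ) : Lp ℝ 2 μ :=
  (hF.memLp_comp (Lp.aestronglyMeasurable h) 2).toLp _

theorem coeFn_superposition (hF : IsIonStatistics F S) (h : Lp ℝ 2 μ) :
    hF.superposition h =ᵐ[μ] fun x => F (h x) := MemLp.coeFn_toLp _

theorem integrable_ionPotential (hF : IsIonStatistics F S) (h : Lp ℝ 2 μ) :
    Integrable (fun x => ionPotential F (h x)) μ := by
  refine Integrable.mono' (((Lp.memLp h).integrable (by norm_num)).abs.const_mul S)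
    (hF.continuous_ionPotential.comp_aestronglyMeasurable (Lp.aestronglyMeasurable h))
    (Eventually.of_forall fun x => hF.abs_ionPotential_le _)

variable (μ) in
/-- The constant function one in `L²`. -/
noncomputable def oneL2 : Lp ℝ 2 μ := (memLp_const (1 : ℝ)).toLp _

theorem coeFn_oneL2 : oneL2 μ =ᵐ[μ] fun _ => (1 : ℝ) := MemLp.coeFn_toLp _

theorem inner_oneL2 (h : Lp ℝ 2 μ) : inner ℝ h (oneL2 μ) = ∫ x, h x ∂μ := by
  rw [L2.inner_def]
  refine integral_congr_ae ?_
  filter_upwards [coeFn_oneL2 (μ := μ)] with x hx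
  rw [hx]; simp

theorem norm_oneL2_sq : ‖oneL2 μ‖ ^ 2 = μ.real univ := by
  rw [← real_inner_self_eq_norm_sq, inner_oneL2, integral_congr_ae coeFn_oneL2]
  simp

theorem coeFn_smul_oneL2 (v : ℝ) : ⇑(v • oneL2 μ) =ᵐ[μ] fun _ => v := by
  filter_upwards [Lp.coeFn_smul v (oneL2 μ), coeFn_oneL2 (μ := μ)] with x h1 h2
  rw [h1, Pi.smul_apply, h2]; simp

theorem superposition_tangent (hF : IsIonStatistics F S) (h k : Lp ℝ 2 μ) :
    ∫ x, ionPotential F (h x) ∂μ + inner ℝ (hF.superposition h) (k - h) ≤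
      ∫ x, ionPotential F (k x) ∂μ := by
  have h1 : Integrable (fun x => inner ℝ (hF.superposition h x) ((k - h) x)) μ :=
    L2.integrable_inner _ _
  rw [L2.inner_def, ← integral_add (hF.integrable_ionPotential h) h1]
  refine integral_mono_ae ((hF.integrable_ionPotential h).add h1) (hF.integrable_ionPotential k) ?_
  filter_upwards [hF.coeFn_superposition h, Lp.coeFn_sub k h] with x e1 e2
  have := hF.ionPotential_tangent (h x) (k x)
  simp only [e1, e2, Pi.sub_apply, inner_real_eq_mul]
  exact this

/-- Coercivity comes from tangents at constant functions. The tangent at s has slope F(s)|Ω| - M in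
v after Mv is subtracted. As M/|Ω| is interior to the range of F, this slope takes both signs, which
gives linear growth in both directions. -/
theorem exists_isCoercivePotential (hF : IsIonStatistics F S) {M : ℝ} (hM : 0 < M)
    (hMS : M < μ.real univ * S) :
    ∃ δ A : ℝ, IsCoercivePotential (oneL2 μ) M (fun h => ∫ x, ionPotential F (h x) ∂μ)
      hF.superposition S δ A := by
  have hS : 0 < S := (hF.mem_Ioo 0).1.trans (hF.mem_Ioo 0).2
  set m := μ.real univ with hm
  have hm0 : 0 < m := by
    by_contra! h
    have : m * S ≤ 0 := mul_nonpos_of_nonpos_of_nonneg h hS.le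
    linarith
  have hMm : M / m < S := by rw [div_lt_iff₀ hm0]; linarith
  have hMm0 : 0 < M / m := by positivity
  -- F(s₁) is half the mean density M/m, and F(s₂) lies midway between M/m and S.
  obtain ⟨s₁, -, hs₁⟩ := hF.bijOn.surjOn (show M / m / 2 ∈ Ioo 0 S from ⟨by linarith, by linarith⟩)
  obtain ⟨s₂, -, hs₂⟩ := hF.bijOn.surjOn
    (show (M / m + S) / 2 ∈ Ioo 0 S from ⟨by linarith, by linarith⟩)
  have hMeq : M / m * m = M := by field_simp
  have hd1 : 0 < M - F s₁ * m := by rw [hs₁]; nlinarith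
  have hd2 : 0 < F s₂ * m - M := by rw [hs₂]; nlinarith
  set c : ℝ → ℝ := fun s => ionPotential F s * m - F s * s * m with hc
  have slope : ∀ (s v : ℝ) (k : Lp ℝ 2 μ), c s + F s * m * v - S * ‖oneL2 μ‖ * ‖k‖ ≤
      ∫ x, ionPotential F ((v • oneL2 μ - k : Lp ℝ 2 μ) x) ∂μ := by
    intro s v k
    have h1 := hF.superposition_tangent (s • oneL2 μ) (v • oneL2 μ - k)
    have e1 : hF.superposition (s • oneL2 μ) = F s • oneL2 μ := by
      refine Lp.ext ?_
      filter_upwards [hF.coeFn_superposition (s • oneL2 μ), coeFn_smul_oneL2 (μ := μ) s,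
        coeFn_smul_oneL2 (μ := μ) (F s)] with x a1 a2 a3
      rw [a1, a2, a3]
    have e2 : ∫ x, ionPotential F ((s • oneL2 μ : Lp ℝ 2 μ) x) ∂μ = ionPotential F s * m := by
      rw [integral_congr_ae (g := fun _ => ionPotential F s)]
      · rw [integral_const, smul_eq_mul, mul_comm]
      · filter_upwards [coeFn_smul_oneL2 (μ := μ) s] with x a
        rw [a]
    have e3 : v • oneL2 μ - k - s • oneL2 μ = (v - s) • oneL2 μ - k := by module
    rw [e1, e2, e3, inner_sub_right, inner_smul_left, inner_smul_left, inner_smul_right,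
      real_inner_self_eq_norm_sq, norm_oneL2_sq] at h1
    simp only [conj_trivial] at h1
    have h2 := real_inner_le_norm (oneL2 μ) k
    have h3 : F s * inner ℝ (oneL2 μ) k ≤ S * ‖oneL2 μ‖ * ‖k‖ := by
      calc F s * inner ℝ (oneL2 μ) k ≤ F s * (‖oneL2 μ‖ * ‖k‖) :=
            mul_le_mul_of_nonneg_left h2 (hF.mem_Ioo s).1.le
        _ ≤ S * (‖oneL2 μ‖ * ‖k‖) :=
            mul_le_mul_of_nonneg_right (hF.mem_Ioo s).2.le (by positivity)
        _ = _ := by ring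
    simp only [hc]
    linarith
  set A := |c s₁| + |c s₂| + S * ‖oneL2 μ‖ with hA
  refine ⟨min (M - F s₁ * m) (F s₂ * m - M), A, ?_⟩
  constructor
  · have : (fun x => ionPotential F ((0 : Lp ℝ 2 μ) x)) =ᵐ[μ] 0 := by
      filter_upwards [Lp.coeFn_zero ℝ 2 μ] with x hx
      rw [hx]; simp [ionPotential]
    rw [integral_congr_ae this]; simp
  · exact fun h k => hF.superposition_tangent h k
  · intro h k
    refine Lp.norm_le_mul_norm_of_ae_le_mul ?_
    filter_upwards [Lp.coeFn_sub (hF.superposition h) (hF.superposition k), Lp.coeFn_sub h k,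
      hF.coeFn_superposition h, hF.coeFn_superposition k] with x a1 a2 a3 a4
    rw [a1, a2, Pi.sub_apply, Pi.sub_apply, a3, a4]
    exact hF.abs_sub_le _ _
  · intro h
    refine Lp.norm_le_mul_norm_of_ae_le_mul ?_
    filter_upwards [hF.coeFn_superposition h, coeFn_oneL2 (μ := μ)] with x a1 a2
    rw [a1, a2, Real.norm_of_nonneg (hF.mem_Ioo _).1.le]
    simpa using (hF.mem_Ioo _).2.le
  · intro h k hhk
    rw [L2.inner_def] at hhk
    have e1 : (fun x => inner ℝ ((hF.superposition h - hF.superposition k) x) ((h - k) x)) =ᵐ[μ]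
        fun x => (F (h x) - F (k x)) * (h x - k x) := by
      filter_upwards [Lp.coeFn_sub (hF.superposition h) (hF.superposition k), Lp.coeFn_sub h k,
        hF.coeFn_superposition h, hF.coeFn_superposition k] with x a1 a2 a3 a4
      rw [a1, a2, Pi.sub_apply, Pi.sub_apply, a3, a4, inner_real_eq_mul]
    have hpos : ∀ a b : ℝ, 0 ≤ (F a - F b) * (a - b) := fun a b => by
      rcases le_total a b with h | h
      · exact mul_nonneg_of_nonpos_of_nonpos (sub_nonpos.2 (hF.strictMono.monotone h))
          (sub_nonpos.2 h)
      · exact mul_nonneg (sub_nonneg.2 (hF.strictMono.monotone h)) (sub_nonneg.2 h)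
    have hint : Integrable (fun x => (F (h x) - F (k x)) * (h x - k x)) μ :=
      (L2.integrable_inner (𝕜 := ℝ) (hF.superposition h - hF.superposition k) (h - k)).congr e1
    -- The integrand is nonnegative by monotonicity, so it vanishes almost everywhere, and
    -- injectivity of F applies.
    rw [integral_congr_ae e1, integral_eq_zero_iff_of_nonneg (fun x => hpos _ _) hint] at hhk
    refine Lp.ext ?_
    filter_upwards [hhk] with x hx
    rcases mul_eq_zero.1 hx with h' | h'
    · exact hF.strictMono.injective (sub_eq_zero.1 h')
    · exact sub_eq_zero.1 h'
  · positivity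
  · exact lt_min hd1 hd2
  · intro v k
    have hk := norm_nonneg k
    have n1 := neg_abs_le (c s₁)
    have n2 := neg_abs_le (c s₂)
    have n3 := abs_nonneg (c s₁)
    have n4 := abs_nonneg (c s₂)
    have n5 : 0 ≤ S * ‖oneL2 μ‖ := by positivity
    have n6 : 0 ≤ |c s₁| * ‖k‖ := by positivity
    have n7 : 0 ≤ |c s₂| * ‖k‖ := by positivity
    have hAk : A * (1 + ‖k‖) = |c s₁| + |c s₂| + S * ‖oneL2 μ‖ + |c s₁| * ‖k‖ + |c s₂| * ‖k‖ +
        S * ‖oneL2 μ‖ * ‖k‖ := by rw [hA]; ring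
    rw [hAk]
    rcases le_total 0 v with hv | hv
    · have h1 := slope s₂ v k
      have h2 := mul_le_mul_of_nonneg_right (min_le_right (M - F s₁ * m) (F s₂ * m - M)) hv
      rw [abs_of_nonneg hv]
      linarith
    · have h1 := slope s₁ v k
      have h2 := mul_le_mul_of_nonneg_right (min_le_left (M - F s₁ * m) (F s₂ * m - M))
        (neg_nonneg.2 hv)
      rw [abs_of_nonpos hv]
      linarith

end IsIonStatistics

end IonPotential

/-! ### Translation between functions on Ω and the Hilbert space problem. -/

section PoissonProblem

variable {d : ℕ} {Ω ΓD ΓN : Set (EuclideanSpace ℝ (Fin d))}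

theorem integral_mul_coeFn_add {α : Type*} [MeasurableSpace α] {μ : Measure α} {f : α → ℝ}
    {u u' : Lp ℝ 2 μ} (h : Integrable (fun x => f x * u x) μ)
    (h' : Integrable (fun x => f x * u' x) μ) :
    ∫ x, f x * (u + u' : Lp ℝ 2 μ) x ∂μ = (∫ x, f x * u x ∂μ) + ∫ x, f x * u' x ∂μ := by
  rw [← integral_add h h']
  refine integral_congr_ae ?_
  filter_upwards [Lp.coeFn_add u u'] with x hx
  rw [hx, Pi.add_apply, mul_add]

theorem integral_mul_coeFn_smul {α : Type*} [MeasurableSpace α] {μ : Measure α} (f : α → ℝ)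
    (c : ℝ) (u : Lp ℝ 2 μ) :
    ∫ x, f x * (c • u : Lp ℝ 2 μ) x ∂μ = c * ∫ x, f x * u x ∂μ := by
  rw [← integral_const_mul]
  refine integral_congr_ae ?_
  filter_upwards [Lp.coeFn_smul c u] with x hx
  rw [hx, Pi.smul_apply, smul_eq_mul, mul_left_comm]

/-- The load functional `φ ↦ ∫_Ω f φ` on `H¹_D(Ω)`. -/
theorem exists_loadFunctional (hΩ : IsBoundedLipschitzDomain Ω) (p : ℝ≥0∞)
    (hp1 : 1 ≤ p) (hpd : (d : ℝ≥0∞) / 2 < p) :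
    ∃ C : ℝ, 0 ≤ C ∧ ∀ f : EuclideanSpace ℝ (Fin d) → ℝ, MemLp f p (volume.restrict Ω) →
      ∃ ℓ : dirichletSpace Ω ΓD →L[ℝ] ℝ, ∀ w : dirichletSpace Ω ΓD,
        Integrable (fun x => f x * w.1.1 x) (volume.restrict Ω) ∧
        ℓ w = ∫ x in Ω, f x * w.1.1 x ∧
        |ℓ w| ≤ C * (eLpNorm f p (volume.restrict Ω)).toReal * (‖w.1.1‖ + ‖w.1.2‖) := by
  obtain ⟨C, hC, h⟩ := exists_dirichlet_pairing_le (ΓD := ΓD) hΩ p hp1 hpd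
  refine ⟨C, hC, fun f hf => ?_⟩
  have hadd : ∀ w w' : dirichletSpace Ω ΓD, ∫ x in Ω, f x * (w + w').1.1 x =
      (∫ x in Ω, f x * w.1.1 x) + ∫ x in Ω, f x * w'.1.1 x := fun w w' =>
    integral_mul_coeFn_add (h f hf w.1 w.2).1 (h f hf w'.1 w'.2).1
  have hsmul : ∀ (c : ℝ) (w : dirichletSpace Ω ΓD), ∫ x in Ω, f x * (c • w).1.1 x =
      c * ∫ x in Ω, f x * w.1.1 x := fun c w => integral_mul_coeFn_smul f c w.1.1
  let ℓ : dirichletSpace Ω ΓD →ₗ[ℝ] ℝ :=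
    { toFun := fun w => ∫ x in Ω, f x * w.1.1 x
      map_add' := hadd
      map_smul' := hsmul }
  refine ⟨ℓ.mkContinuous (C * (eLpNorm f p (volume.restrict Ω)).toReal * 2) fun w => ?_,
    fun w => ⟨(h f hf w.1 w.2).1, rfl, (h f hf w.1 w.2).2⟩⟩
  refine (h f hf w.1 w.2).2.trans ?_
  rw [mul_assoc _ (2 : ℝ)]
  have h1 : ‖w.1.1‖ ≤ ‖w‖ := norm_fst_le w.1
  have h2 : ‖w.1.2‖ ≤ ‖w‖ := norm_snd_le w.1
  exact mul_le_mul_of_nonneg_left (by linarith) (mul_nonneg hC ENNReal.toReal_nonneg)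

/-- Weak solutions of the Poisson problem, written in the Hilbert space `H¹_D(Ω)`. -/
theorem isPoissonWeakSolution_iff (hΩ : IsBoundedLipschitzDomain Ω)
    [IsFiniteMeasure (volume.restrict Ω)] {lam : ℝ} {z : ℤ}
    {F : ℝ → ℝ} {M σ : ℝ} {ψD f : EuclideanSpace ℝ (Fin d) → ℝ}
    {ℓ : dirichletSpace Ω ΓD →L[ℝ] ℝ} (hℓ : ∀ w : dirichletSpace Ω ΓD,
      Integrable (fun x => f x * w.1.1 x) (volume.restrict Ω) ∧ ℓ w = ∫ x in Ω, f x * w.1.1 x)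
    {v : ℝ} {ψ : EuclideanSpace ℝ (Fin d) → ℝ} (hψ : MemH1 Ω ψ)
    (hb : MemH1D Ω ΓD (fun x => ψ x - σ * ψD x)) {N : Lp ℝ 2 (volume.restrict Ω)}
    {G : Lp (EuclideanSpace ℝ (Fin d)) 2 (volume.restrict Ω)}
    (hN : (fun x => F (v - z * ψ x)) =ᵐ[volume.restrict Ω] N)
    (hG : weakGrad Ω ψ =ᵐ[volume.restrict Ω] G) :
    IsPoissonWeakSolution Ω ΓD lam z F M σ ψD f v ψ ↔
      inner ℝ N (IsIonStatistics.oneL2 (volume.restrict Ω)) = M ∧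
      ∀ φ : dirichletSpace Ω ΓD,
        lam ^ 2 * inner ℝ G φ.1.2 = σ * ℓ φ + σ * (z * inner ℝ N φ.1.1) := by
  have hmass : ∫ x in Ω, F (v - z * ψ x) =
      inner ℝ N (IsIonStatistics.oneL2 (volume.restrict Ω)) := by
    rw [IsIonStatistics.inner_oneL2, integral_congr_ae hN]
  -- Stated for an arbitrary representative φ', so that it serves both directions. The load and the
  -- charge term are integrated separately: the first is integrable by the L^p pairing, the second
  -- as an L² product.
  have pair : ∀ (φ : dirichletSpace Ω ΓD) (φ' : EuclideanSpace ℝ (Fin d) → ℝ),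
      φ' =ᵐ[volume.restrict Ω] φ.1.1 → weakGrad Ω φ' =ᵐ[volume.restrict Ω] φ.1.2 →
      Integrable (fun x => (f x + z * F (v - z * ψ x)) * φ' x) (volume.restrict Ω) ∧
      ∫ x in Ω, (f x + z * F (v - z * ψ x)) * φ' x = ℓ φ + z * inner ℝ N φ.1.1 ∧
      ∫ x in Ω, inner ℝ (weakGrad Ω ψ x) (weakGrad Ω φ' x) = inner ℝ G φ.1.2 := by
    intro φ φ' h1 h2
    have i2 : Integrable (fun x => (z : ℝ) * inner ℝ (N x) (φ.1.1 x)) (volume.restrict Ω) :=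
      (L2.integrable_inner (𝕜 := ℝ) N φ.1.1).const_mul _
    have e : (fun x => (f x + z * F (v - z * ψ x)) * φ' x) =ᵐ[volume.restrict Ω]
        fun x => f x * φ.1.1 x + z * inner ℝ (N x) (φ.1.1 x) := by
      filter_upwards [h1, hN] with x a1 a2
      rw [a1, a2, inner_real_eq_mul]; ring
    refine ⟨((hℓ φ).1.add i2).congr e.symm, ?_, ?_⟩
    · rw [integral_congr_ae e, integral_add (hℓ φ).1 i2, integral_const_mul, (hℓ φ).2, L2.inner_def]
    · rw [L2.inner_def]
      refine integral_congr_ae ?_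
      filter_upwards [h2, hG] with x a1 a2
      rw [a1, a2]
  constructor
  · intro h
    refine ⟨hmass.symm.trans h.mass, fun φ => ?_⟩
    obtain ⟨hφ, hφg⟩ := IsDirichletLimit.memH1D hΩ (Lp.memLp φ.1.1) (Lp.memLp φ.1.2) φ.2
    obtain ⟨-, e1, e2⟩ := pair φ _ EventuallyEq.rfl hφg
    exact (congrArg (lam ^ 2 * ·) e2).symm.trans ((h.equation _ hφ).trans
      ((congrArg (σ * ·) e1).trans (mul_add _ _ _)))
  · rintro ⟨hm, heq⟩
    have test : ∀ φ, MemH1D Ω ΓD φ → ∃ φ' : dirichletSpace Ω ΓD,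
        φ =ᵐ[volume.restrict Ω] φ'.1.1 ∧ weakGrad Ω φ =ᵐ[volume.restrict Ω] φ'.1.2 := fun φ hφ =>
      ⟨⟨_, hφ.toLp_mem⟩, (MemLp.coeFn_toLp hφ.1.1).symm,
        (MemLp.coeFn_toLp (weakGrad_spec hφ.1).1).symm⟩
    refine ⟨hψ, hb, fun φ hφ => ?_, fun φ hφ => ?_, hmass.trans hm⟩
    · obtain ⟨φ', h1, h2⟩ := test φ hφ
      exact (pair φ' φ h1 h2).1
    · obtain ⟨φ', h1, h2⟩ := test φ hφ
      obtain ⟨-, e1, e2⟩ := pair φ' φ h1 h2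
      exact (congrArg (lam ^ 2 * ·) e2).trans ((heq φ').trans
        ((congrArg (σ * ·) e1).trans (mul_add _ _ _)).symm)

/-- The correspondence between `ψ` and `u = ψ - σ ψD ∈ H¹_D(Ω)`. -/
theorem dirichletSpace_shift (hΩ : IsBoundedLipschitzDomain Ω)
    {ψD ψ : EuclideanSpace ℝ (Fin d) → ℝ} (hψD : MemH1 Ω ψD) {σ : ℝ}
    {h₀ : Lp ℝ 2 (volume.restrict Ω)} {g₀ : Lp (EuclideanSpace ℝ (Fin d)) 2 (volume.restrict Ω)}
    (hh₀ : ψD =ᵐ[volume.restrict Ω] h₀) (hg₀ : weakGrad Ω ψD =ᵐ[volume.restrict Ω] g₀)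
    {a : Lp ℝ 2 (volume.restrict Ω)} {b : Lp (EuclideanSpace ℝ (Fin d)) 2 (volume.restrict Ω)}
    (hab : (a, b) ∈ dirichletSpace Ω ΓD)
    (hw : (fun x => ψ x - σ * ψD x) =ᵐ[volume.restrict Ω] a) :
    MemH1 Ω ψ ∧ MemH1D Ω ΓD (fun x => ψ x - σ * ψD x) ∧
      ψ =ᵐ[volume.restrict Ω] (σ • h₀ + a : Lp ℝ 2 (volume.restrict Ω)) ∧
      weakGrad Ω ψ =ᵐ[volume.restrict Ω]
        (b + σ • g₀ : Lp (EuclideanSpace ℝ (Fin d)) 2 (volume.restrict Ω)) := by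
  have hu : MemLp (fun x => ψ x - σ * ψD x) 2 (volume.restrict Ω) :=
    (memLp_congr_ae hw).2 (Lp.memLp a)
  obtain ⟨huD, hug⟩ := IsDirichletLimit.memH1D hΩ hu (Lp.memLp b)
    (IsDirichletLimit.congr hab hw.symm EventuallyEq.rfl)
  have hψeq : ψ = fun x => 1 * (ψ x - σ * ψD x) + σ * ψD x := by ext x; ring
  have hψ : MemH1 Ω ψ := by rw [hψeq]; exact huD.1.combo hψD 1 σ
  refine ⟨hψ, huD, ?_, ?_⟩
  · filter_upwards [hw, hh₀, Lp.coeFn_add (σ • h₀) a, Lp.coeFn_smul σ h₀] with x a1 a2 a3 a4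
    rw [a3, Pi.add_apply, a4, Pi.smul_apply, ← a1, ← a2, smul_eq_mul]; ring
  · have h1 := MemH1.weakGrad_combo hΩ.isOpen huD.1 hψD 1 σ
    rw [← hψeq] at h1
    filter_upwards [h1, hug, hg₀, Lp.coeFn_add b (σ • g₀), Lp.coeFn_smul σ g₀]
      with x a1 a2 a3 a4 a5
    rw [a1, a2, a4, Pi.add_apply, a5, Pi.smul_apply, a3, one_smul]

theorem IsIonStatistics.comp_ae_eq_superposition [IsFiniteMeasure (volume.restrict Ω)]
    {F : ℝ → ℝ} {S : ℝ} (hF : IsIonStatistics F S) (v z : ℝ)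
    {ψ : EuclideanSpace ℝ (Fin d) → ℝ} {k : Lp ℝ 2 (volume.restrict Ω)}
    (hk : ψ =ᵐ[volume.restrict Ω] k) :
    (fun x => F (v - z * ψ x)) =ᵐ[volume.restrict Ω]
      hF.superposition (v • IsIonStatistics.oneL2 (volume.restrict Ω) - z • k) := by
  filter_upwards [hF.coeFn_superposition (v • IsIonStatistics.oneL2 (volume.restrict Ω) - z • k),
    hk, IsIonStatistics.coeFn_smul_oneL2 (μ := volume.restrict Ω) v,
    Lp.coeFn_sub (v • IsIonStatistics.oneL2 (volume.restrict Ω)) (z • k),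
    Lp.coeFn_smul z k] with x a1 a2 a3 a4 a5
  rw [a1, a4, Pi.sub_apply, a3, a5, Pi.smul_apply, a2, smul_eq_mul]

theorem h1Norm_sq {u : EuclideanSpace ℝ (Fin d) → ℝ}
    {a : Lp ℝ 2 (volume.restrict Ω)} {b : Lp (EuclideanSpace ℝ (Fin d)) 2 (volume.restrict Ω)}
    (ha : u =ᵐ[volume.restrict Ω] a) (hb : weakGrad Ω u =ᵐ[volume.restrict Ω] b) :
    h1Norm Ω u ^ 2 = ‖a‖ ^ 2 + ‖b‖ ^ 2 := by
  rw [h1Norm, Real.sq_sqrt (by positivity), eLpNorm_congr_ae ha, eLpNorm_congr_ae hb, Lp.norm_def,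
    Lp.norm_def]

/-- The quantitative part of the a priori estimate. -/
theorem solution_estimate {r u k g h n v σ P C c ζ E A δ : ℝ} (hσ : σ ∈ Icc (0 : ℝ) 1)
    (hP : 0 ≤ P) (hC : 0 ≤ C) (hc : 0 ≤ c) (hζ : 0 ≤ ζ) (hE : 0 ≤ E) (hA : 0 ≤ A) (hδ : 0 < δ)
    (hk0 : 0 ≤ k) (hu0 : 0 ≤ u)
    (hr : r ≤ σ * (g + c * (C * (P + 1) * n + ζ * E * P)))
    (hk : k ≤ σ * h + P * r) (hu : u ≤ r + σ * g)
    (hv : δ * |v| ≤ (A + E) * (1 + ζ * k)) :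
    σ * |v| + (k ^ 2 + u ^ 2) ≤ σ * ((A + E) * (1 + ζ * (1 + P * (1 + c * (C * (P + 1) + ζ * E * P))))
      / δ + (1 + P * (1 + c * (C * (P + 1) + ζ * E * P))) ^ 2 +
      (2 + c * (C * (P + 1) + ζ * E * P)) ^ 2) * (1 + (h ^ 2 + g ^ 2) + n ^ 2) := by
  set b := c * (C * (P + 1) + ζ * E * P) with hb
  have hb0 : 0 ≤ b := by positivity
  set Q := 1 + (h ^ 2 + g ^ 2) + n ^ 2 with hQ
  have hh2 := sq_nonneg h
  have hg2 := sq_nonneg g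
  have hn2 := sq_nonneg n
  -- q dominates 1, h, g and n. The linear bounds thus become multiples of q, and their squares
  -- multiples of Q.
  set q := √Q with hq
  have hQ1 : 1 ≤ Q := by linarith
  have hqQ : q ^ 2 = Q := Real.sq_sqrt (by linarith)
  have hq1 : 1 ≤ q := Real.one_le_sqrt.2 hQ1
  have hqq : q ≤ Q := by rw [← hqQ]; exact le_self_pow₀ hq1 two_ne_zero
  have hhq : h ≤ q := Real.le_sqrt_of_sq_le (by linarith)
  have hgq : g ≤ q := Real.le_sqrt_of_sq_le (by linarith)
  have hnq : n ≤ q := Real.le_sqrt_of_sq_le (by linarith)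
  have hσ0 := hσ.1
  have hr' : r ≤ σ * ((1 + b) * q) := by
    refine hr.trans (mul_le_mul_of_nonneg_left ?_ hσ0)
    calc g + c * (C * (P + 1) * n + ζ * E * P)
        ≤ q + c * (C * (P + 1) * q + ζ * E * P * q) := by
          have : ζ * E * P ≤ ζ * E * P * q := le_mul_of_one_le_right (by positivity) hq1
          gcongr
      _ = (1 + b) * q := by rw [hb]; ring
  have hk' : k ≤ σ * ((1 + P * (1 + b)) * q) := by
    calc k ≤ σ * h + P * r := hk
      _ ≤ σ * q + P * (σ * ((1 + b) * q)) := by gcongr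
      _ = _ := by ring
  have hu' : u ≤ σ * ((2 + b) * q) := by
    calc u ≤ r + σ * g := hu
      _ ≤ σ * ((1 + b) * q) + σ * q := by gcongr
      _ = _ := by ring
  -- Squaring produces σ², and σ ≤ 1 reduces it to the single factor σ of the estimate.
  have hsq : ∀ {x y : ℝ}, 0 ≤ x → x ≤ σ * (y * q) → x ^ 2 ≤ σ * (y ^ 2 * Q) := by
    intro x y hx hxy
    calc x ^ 2 ≤ (σ * (y * q)) ^ 2 := by gcongr
      _ = σ * σ * (y ^ 2 * Q) := by rw [← hqQ]; ring
      _ ≤ σ * 1 * (y ^ 2 * Q) := by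
          gcongr
          exact hσ.2
      _ = _ := by ring
  have k1 := hsq hk0 hk'
  have k2 := hsq hu0 hu'
  have hkQ : k ≤ (1 + P * (1 + b)) * Q := by
    calc k ≤ σ * ((1 + P * (1 + b)) * q) := hk'
      _ ≤ 1 * ((1 + P * (1 + b)) * Q) := by
          gcongr
          exact hσ.2
      _ = _ := one_mul _
  have hv' : |v| ≤ (A + E) * (1 + ζ * (1 + P * (1 + b))) / δ * Q := by
    rw [div_mul_eq_mul_div, le_div_iff₀ hδ, mul_comm |v|]
    calc δ * |v| ≤ (A + E) * (1 + ζ * k) := hv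
      _ ≤ (A + E) * (Q + ζ * ((1 + P * (1 + b)) * Q)) := by gcongr
      _ = _ := by ring
  have k3 := mul_le_mul_of_nonneg_left hv' hσ0
  linarith

end PoissonProblem

/-! ### The main theorem. -/

set_option maxHeartbeats 1000000 in
/-- The constant `K` depends only on `Ω`, `ΓD`, `p`, `lam`, `F`, `M` and `zabs = |z|`, and not on
`σ`, `ψD`, `f`. -/
theorem mainTheorem6 (d : ℕ) (hd : 1 ≤ d) (Ω ΓD ΓN : Set (EuclideanSpace ℝ (Fin d)))
    (hΩ : IsBoundedLipschitzDomain Ω) (hΓ : IsBoundarySplitting Ω ΓD ΓN)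
    (lam : ℝ) (hlam : 0 < lam) (F : ℝ → ℝ) (S : ℝ) (hF : IsIonStatistics F S)
    (M : ℝ) (hM : 0 < M) (hMS : M < (volume Ω).toReal * S)
    (p : ℝ≥0∞) (hp1 : 1 ≤ p) (hpd : (d : ℝ≥0∞) / 2 < p) (zabs : ℕ) :
    ∃ K : ℝ, 0 < K ∧
      ∀ z : ℤ, z.natAbs = zabs →
      ∀ ψD : EuclideanSpace ℝ (Fin d) → ℝ, MemH1 Ω ψD → MemLp ψD ∞ (volume.restrict Ω) →
      ∀ f : EuclideanSpace ℝ (Fin d) → ℝ, MemLp f p (volume.restrict Ω) →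
      ∀ σ ∈ Icc (0 : ℝ) 1,
        ∃ (v : ℝ) (ψ : EuclideanSpace ℝ (Fin d) → ℝ),
          IsPoissonWeakSolution Ω ΓD lam z F M σ ψD f v ψ ∧
          (∀ (v' : ℝ) (ψ' : EuclideanSpace ℝ (Fin d) → ℝ),
            IsPoissonWeakSolution Ω ΓD lam z F M σ ψD f v' ψ' →
              v' = v ∧ ψ' =ᵐ[volume.restrict Ω] ψ) ∧
          σ * |v| + h1Norm Ω ψ ^ 2 ≤
            σ * K * (1 + h1Norm Ω ψD ^ 2 + (eLpNorm f p (volume.restrict Ω)).toReal ^ 2) := by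
  have hfin : IsFiniteMeasure (volume.restrict Ω) :=
    ⟨by simpa using hΩ.isBounded.measure_lt_top⟩
  have hreal : (volume.restrict Ω).real univ = (volume Ω).toReal := by
    simp [Measure.real]
  obtain ⟨P, hP0, hP⟩ := exists_norm_fst_le hd hΩ hΓ
  obtain ⟨C, hC0, hC⟩ := exists_loadFunctional (ΓD := ΓD) hΩ p hp1 hpd
  obtain ⟨δ, A, hΨ⟩ := hF.exists_isCoercivePotential (μ := volume.restrict Ω) hM
    (by rw [hreal]; exact hMS)
  set e := IsIonStatistics.oneL2 (volume.restrict Ω) with he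
  have hSe : 0 ≤ S * ‖e‖ := (norm_nonneg _).trans (hΨ.norm_le 0)
  have he0 : e ≠ 0 := by
    intro h
    have h1 := IsIonStatistics.norm_oneL2_sq (μ := volume.restrict Ω)
    rw [← he, h, norm_zero, hreal, zero_pow two_ne_zero] at h1
    rw [← h1, zero_mul] at hMS
    exact hMS.not_gt hM
  have hA := hΨ.nonneg
  have hδ := hΨ.pos
  -- The constant of `solution_estimate` with c = λ⁻², ζ = |z| and E = S‖e‖. Here P is the
  -- Poincaré-Friedrichs constant and C that of the load pairing.
  refine ⟨(A + S * ‖e‖) * (1 + zabs * (1 + P * (1 + (lam ^ 2)⁻¹ *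
      (C * (P + 1) + zabs * (S * ‖e‖) * P)))) / δ +
      (1 + P * (1 + (lam ^ 2)⁻¹ * (C * (P + 1) + zabs * (S * ‖e‖) * P))) ^ 2 +
      (2 + (lam ^ 2)⁻¹ * (C * (P + 1) + zabs * (S * ‖e‖) * P)) ^ 2, by positivity,
    fun z hz ψD hψD _ f hf σ hσ => ?_⟩
  obtain ⟨ℓ, hℓ⟩ := hC f hf
  have hℓ' : ∀ w : dirichletSpace Ω ΓD,
      Integrable (fun x => f x * w.1.1 x) (volume.restrict Ω) ∧ ℓ w = ∫ x in Ω, f x * w.1.1 x :=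
    fun w => ⟨(hℓ w).1, (hℓ w).2.1⟩
  have habsz : |(z : ℝ)| = zabs := by rw [← hz, Nat.cast_natAbs, Int.cast_abs]
  obtain ⟨h₀, hh₀⟩ : ∃ h₀ : Lp ℝ 2 (volume.restrict Ω), ψD =ᵐ[volume.restrict Ω] h₀ :=
    ⟨hψD.1.toLp ψD, (MemLp.coeFn_toLp hψD.1).symm⟩
  obtain ⟨g₀, hg₀⟩ : ∃ g₀ : Lp (EuclideanSpace ℝ (Fin d)) 2 (volume.restrict Ω),
      weakGrad Ω ψD =ᵐ[volume.restrict Ω] g₀ :=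
    ⟨(weakGrad_spec hψD).1.toLp _, (MemLp.coeFn_toLp (weakGrad_spec hψD).1).symm⟩
  obtain ⟨v, w, hm, hw⟩ : ∃ (v : ℝ) (w : dirichletSpace Ω ΓD),
      inner ℝ (hF.superposition (v • e - (z : ℝ) • (σ • h₀ + w.1.1))) e = M ∧
      ∀ φ : dirichletSpace Ω ΓD, lam ^ 2 * inner ℝ (w.1.2 + σ • g₀) φ.1.2 = σ * ℓ φ +
        σ * (z * inner ℝ (hF.superposition (v • e - (z : ℝ) • (σ • h₀ + w.1.1))) φ.1.1) :=
    hΨ.exists_scaled_solution isClosed_dirichletSpace hP hlam hσ.1 h₀ g₀ ℓ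
  -- Used in both directions: to turn the Hilbert space solution into a weak solution, and to bring
  -- any competing solution into the setting of `unique`.
  have iff_solution : ∀ (v : ℝ) (ψ : EuclideanSpace ℝ (Fin d) → ℝ) (w : dirichletSpace Ω ΓD),
      (fun x => ψ x - σ * ψD x) =ᵐ[volume.restrict Ω] w.1.1 →
      (IsPoissonWeakSolution Ω ΓD lam z F M σ ψD f v ψ ↔
        inner ℝ (hF.superposition (v • e - (z : ℝ) • (σ • h₀ + w.1.1))) e = M ∧
        ∀ φ : dirichletSpace Ω ΓD, lam ^ 2 * inner ℝ (w.1.2 + σ • g₀) φ.1.2 = σ * ℓ φ +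
          σ * (z * inner ℝ (hF.superposition (v • e - (z : ℝ) • (σ • h₀ + w.1.1))) φ.1.1)) := by
    intro v ψ w hw
    obtain ⟨k1, k2, k3, k4⟩ := dirichletSpace_shift hΩ hψD hh₀ hg₀ w.2 hw
    exact isPoissonWeakSolution_iff hΩ hℓ' k1 k2 (hF.comp_ae_eq_superposition v z k3) k4
  have hae : (fun x => (σ * ψD x + w.1.1 x) - σ * ψD x) =ᵐ[volume.restrict Ω] w.1.1 :=
    Eventually.of_forall fun x => add_sub_cancel_left _ _
  refine ⟨v, fun x => σ * ψD x + w.1.1 x, (iff_solution v _ w hae).2 ⟨hm, hw⟩,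
    fun v' ψ' h' => ?_, ?_⟩
  · obtain ⟨w', hw'⟩ : ∃ w' : dirichletSpace Ω ΓD,
        (fun x => ψ' x - σ * ψD x) =ᵐ[volume.restrict Ω] w'.1.1 :=
      ⟨⟨_, h'.boundary.toLp_mem⟩, (MemLp.coeFn_toLp h'.boundary.1.1).symm⟩
    obtain ⟨hm2, hw2⟩ := (iff_solution v' ψ' w' hw').1 h'
    obtain ⟨hv, rfl⟩ := hΨ.unique he0 hP hlam hσ.1 hm2 hm hw2 hw
    refine ⟨hv, ?_⟩
    filter_upwards [hw'] with x hx
    rw [← hx, add_sub_cancel]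
  · obtain ⟨-, -, k3, k4⟩ := dirichletSpace_shift hΩ hψD hh₀ hg₀ w.2 hae
    rw [h1Norm_sq k3 k4, h1Norm_sq hh₀ hg₀]
    set n := (eLpNorm f p (volume.restrict Ω)).toReal
    have hn0 : 0 ≤ n := ENNReal.toReal_nonneg
    have hℓw : |ℓ w| ≤ C * (P + 1) * n * ‖w.1.2‖ := by
      refine (hℓ w).2.2.trans ?_
      calc C * n * (‖w.1.1‖ + ‖w.1.2‖) ≤ C * n * (P * ‖w.1.2‖ + ‖w.1.2‖) :=
            mul_le_mul_of_nonneg_left (add_le_add_left (hP w.1 w.2) _) (mul_nonneg hC0 hn0)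
        _ = _ := by ring
    have hr := hΨ.norm_snd_le hP hP0 (b := C * (P + 1) * n) (by positivity) hlam hσ.1 hℓw (hw w)
    have hv := hΨ.abs_le hm
    rw [norm_smul, Real.norm_eq_abs, habsz] at hv
    rw [habsz] at hr
    refine solution_estimate hσ hP0 hC0 (by positivity) (by positivity) hSe hA hδ (norm_nonneg _)
      (norm_nonneg _) hr ?_ ?_ hv
    · refine (norm_add_le _ _).trans (add_le_add ?_ (hP w.1 w.2))
      rw [norm_smul, Real.norm_of_nonneg hσ.1]
    · refine (norm_add_le _ _).trans (add_le_add le_rfl ?_)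
      rw [norm_smul, Real.norm_of_nonneg hσ.1]
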